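/- **Resourceful contextual bandits.** There are $K$ actions, $d$ resources, a time horizon $T\in\mathbb N$, budgets $B_1,\dots,B_d>0$, a measurable space $X$ of contexts (possibly infinite), and a nonempty finite set $\Pi$ of policies, i.e. (measurable) maps from $X$ to the set of actions. Time is one of the $d$ resources: its budget is $T$ and every action consumes exactly one unit of it per round. An outcome distribution $D$ is a joint probability distribution of a context $x\in X$, a reward $r(a)\in[0,1]$ for each action $a$ and a consumption $c_i(a)\in[0,1]$ for each action $a$ and resource $i$. In each round, $(x,r,c)$ is drawn independently from $D$; the algorithm sees $x$, chooses an action $a$ (possibly at random, depending on what it observed in the previous rounds), and then observes only $r(a)$ and $c_1(a),\dots,c_d(a)$. It stops in the first round in which the total consumption of some resource $i$ exceeds $B_i$; its total reward $\mathrm{REW}$ is the sum of the rewards of the rounds strictly before that one. Initially the algorithm knows $K$, $d$, $T$, $(B_i)_i$, $\Pi$ and the distribution $D_X$ of contexts, and nothing else about $D$. Put $B=\min_i B_i$, and let $\mathrm{OPT}(\Pi)$ be the supremum of the expected total rewards of algorithms that know $D$ and that in each round, before they see the context, commit to a policy in $\Pi$, whose action they then take. **Theorem.** There are an absolute constant $C>0$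 and an algorithm which, for every such problem (all $X$, $K$, $d$, $T$, $(B_i)_i$, $\Pi$, $D_X$) and every outcome distribution $D$ with context distribution $D_X$, achieves expected total reward $$\mathbb E[\mathrm{REW}]\;\ge\;\mathrm{OPT}(\Pi)-C\left(1+\frac{\mathrm{OPT}(\Pi)}{B}\right)\sqrt{dKT\,\log\bigl(dKT\,|\Pi|\bigr)} .$$ -/

import Mathlib

universe u

noncomputable section

namespace ResourcefulBandits

open MeasureTheory

/-- The reward and the consumption of each of the `d` resources caused by one action. -/
abbrev Payoff (d : ℕ) : Type := ℝ × (Fin d → ℝ)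

/-- What one round of the environment holds: the context, and the payoff of every action. -/
abbrev Outcome (X : Type u) (K d : ℕ) : Type u := X × (Fin K → Payoff d)

/-- What an algorithm gets to see of one round: the context, the chosen action, and the payoff of
that action only (bandit feedback). -/
abbrev Observation (X : Type u) (K d : ℕ) : Type u := X × Fin K × Payoff d

/-- The part of an instance of resourceful contextual bandits that is known to the algorithm:
the actions `Fin K`, the resources `Fin d` (time is one of them), the horizon `T`, the budgets,
the finite policy set and the distribution of context arrivals. -/
structure KnownData (X : Type u) [MeasurableSpace X] where
  /-- number of actions -/
  K : ℕ
  /-- number of resources, time included -/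
  d : ℕ
  /-- time horizon -/
  T : ℕ
  /-- budget of each resource -/
  budget : Fin d → ℝ
  budget_pos : ∀ i, 0 < budget i
  /-- the resource that is time -/
  time : Fin d
  budget_time : budget time = T
  /-- the finite set of policies -/
  policies : Finset (X → Fin K)
  policies_nonempty : policies.Nonempty
  policies_measurable : ∀ π ∈ policies, Measurable π
  /-- the distribution of context arrivals -/
  contextLaw : Measure X
  contextLaw_prob : IsProbabilityMeasure contextLaw

/-- The smallest budget. -/
def KnownData.minBudget {X : Type u} [MeasurableSpace X] (I : KnownData X) : ℝ :=
  ⨅ i, I.budget i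

/-- The probability measure `D` is an outcome distribution for the known data `I`: it is the law of
the context jointly with the payoffs of all actions, with the known distribution of contexts, with
rewards and consumptions in `[0, 1]` (correlated arbitrarily), and in which every action consumes
exactly one unit of time. -/
structure IsOutcomeDistribution {X : Type u} [MeasurableSpace X] (I : KnownData X)
    (D : Measure (Outcome X I.K I.d)) : Prop where
  context : D.map Prod.fst = I.contextLaw
  reward_mem : ∀ᵐ o ∂D, ∀ a, (o.2 a).1 ∈ Set.Icc (0 : ℝ) 1
  consumption_mem : ∀ᵐ o ∂D, ∀ a i, (o.2 a).2 i ∈ Set.Icc (0 : ℝ) 1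
  consumption_time : ∀ᵐ o ∂D, ∀ a, (o.2 a).2 I.time = 1

/-- A (randomized) algorithm: a private random seed, drawn once and independently of the
environment, and a mapping that sends the seed, the observations of the rounds before round `t`
and the context of round `t` to an action. Rounds are numbered from `0`. -/
structure Algorithm (X : Type u) [MeasurableSpace X] (K d : ℕ) where
  /-- values of the private random seed -/
  Seed : Type
  [seedSpace : MeasurableSpace Seed]
  /-- distribution of the private random seed -/
  seedLaw : Measure Seed
  seedLaw_prob : IsProbabilityMeasure seedLaw
  /-- the choice of the action -/
  act : Seed → (t : ℕ) → (Fin t → Observation X K d) → X → Fin K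
  measurable_act : ∀ t, Measurable
    fun p : Seed × (Fin t → Observation X K d) × X => act p.1 t p.2.1 p.2.2

attribute [instance] Algorithm.seedSpace Algorithm.seedLaw_prob

attribute [instance] KnownData.contextLaw_prob

namespace Algorithm

variable {X : Type u} [MeasurableSpace X] {K d : ℕ}

/-- The observations of the first `t` rounds, when the algorithm runs with seed `s` against the
sequence of outcomes `ω`. -/
def history (alg : Algorithm X K d) (s : alg.Seed) (ω : ℕ → Outcome X K d) :
    (t : ℕ) → Fin t → Observation X K d
  | 0 => Fin.elim0
  | t + 1 =>
    let h := history alg s ω t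
    let a := alg.act s t h (ω t).1
    Fin.snoc (α := fun _ => Observation X K d) h ((ω t).1, a, (ω t).2 a)

/-- The action chosen in round `t`. -/
def action (alg : Algorithm X K d) (s : alg.Seed) (ω : ℕ → Outcome X K d) (t : ℕ) : Fin K :=
  alg.act s t (alg.history s ω t) (ω t).1

/-- The reward obtained in round `t`. -/
def reward (alg : Algorithm X K d) (s : alg.Seed) (ω : ℕ → Outcome X K d) (t : ℕ) : ℝ :=
  ((ω t).2 (alg.action s ω t)).1

/-- The amount of resource `i` consumed in round `t`. -/
def consumption (alg : Algorithm X K d) (s : alg.Seed) (ω : ℕ → Outcome X K d) (t : ℕ)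
    (i : Fin d) : ℝ :=
  ((ω t).2 (alg.action s ω t)).2 i

/-- No budget has been exceeded in any of the rounds up to and including round `t`. -/
def WithinBudget (alg : Algorithm X K d) (budget : Fin d → ℝ) (s : alg.Seed)
    (ω : ℕ → Outcome X K d) (t : ℕ) : Prop :=
  ∀ n ≤ t, ∀ i, ∑ m ∈ Finset.range (n + 1), alg.consumption s ω m i ≤ budget i

open Classical in
/-- The total reward over the horizon `T`: the algorithm stops in the first round in which some
budget is exceeded, and collects the rewards of the rounds strictly before it. -/
def totalReward (alg : Algorithm X K d) (T : ℕ) (budget : Fin d → ℝ) (s : alg.Seed)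
    (ω : ℕ → Outcome X K d) : ℝ :=
  ∑ t ∈ Finset.range T, if alg.WithinBudget budget s ω t then alg.reward s ω t else 0

/-- The expected total reward, when the outcomes of the rounds are drawn independently from `D`
and the seed is independent of them. -/
def expectedReward (alg : Algorithm X K d) (T : ℕ) (budget : Fin d → ℝ)
    (D : Measure (Outcome X K d)) [IsProbabilityMeasure D] : ℝ :=
  ∫ p : alg.Seed × (ℕ → Outcome X K d), alg.totalReward T budget p.1 p.2
    ∂(alg.seedLaw.prod (Measure.infinitePi fun _ : ℕ => D))

/-- In every round, before the context is seen, the algorithm commits to one of the given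
policies, and then chooses the action that this policy assigns to the context. -/
def CommitsTo (alg : Algorithm X K d) (policies : Finset (X → Fin K)) : Prop :=
  ∀ s t h, alg.act s t h ∈ policies

end Algorithm

/-- The benchmark: the best expected total reward, under the given outcome distribution `D`, of an
algorithm that commits to a policy of the policy set in each round. The supremum is taken for a
fixed `D`, so that the benchmark knows `D`. -/
def KnownData.benchmark {X : Type u} [MeasurableSpace X] (I : KnownData X)
    (D : Measure (Outcome X I.K I.d)) [IsProbabilityMeasure D] : ℝ :=
  sSup {v : ℝ | ∃ alg : Algorithm X I.K I.d, alg.CommitsTo I.policies ∧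
    v = alg.expectedReward I.T I.budget D}

end ResourcefulBandits

end

/-!
The algorithm plays two multiplicative-weights learners against each other. Write
`S = √(d K T log (d K T |Π|))`.

*Linear program.* Replace a policy by its mean reward and its mean consumption, where the
consumption of resource `i` is scaled by `B / B i`, so that all budgets become `B`. Let `V` be the
largest reward that a sub-probability vector over the policies collects in `T` rounds without
exceeding `B` in the mean (`lpValue`). The average usage of the policies by an algorithm that
knows `D` is feasible up to a factor `1 + 1 / B`, because the consumption exceeds a budget by at
most one round. Hence `OPT(Π) ≤ (1 + 1 / B) V` (`benchmark_le_lpValue`), and it suffices to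
compete with every feasible vector `P`.

*Price.* The Lagrangian relaxation needs an exchange rate `Z` between reward and resources with
`V / B ≤ Z = O((V + S) / B)`. A warm-up of about `S` uniformly random rounds suffices for that: with
multiplicative Chernoff bounds it determines all mean rewards and mean consumptions up to a
constant factor and an additive error of order `S / T`, which determines `V` up to a constant
factor and an additive error of order `S` (`lpValue_le_of_close`, `Regime.integral_goodPrice`).

*Two players.* After the warm-up, the payoff of an action is its reward minus `Z` times its
consumption, averaged over the resources with weights proportional to `exp (S / T * consumption)`.
The policies receive exponential weights with importance-weighted estimates of that payoff,
uniform exploration, and one more expert of constant weight `1` which does nothing. Doing nothing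
costs nothing but time, so it need not be played: a round is instead an action drawn conditionally
on acting, and virtual time advances by the mean number `1 / mass` of trials that this would take.
Virtual time enters as the consumption of the resource time.

*Potential.* The logarithms of the total weights of both players, minus the estimated payoff of
`P`, plus a multiple of the virtual time, form a potential. In each round its expected growth is
at most the expected reward, up to second-order terms of total size `O((1 + Z) S)`
(`Regime.stepMean_surplus_nonneg`, made applicable to the interaction by
`Strategy.integral_step`). It starts at `O((1 + Z) S)` (`Regime.potential_start_le`), and once a
budget is used up, in particular once virtual time is, it has reached the reward of `P` up to
`O((1 + Z) S)` (`Regime.le_potential_end`), since `Z` times the exhausted budget exceeds what `P`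
could still gain. As `(1 + Z) S = O((1 + V / B) S)` when `S ≤ B`, this is the claim. If
`B < 400 S` the bound is not positive, and if `K = 1` all algorithms coincide.
-/

noncomputable section

open MeasureTheory

/-! ### Resampling a coordinate of a product measure -/

theorem measurePreserving_update_infinitePi {Y : Type*} [MeasurableSpace Y] (ν : Measure Y)
    [IsProbabilityMeasure ν] (t : ℕ) :
    MeasurePreserving (fun p : (ℕ → Y) × Y => Function.update p.1 t p.2)
      ((Measure.infinitePi fun _ : ℕ => ν).prod ν) (Measure.infinitePi fun _ : ℕ => ν) := by
  have hm : Measurable (fun p : (ℕ → Y) × Y => Function.update p.1 t p.2) := by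
    refine measurable_pi_lambda _ fun i => ?_
    by_cases h : i = t
    · subst h; simpa using measurable_snd
    · simp only [Function.update_of_ne h]
      exact (measurable_pi_apply i).comp measurable_fst
  refine ⟨hm, ?_⟩
  refine Measure.eq_infinitePi (μ := fun _ : ℕ => ν) fun s A hA => ?_
  rw [Measure.map_apply hm (MeasurableSet.pi s.countable_toSet fun i _ => hA i)]
  by_cases ht : t ∈ s
  · have : (fun p : (ℕ → Y) × Y => Function.update p.1 t p.2) ⁻¹' (Set.pi s A)
        = (Set.pi (s.erase t) A) ×ˢ (A t) := by
      ext ⟨ω, y⟩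
      simp only [Set.mem_preimage, Set.mem_pi, Set.mem_prod, Finset.mem_coe, Finset.mem_erase]
      constructor
      · intro h
        refine ⟨fun i hi => ?_, ?_⟩
        · simpa [Function.update_of_ne hi.1] using h i hi.2
        · simpa using h t ht
      · rintro ⟨h1, h2⟩ i hi
        by_cases hit : i = t
        · subst hit; simpa using h2
        · simpa [Function.update_of_ne hit] using h1 i ⟨hit, hi⟩
    rw [this, Measure.prod_prod, Measure.infinitePi_pi (μ := fun _ : ℕ => ν) (fun i _ => hA i),
      mul_comm, Finset.mul_prod_erase s (fun i => ν (A i)) ht]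
  · have : (fun p : (ℕ → Y) × Y => Function.update p.1 t p.2) ⁻¹' (Set.pi s A)
        = (Set.pi s A) ×ˢ Set.univ := by
      ext ⟨ω, y⟩
      simp only [Set.mem_preimage, Set.mem_pi, Set.mem_prod, Finset.mem_coe, Set.mem_univ, and_true]
      refine forall₂_congr fun i hi => ?_
      have hit : i ≠ t := fun h => ht (h ▸ hi)
      simp [Function.update_of_ne hit]
    rw [this, Measure.prod_prod, Measure.infinitePi_pi (μ := fun _ : ℕ => ν) (fun i _ => hA i)]
    simp

/-! ### Sampling from a finite distribution -/

/-- Inverse-transform sampling from the weights `p` with the quantile `u`: the number of partial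
sums of `p` that are at most `u`, and the fallback `a₀` if this is not a legal index. -/
def samplePick {K : ℕ} (a₀ : Fin K) (p : Fin K → ℝ) (u : ℝ) : Fin K :=
  if h : (∑ a : Fin K, if ∑ b ∈ Finset.Iic a, p b ≤ u then 1 else 0) < K then
    ⟨∑ a : Fin K, if ∑ b ∈ Finset.Iic a, p b ≤ u then 1 else 0, h⟩ else a₀

theorem measurable_samplePick {K : ℕ} {α : Type*} [MeasurableSpace α] {a₀ : α → Fin K}
    {p : α → Fin K → ℝ} {u : α → ℝ} (ha : Measurable a₀) (hp : Measurable p) (hu : Measurable u) :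
    Measurable fun x => samplePick (a₀ x) (p x) (u x) := by
  have hN : Measurable fun x =>
      (∑ a : Fin K, if ∑ b ∈ Finset.Iic a, p x b ≤ u x then 1 else 0 : ℕ) := by
    refine Finset.measurable_sum _ fun a _ => ?_
    refine Measurable.ite (measurableSet_le ?_ hu) measurable_const measurable_const
    exact Finset.measurable_sum _ fun b _ => (measurable_pi_apply b).comp hp
  have : (fun x => samplePick (a₀ x) (p x) (u x)) = (fun q : ℕ × Fin K =>
      if h : q.1 < K then (⟨q.1, h⟩ : Fin K) else q.2) ∘ fun x =>
      ((∑ a : Fin K, if ∑ b ∈ Finset.Iic a, p x b ≤ u x then 1 else 0 : ℕ), a₀ x) := rfl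
  rw [this]
  exact (measurable_of_countable _).comp (hN.prodMk ha)

theorem samplePick_eq {K : ℕ} (a₀ : Fin K) {p : Fin K → ℝ} (hp : ∀ a, 0 ≤ p a) {u : ℝ} {a : Fin K}
    (h1 : ∑ b ∈ Finset.Iio a, p b ≤ u) (h2 : u < ∑ b ∈ Finset.Iic a, p b) :
    samplePick a₀ p u = a := by
  have hN : (∑ c : Fin K, if ∑ b ∈ Finset.Iic c, p b ≤ u then 1 else 0 : ℕ) = a := by
    have : ∀ c : Fin K, (∑ b ∈ Finset.Iic c, p b ≤ u) ↔ c < a := by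
      intro c
      constructor
      · intro h
        by_contra hc
        have : ∑ b ∈ Finset.Iic a, p b ≤ ∑ b ∈ Finset.Iic c, p b :=
          Finset.sum_le_sum_of_subset_of_nonneg (Finset.Iic_subset_Iic.2 (not_lt.1 hc))
            fun i _ _ => hp i
        linarith
      · intro h
        refine le_trans (Finset.sum_le_sum_of_subset_of_nonneg ?_ fun i _ _ => hp i) h1
        intro i hi
        exact Finset.mem_Iio.2 (lt_of_le_of_lt (Finset.mem_Iic.1 hi) h)
    simp only [this, Finset.sum_boole, Nat.cast_id]
    rw [show (Finset.univ.filter fun c => c < a) = Finset.Iio a by ext; simp, Fin.card_Iio]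
  unfold samplePick
  rw [dif_pos (by rw [hN]; exact a.2)]
  exact Fin.ext hN

theorem integral_samplePick {K : ℕ} (a₀ : Fin K) {p : Fin K → ℝ} (hp : ∀ a, 0 ≤ p a)
    (hs : ∑ a, p a = 1) (f : Fin K → ℝ) :
    ∫ u, f (samplePick a₀ p u) ∂(volume.restrict (Set.Ico (0 : ℝ) 1)) = ∑ a, p a * f a := by
  have key : ∀ u ∈ Set.Ico (0 : ℝ) 1, f (samplePick a₀ p u) =
      ∑ a, Set.indicator (Set.Ico (∑ b ∈ Finset.Iio a, p b) (∑ b ∈ Finset.Iic a, p b))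
        (fun _ => f a) u := by
    intro u hu
    obtain ⟨a, h1, h2⟩ : ∃ a, ∑ b ∈ Finset.Iio a, p b ≤ u ∧ u < ∑ b ∈ Finset.Iic a, p b := by
      by_contra hcon
      push Not at hcon
      have hall : ∀ n : ℕ, ∀ hn : n < K, ∑ b ∈ Finset.Iic (⟨n, hn⟩ : Fin K), p b ≤ u := by
        intro n
        induction n with
        | zero =>
          intro hn
          refine hcon _ ?_
          have : Finset.Iio (⟨0, hn⟩ : Fin K) = ∅ := by
            ext x; simp [Fin.lt_def]
          rw [this]; simpa using hu.1
        | succ n ih =>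
          intro hn
          refine hcon _ ?_
          have : Finset.Iio (⟨n + 1, hn⟩ : Fin K) = Finset.Iic ⟨n, by omega⟩ := by
            ext x; simp [Fin.lt_def, Fin.le_def]
          rw [this]; exact ih _
      have hK : 0 < K := a₀.pos
      have := hall (K - 1) (by omega)
      have h3 : Finset.Iic (⟨K - 1, by omega⟩ : Fin K) = Finset.univ := by
        ext x; simp [Fin.le_def]; omega
      rw [h3, hs] at this
      exact absurd hu.2 (not_lt.2 this)
    rw [samplePick_eq a₀ hp h1 h2, Finset.sum_eq_single a]
    · rw [Set.indicator_of_mem (Set.mem_Ico.2 ⟨h1, h2⟩)]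
    · intro b _ hb
      refine Set.indicator_of_notMem (fun hm => hb ?_) _
      rw [← samplePick_eq a₀ hp hm.1 hm.2, samplePick_eq a₀ hp h1 h2]
    · simp
  rw [setIntegral_congr_fun measurableSet_Ico key, integral_finsetSum]
  · refine Finset.sum_congr rfl fun a _ => ?_
    have h0 : 0 ≤ ∑ b ∈ Finset.Iio a, p b := Finset.sum_nonneg fun i _ => hp i
    have h1 : ∑ b ∈ Finset.Iic a, p b ≤ 1 := by
      rw [← hs]
      exact Finset.sum_le_sum_of_subset_of_nonneg (Finset.subset_univ _) fun i _ _ => hp i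
    have h2 : ∑ b ∈ Finset.Iic a, p b = p a + ∑ b ∈ Finset.Iio a, p b := by
      rw [← Finset.Iio_insert, Finset.sum_insert (by simp)]
    rw [integral_indicator measurableSet_Ico, Measure.restrict_restrict measurableSet_Ico,
      Set.inter_eq_left.2 (Set.Ico_subset_Ico h0 h1), integral_const]
    simp only [measureReal_restrict_apply_univ, smul_eq_mul]
    rw [Real.volume_real_Ico_of_le (by rw [h2]; linarith [hp a]), h2]
    ring
  · intro a _
    exact (integrable_const _).indicator measurableSet_Ico

/-! ### Elementary inequalities for exponential weights -/

theorem exp_le_one_add_add_sq {x : ℝ} (hx : x ≤ 1) : Real.exp x ≤ 1 + x + x ^ 2 := by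
  rcases le_or_gt (-1) x with h | h
  · have := (abs_le.1 (Real.abs_exp_sub_one_sub_id_le (abs_le.2 ⟨h, hx⟩))).2
    linarith
  · have : Real.exp x ≤ 1 := Real.exp_le_one_iff.2 (by linarith)
    nlinarith

theorem exp_le_one_add_two_mul {x : ℝ} (h0 : 0 ≤ x) (h1 : x ≤ 1) : Real.exp x ≤ 1 + 2 * x := by
  nlinarith [exp_le_one_add_add_sq h1]

theorem exp_neg_le_one_sub_half {x : ℝ} (h0 : 0 ≤ x) (h1 : x ≤ 1) :
    Real.exp (-x) ≤ 1 - x / 2 := by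
  have h2 : Real.exp (-x) * Real.exp x = 1 := by rw [← Real.exp_add]; simp
  nlinarith [Real.add_one_le_exp x, Real.exp_pos (-x)]

/-- One multiplicative-weights step: the growth of the logarithm of the total weight, of which the
amount `c` stays fixed, is at most the average exponent plus the average squared exponent. -/
theorem log_sum_exp_step {ι : Type*} [Fintype ι] {c : ℝ} (hc : 0 ≤ c) {w x : ι → ℝ}
    (hw : ∀ i, 0 ≤ w i) (hx : ∀ i, x i ≤ 1) (hpos : 0 < c + ∑ i, w i) :
    Real.log (c + ∑ i, w i * Real.exp (x i)) - Real.log (c + ∑ i, w i) ≤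
      ∑ i, w i / (c + ∑ j, w j) * (x i + x i ^ 2) := by
  set W := c + ∑ i, w i
  have h1 : 0 < c + ∑ i, w i * Real.exp (x i) := by
    rcases hc.lt_or_eq with h | h
    · exact add_pos_of_pos_of_nonneg h
        (Finset.sum_nonneg fun i _ => mul_nonneg (hw i) (Real.exp_pos _).le)
    · have h3 : ∑ i, w i ≠ 0 := by
        intro h0; apply hpos.ne'; simp [W, h0, ← h]
      obtain ⟨i, -, hi⟩ := Finset.exists_ne_zero_of_sum_ne_zero h3
      refine add_pos_of_nonneg_of_pos hc (Finset.sum_pos'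
        (fun i _ => mul_nonneg (hw i) (Real.exp_pos _).le) ⟨i, Finset.mem_univ _, ?_⟩)
      exact mul_pos ((hw i).lt_of_ne' hi) (Real.exp_pos _)
  rw [← Real.log_div h1.ne' hpos.ne']
  refine (Real.log_le_sub_one_of_pos (div_pos h1 hpos)).trans ?_
  rw [div_sub_one hpos.ne', div_le_iff₀ hpos, Finset.sum_mul]
  have : c + ∑ i, w i * Real.exp (x i) - W = ∑ i, w i * (Real.exp (x i) - 1) := by
    simp only [W, mul_sub, Finset.sum_sub_distrib, mul_one]; ring
  rw [this]
  refine Finset.sum_le_sum fun i _ => ?_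
  rw [div_mul_eq_mul_div, div_mul_cancel₀ _ hpos.ne']
  exact mul_le_mul_of_nonneg_left (by linarith [exp_le_one_add_add_sq (hx i)]) (hw i)

/-- A step whose exponents are known beforehand costs no second-order term, if it is measured with
the weights after the step. -/
theorem log_sum_exp_sub_le {ι : Type*} [Fintype ι] [Nonempty ι] (m δ : ι → ℝ) :
    Real.log (∑ i, Real.exp (m i + δ i)) - Real.log (∑ i, Real.exp (m i)) ≤
      ∑ i, Real.exp (m i + δ i) / (∑ j, Real.exp (m j + δ j)) * δ i := by
  set W := ∑ j, Real.exp (m j + δ j) with hW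
  have hWpos : 0 < W := Finset.sum_pos (fun i _ => Real.exp_pos _) Finset.univ_nonempty
  have hpos : 0 < ∑ j, Real.exp (m j) :=
    Finset.sum_pos (fun i _ => Real.exp_pos _) Finset.univ_nonempty
  have hj := convexOn_exp.map_sum_le (t := Finset.univ) (w := fun i => Real.exp (m i + δ i) / W)
    (p := fun i => - δ i) (fun i _ => div_nonneg (Real.exp_pos _).le hWpos.le)
    (by rw [← Finset.sum_div, ← hW, div_self hWpos.ne']) (fun _ _ => Set.mem_univ _)
  simp only [smul_eq_mul] at hj
  have h2 : ∑ i, Real.exp (m i + δ i) / W * Real.exp (-δ i) = (∑ i, Real.exp (m i)) / W := by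
    rw [Finset.sum_div]
    refine Finset.sum_congr rfl fun i _ => ?_
    rw [div_mul_eq_mul_div, ← Real.exp_add]; congr 2; ring
  rw [h2] at hj
  have h3 := (Real.le_log_iff_exp_le (div_pos hpos hWpos)).2 hj
  rw [Real.log_div hpos.ne' hWpos.ne'] at h3
  simp only [mul_neg, Finset.sum_neg_distrib] at h3
  linarith

theorem sum_mul_le_log_one_add_sum_exp {ι : Type*} [Fintype ι] {P l : ι → ℝ} (hP : ∀ i, 0 ≤ P i)
    (hs : ∑ i, P i ≤ 1) : ∑ i, P i * l i ≤ Real.log (1 + ∑ i, Real.exp (l i)) := by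
  have hn : 0 ≤ ∑ i, Real.exp (l i) := Finset.sum_nonneg fun i _ => (Real.exp_pos _).le
  have h0 : 0 ≤ Real.log (1 + ∑ i, Real.exp (l i)) := Real.log_nonneg (by linarith)
  have h1 : ∀ i, l i ≤ Real.log (1 + ∑ i, Real.exp (l i)) := fun i => by
    rw [Real.le_log_iff_exp_le (by linarith)]
    have := Finset.single_le_sum (f := fun i => Real.exp (l i)) (fun i _ => (Real.exp_pos _).le)
      (Finset.mem_univ i)
    linarith
  calc ∑ i, P i * l i ≤ ∑ i, P i * Real.log (1 + ∑ i, Real.exp (l i)) :=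
        Finset.sum_le_sum fun i _ => mul_le_mul_of_nonneg_left (h1 i) (hP i)
    _ = (∑ i, P i) * Real.log (1 + ∑ i, Real.exp (l i)) := by rw [Finset.sum_mul]
    _ ≤ _ := mul_le_of_le_one_left h0 hs

theorem le_log_sum_exp {ι : Type*} [Fintype ι] (l : ι → ℝ) (i : ι) :
    l i ≤ Real.log (∑ j, Real.exp (l j)) := by
  have := Finset.single_le_sum (f := fun i => Real.exp (l i)) (fun i _ => (Real.exp_pos _).le)
    (Finset.mem_univ i)
  exact (Real.le_log_iff_exp_le ((Real.exp_pos _).trans_le this)).2 this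

/-! ### Bounded measurable functions -/

/-- Measurable and bounded real functions; they are integrable for every finite measure. -/
def BddMeas {α : Type*} [MeasurableSpace α] (f : α → ℝ) : Prop :=
  Measurable f ∧ ∃ C, ∀ x, |f x| ≤ C

namespace BddMeas

variable {α : Type*} [MeasurableSpace α] {f g : α → ℝ}

theorem integrable (hf : BddMeas f) (μ : Measure α) [IsFiniteMeasure μ] : Integrable f μ := by
  obtain ⟨hm, C, hC⟩ := hf
  exact Integrable.of_bound hm.aestronglyMeasurable C (Filter.Eventually.of_forall hC)

theorem const (c : ℝ) : BddMeas fun _ : α => c := ⟨measurable_const, |c|, fun _ => le_rfl⟩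

theorem comp {β : Type*} [MeasurableSpace β] (hf : BddMeas f) {k : β → α} (hk : Measurable k) :
    BddMeas fun x => f (k x) :=
  ⟨hf.1.comp hk, hf.2.imp fun _ hC x => hC (k x)⟩

theorem add (hf : BddMeas f) (hg : BddMeas g) : BddMeas fun x => f x + g x := by
  obtain ⟨hm, C, hC⟩ := hf
  obtain ⟨hm', C', hC'⟩ := hg
  exact ⟨hm.add hm', C + C', fun x => (abs_add_le _ _).trans (add_le_add (hC x) (hC' x))⟩

theorem neg (hf : BddMeas f) : BddMeas fun x => - f x :=
  ⟨hf.1.neg, hf.2.imp fun _ hC x => by rw [abs_neg]; exact hC x⟩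

theorem sub (hf : BddMeas f) (hg : BddMeas g) : BddMeas fun x => f x - g x := by
  simpa only [sub_eq_add_neg] using hf.add hg.neg

theorem mul (hf : BddMeas f) (hg : BddMeas g) : BddMeas fun x => f x * g x := by
  obtain ⟨hm, C, hC⟩ := hf
  obtain ⟨hm', C', hC'⟩ := hg
  refine ⟨hm.mul hm', C * C', fun x => ?_⟩
  rw [abs_mul]
  exact mul_le_mul (hC x) (hC' x) (abs_nonneg _) ((abs_nonneg _).trans (hC x))

theorem sum {ι : Type*} {s : Finset ι} {f : ι → α → ℝ} (hf : ∀ i ∈ s, BddMeas (f i)) :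
    BddMeas fun x => ∑ i ∈ s, f i x := by
  classical
  induction s using Finset.induction_on with
  | empty => simpa using const 0
  | insert a s ha ih =>
    simp only [Finset.sum_insert ha]
    exact (hf a (by simp)).add (ih fun i hi => hf i (by simp [hi]))

theorem exp (hf : BddMeas f) : BddMeas fun x => Real.exp (f x) := by
  obtain ⟨hm, C, hC⟩ := hf
  exact ⟨hm.exp, Real.exp C, fun x => by
    rw [abs_of_pos (Real.exp_pos _)]; exact Real.exp_le_exp.2 ((le_abs_self _).trans (hC x))⟩

theorem log_of_one_le (hf : BddMeas f) (h : ∀ x, 1 ≤ f x) : BddMeas fun x => Real.log (f x) := by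
  obtain ⟨hm, C, hC⟩ := hf
  refine ⟨hm.log, C, fun x => ?_⟩
  rw [abs_of_nonneg (Real.log_nonneg (h x))]
  linarith [Real.log_le_sub_one_of_pos (by linarith [h x] : 0 < f x), le_abs_self (f x), hC x]

theorem ite {p : α → Prop} [DecidablePred p] (hp : MeasurableSet {x | p x}) (hf : BddMeas f)
    (hg : BddMeas g) : BddMeas fun x => if p x then f x else g x := by
  obtain ⟨hm, C, hC⟩ := hf
  obtain ⟨hm', C', hC'⟩ := hg
  refine ⟨Measurable.ite hp hm hm', max C C', fun x => ?_⟩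
  dsimp only
  split_ifs
  · exact (hC x).trans (le_max_left _ _)
  · exact (hC' x).trans (le_max_right _ _)

theorem of_mem_Icc (hf : Measurable f) {a b : ℝ} (h : ∀ x, f x ∈ Set.Icc a b) : BddMeas f :=
  ⟨hf, max |a| |b|, fun x => abs_le_max_abs_abs (h x).1 (h x).2⟩

end BddMeas

end

noncomputable section

open MeasureTheory ResourcefulBandits

/-! ### Measurability and causality of the interaction -/

namespace ResourcefulBandits.Algorithm

variable {X : Type u} [MeasurableSpace X] {K d : ℕ} (alg : Algorithm X K d)

theorem measurable_history (t : ℕ) :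
    Measurable fun p : alg.Seed × (ℕ → Outcome X K d) => alg.history p.1 p.2 t := by
  induction t with
  | zero => exact measurable_pi_lambda _ fun i => i.elim0
  | succ t ih =>
    have hx : Measurable fun p : alg.Seed × (ℕ → Outcome X K d) => (p.2 t).1 := by fun_prop
    have ha : Measurable fun p : alg.Seed × (ℕ → Outcome X K d) =>
        alg.act p.1 t (alg.history p.1 p.2 t) (p.2 t).1 :=
      (alg.measurable_act t).comp (measurable_fst.prodMk (ih.prodMk hx))
    have hp : Measurable fun p : alg.Seed × (ℕ → Outcome X K d) =>
        (p.2 t).2 (alg.act p.1 t (alg.history p.1 p.2 t) (p.2 t).1) := by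
      have he : Measurable fun q : Fin K × (Fin K → Payoff d) => q.2 q.1 :=
        measurable_from_prod_countable_right fun a => measurable_pi_apply a
      have h2 : Measurable fun p : alg.Seed × (ℕ → Outcome X K d) => (p.2 t).2 := by fun_prop
      exact he.comp (ha.prodMk h2)
    refine measurable_pi_lambda _ fun i => ?_
    refine Fin.lastCases ?_ (fun j => ?_) i
    · simpa [history] using hx.prodMk (ha.prodMk hp)
    · simp only [history, Fin.snoc_castSucc]
      exact (measurable_pi_apply j).comp ih

theorem measurable_action (t : ℕ) :
    Measurable fun p : alg.Seed × (ℕ → Outcome X K d) => alg.action p.1 p.2 t :=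
  (alg.measurable_act t).comp
    (measurable_fst.prodMk ((alg.measurable_history t).prodMk (by fun_prop)))

theorem measurable_payoff (t : ℕ) :
    Measurable fun p : alg.Seed × (ℕ → Outcome X K d) => (p.2 t).2 (alg.action p.1 p.2 t) := by
  have he : Measurable fun q : Fin K × (Fin K → Payoff d) => q.2 q.1 :=
    measurable_from_prod_countable_right fun a => measurable_pi_apply a
  have h2 : Measurable fun p : alg.Seed × (ℕ → Outcome X K d) => (p.2 t).2 := by fun_prop
  exact he.comp ((alg.measurable_action t).prodMk h2)

theorem measurable_reward (t : ℕ) :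
    Measurable fun p : alg.Seed × (ℕ → Outcome X K d) => alg.reward p.1 p.2 t :=
  (alg.measurable_payoff t).fst

theorem measurable_consumption (t : ℕ) (i : Fin d) :
    Measurable fun p : alg.Seed × (ℕ → Outcome X K d) => alg.consumption p.1 p.2 t i :=
  (measurable_pi_apply i).comp (alg.measurable_payoff t).snd

theorem measurableSet_withinBudget (b : Fin d → ℝ) (t : ℕ) :
    MeasurableSet {p : alg.Seed × (ℕ → Outcome X K d) | alg.WithinBudget b p.1 p.2 t} := by
  simp only [WithinBudget, Set.ofPred_forall]
  refine MeasurableSet.iInter fun n => MeasurableSet.iInter fun _ =>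
    MeasurableSet.iInter fun i => ?_
  exact measurableSet_le (Finset.measurable_sum _ fun m _ => alg.measurable_consumption m i)
    measurable_const

/-- What has been observed before round `t` depends only on the outcomes of the earlier rounds. -/
theorem history_congr (s : alg.Seed) {ω ω' : ℕ → Outcome X K d} {t : ℕ}
    (h : ∀ m < t, ω m = ω' m) : alg.history s ω t = alg.history s ω' t := by
  induction t with
  | zero => rfl
  | succ t ih =>
    have := ih fun m hm => h m (hm.trans t.lt_succ_self)
    simp only [history, this, h t t.lt_succ_self]

theorem action_congr (s : alg.Seed) {ω ω' : ℕ → Outcome X K d} {t : ℕ}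
    (h : ∀ m ≤ t, ω m = ω' m) : alg.action s ω t = alg.action s ω' t := by
  simp only [action, alg.history_congr s fun m hm => h m hm.le, h t le_rfl]

theorem consumption_congr (s : alg.Seed) {ω ω' : ℕ → Outcome X K d} {t : ℕ}
    (h : ∀ m ≤ t, ω m = ω' m) : alg.consumption s ω t = alg.consumption s ω' t := by
  funext i
  simp only [consumption, alg.action_congr s h, h t le_rfl]

theorem measurable_totalReward (T : ℕ) (b : Fin d → ℝ) :
    Measurable fun p : alg.Seed × (ℕ → Outcome X K d) => alg.totalReward T b p.1 p.2 := by
  unfold totalReward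
  exact Finset.measurable_sum _ fun t _ =>
    Measurable.ite (alg.measurableSet_withinBudget b t) (alg.measurable_reward t) measurable_const

end ResourcefulBandits.Algorithm

/-! ### Clipped payoffs and their means -/

/-- Truncation to the unit interval. -/
def unitClip (x : ℝ) : ℝ := max 0 (min 1 x)

theorem unitClip_mem (x : ℝ) : unitClip x ∈ Set.Icc (0 : ℝ) 1 :=
  ⟨le_max_left _ _, max_le zero_le_one (min_le_left _ _)⟩

theorem unitClip_of_mem {x : ℝ} (h : x ∈ Set.Icc (0 : ℝ) 1) : unitClip x = x := by
  rw [unitClip, min_eq_right h.2, max_eq_right h.1]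

theorem measurable_unitClip : Measurable unitClip := by unfold unitClip; fun_prop

namespace ResourcefulBandits.KnownData

variable {X : Type u} [MeasurableSpace X] (I : KnownData X)

theorem minBudget_le (i : Fin I.d) : I.minBudget ≤ I.budget i :=
  ciInf_le (Set.finite_range _).bddBelow i

theorem minBudget_pos : 0 < I.minBudget := by
  have : Nonempty (Fin I.d) := ⟨I.time⟩
  obtain ⟨i, hi⟩ := exists_eq_ciInf_of_finite (f := I.budget)
  rw [minBudget, ← hi]; exact I.budget_pos i

theorem minBudget_le_T : I.minBudget ≤ I.T := I.budget_time ▸ I.minBudget_le I.time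

theorem one_le_T : 1 ≤ I.T := by
  have := I.budget_pos I.time
  rw [I.budget_time] at this
  exact_mod_cast this

/-- Consumption of a resource other than time, in the unit in which every budget equals the smallest
one. Time is counted separately, therefore its value is `0` here. -/
def scaledCon (i : Fin I.d) (o : Payoff I.d) : ℝ :=
  if i = I.time then 0 else unitClip (o.2 i) * (I.minBudget / I.budget i)

theorem scaledCon_mem (i : Fin I.d) (o : Payoff I.d) : I.scaledCon i o ∈ Set.Icc (0 : ℝ) 1 := by
  unfold scaledCon
  split_ifs
  · simp
  · have h1 := unitClip_mem (o.2 i)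
    have h2 : I.minBudget / I.budget i ≤ 1 := (div_le_one (I.budget_pos i)).2 (I.minBudget_le i)
    have h3 : 0 ≤ I.minBudget / I.budget i := div_nonneg I.minBudget_pos.le (I.budget_pos i).le
    exact ⟨mul_nonneg h1.1 h3, mul_le_one₀ h1.2 h3 h2⟩

theorem scaledCon_time (o : Payoff I.d) : I.scaledCon I.time o = 0 := if_pos rfl

theorem measurable_scaledCon (i : Fin I.d) : Measurable (I.scaledCon i) := by
  unfold scaledCon
  split_ifs
  · exact measurable_const
  · have := measurable_unitClip
    fun_prop

/-- The mean reward of a policy. -/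
def meanReward (D : Measure (Outcome X I.K I.d)) (π : I.policies) : ℝ :=
  ∫ o, unitClip (o.2 (π.1 o.1)).1 ∂D

/-- The mean scaled consumption of a policy. -/
def meanCon (D : Measure (Outcome X I.K I.d)) (π : I.policies) (i : Fin I.d) : ℝ :=
  ∫ o, I.scaledCon i (o.2 (π.1 o.1)) ∂D

theorem measurable_policy_payoff (π : I.policies) :
    Measurable fun o : Outcome X I.K I.d => o.2 (π.1 o.1) := by
  have he : Measurable fun q : Fin I.K × (Fin I.K → Payoff I.d) => q.2 q.1 :=
    measurable_from_prod_countable_right fun a => measurable_pi_apply a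
  exact he.comp (((I.policies_measurable _ π.2).comp measurable_fst).prodMk measurable_snd)

theorem bddMeas_policy_reward (π : I.policies) :
    BddMeas fun o : Outcome X I.K I.d => unitClip (o.2 (π.1 o.1)).1 :=
  .of_mem_Icc (measurable_unitClip.comp (I.measurable_policy_payoff π).fst) fun _ => unitClip_mem _

theorem bddMeas_policy_con (π : I.policies) (i : Fin I.d) :
    BddMeas fun o : Outcome X I.K I.d => I.scaledCon i (o.2 (π.1 o.1)) :=
  .of_mem_Icc ((I.measurable_scaledCon i).comp (I.measurable_policy_payoff π))
    fun _ => I.scaledCon_mem _ _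

end ResourcefulBandits.KnownData

/-! ### The linear program -/

/-- `P` is a subprobability vector whose consumption over `T` rounds meets the budget `B` for every
resource. -/
def LPFeasible {ι κ : Type*} [Fintype ι] (T B : ℝ) (c : ι → κ → ℝ) (P : ι → ℝ) : Prop :=
  (∀ π, 0 ≤ P π) ∧ ∑ π, P π ≤ 1 ∧ ∀ i, T * ∑ π, P π * c π i ≤ B

/-- The largest reward over `T` rounds of a feasible subprobability vector. -/
def lpValue {ι κ : Type*} [Fintype ι] (T B : ℝ) (r : ι → ℝ) (c : ι → κ → ℝ) : ℝ :=
  sSup {v | ∃ P, LPFeasible T B c P ∧ v = T * ∑ π, P π * r π}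

section LP

variable {ι κ : Type*} [Fintype ι] {T B : ℝ} {r r' : ι → ℝ} {c c' : ι → κ → ℝ} {P : ι → ℝ}

theorem LPFeasible.reward_le (hT : 0 ≤ T) (hr : ∀ π, r π ≤ 1) (hP : LPFeasible T B c P) :
    T * ∑ π, P π * r π ≤ T := by
  refine mul_le_of_le_one_right hT (le_trans (Finset.sum_le_sum fun π _ => ?_) hP.2.1)
  exact mul_le_of_le_one_right (hP.1 π) (hr π)

theorem LPFeasible.le_lpValue (hT : 0 ≤ T) (hr : ∀ π, r π ≤ 1) (hP : LPFeasible T B c P) :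
    T * ∑ π, P π * r π ≤ lpValue T B r c := by
  refine le_csSup ⟨T, ?_⟩ ⟨P, hP, rfl⟩
  rintro v ⟨Q, hQ, rfl⟩
  exact hQ.reward_le hT hr

theorem lpValue_nonneg (hT : 0 ≤ T) (hr : ∀ π, 0 ≤ r π) : 0 ≤ lpValue T B r c := by
  refine Real.sSup_nonneg ?_
  rintro v ⟨Q, hQ, rfl⟩
  exact mul_nonneg hT (Finset.sum_nonneg fun π _ => mul_nonneg (hQ.1 π) (hr π))

theorem lpValue_le (hT : 0 ≤ T) (hr : ∀ π, r π ≤ 1) : lpValue T B r c ≤ T := by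
  refine Real.sSup_le ?_ hT
  rintro v ⟨Q, hQ, rfl⟩
  exact hQ.reward_le hT hr

/-- Data that agree up to a factor `2` and a small additive error have linear programs whose values
agree up to a constant factor: a third of a feasible vector for one is feasible for the other. -/
theorem lpValue_le_of_close {s : ℝ} (hT : 0 ≤ T) (hs : 0 ≤ s) (hsB : T * s ≤ B)
    (h0 : ∀ π, 0 ≤ r' π) (h1 : ∀ π, r' π ≤ 1)
    (hr : ∀ π, r π ≤ 2 * r' π + s) (hc : ∀ π i, c' π i ≤ 2 * c π i + s) :
    lpValue T B r c ≤ 6 * lpValue T B r' c' + T * s := by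
  have hTs := mul_nonneg hT hs
  refine Real.sSup_le ?_ (by have := lpValue_nonneg (B := B) (c := c') hT h0; linarith)
  rintro v ⟨P, ⟨hP0, hP1, hP2⟩, rfl⟩
  have hQ : LPFeasible T B c' fun π => P π / 3 := by
    refine ⟨fun π => div_nonneg (hP0 π) (by norm_num), ?_, fun i => ?_⟩
    · rw [← Finset.sum_div]; linarith
    · have : ∑ π, P π / 3 * c' π i ≤ (2 * ∑ π, P π * c π i + (∑ π, P π) * s) / 3 := by
        rw [Finset.mul_sum, Finset.sum_mul, ← Finset.sum_add_distrib, Finset.sum_div]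
        refine Finset.sum_le_sum fun π _ => ?_
        have := mul_le_mul_of_nonneg_left (hc π i) (hP0 π)
        linarith
      have h2 := mul_le_mul_of_nonneg_left this hT
      have h3 := mul_le_mul_of_nonneg_right hP1 hTs
      have h4 := hP2 i
      nlinarith
  have hle := hQ.le_lpValue hT h1
  have : ∑ π, P π * r π ≤ 6 * ∑ π, P π / 3 * r' π + (∑ π, P π) * s := by
    rw [Finset.mul_sum, Finset.sum_mul, ← Finset.sum_add_distrib]
    refine Finset.sum_le_sum fun π _ => ?_
    have := mul_le_mul_of_nonneg_left (hr π) (hP0 π)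
    linarith
  have h2 := mul_le_mul_of_nonneg_left this hT
  have h3 := mul_le_mul_of_nonneg_right hP1 hTs
  nlinarith

end LP

end

noncomputable section

open MeasureTheory ResourcefulBandits

/-! ### Expectations over the interaction -/

/-- The current outcome may be replaced by a fresh one. -/
theorem integral_resample {S Y : Type*} [MeasurableSpace S] [MeasurableSpace Y] (ν : Measure S)
    [IsProbabilityMeasure ν] (D : Measure Y) [IsProbabilityMeasure D] (t : ℕ)
    {F : S × (ℕ → Y) → ℝ} (hF : BddMeas F) :
    ∫ p, F p ∂(ν.prod (Measure.infinitePi fun _ : ℕ => D)) =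
      ∫ p, ∫ y, F (p.1, Function.update p.2 t y) ∂D
        ∂(ν.prod (Measure.infinitePi fun _ : ℕ => D)) := by
  have hmp : MeasurePreserving (fun q : (S × (ℕ → Y)) × Y => (q.1.1, Function.update q.1.2 t q.2))
      ((ν.prod (Measure.infinitePi fun _ : ℕ => D)).prod D)
      (ν.prod (Measure.infinitePi fun _ : ℕ => D)) :=
    ((MeasurePreserving.id ν).prod (measurePreserving_update_infinitePi D t)).comp
      (measurePreserving_prodAssoc ν (Measure.infinitePi fun _ : ℕ => D) D)
  conv_lhs => rw [← hmp.map_eq]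
  rw [integral_map hmp.measurable.aemeasurable hF.1.aestronglyMeasurable,
    integral_prod _ ((hF.comp hmp.measurable).integrable _)]

namespace ResourcefulBandits

variable {X : Type u} [MeasurableSpace X]

/-- The outcome respects the constraints that hold almost surely for an outcome distribution. -/
def KnownData.Legal (I : KnownData X) (o : Outcome X I.K I.d) : Prop :=
  (∀ a, (o.2 a).1 ∈ Set.Icc (0 : ℝ) 1) ∧ (∀ a i, (o.2 a).2 i ∈ Set.Icc (0 : ℝ) 1) ∧
    ∀ a, (o.2 a).2 I.time = 1

/-- The joint law of the seed and the outcomes. -/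
abbrev Algorithm.pathLaw {K d : ℕ} (alg : Algorithm X K d) (D : Measure (Outcome X K d))
    [IsProbabilityMeasure D] : Measure (alg.Seed × (ℕ → Outcome X K d)) :=
  alg.seedLaw.prod (Measure.infinitePi fun _ : ℕ => D)

section

variable {I : KnownData X} {D : Measure (Outcome X I.K I.d)} [IsProbabilityMeasure D]

theorem ae_legal (hD : IsOutcomeDistribution I D) (alg : Algorithm X I.K I.d) :
    ∀ᵐ p ∂alg.pathLaw D, ∀ t, I.Legal (p.2 t) := by
  have h : ∀ᵐ o ∂D, I.Legal o := by
    filter_upwards [hD.reward_mem, hD.consumption_mem, hD.consumption_time] with o h1 h2 h3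
    exact ⟨h1, h2, h3⟩
  rw [ae_all_iff]
  intro t
  have hq : Measure.QuasiMeasurePreserving
      (fun p : alg.Seed × (ℕ → Outcome X I.K I.d) => p.2 t) (alg.pathLaw D) D :=
    ((measurePreserving_eval_infinitePi (fun _ : ℕ => D) t).quasiMeasurePreserving).comp
      Measure.quasiMeasurePreserving_snd
  exact hq.ae h

theorem KnownData.Legal.clip_reward {o : Outcome X I.K I.d} (h : I.Legal o) (a : Fin I.K) :
    unitClip (o.2 a).1 = (o.2 a).1 := unitClip_of_mem (h.1 a)

theorem KnownData.Legal.scaledCon_eq {o : Outcome X I.K I.d} (h : I.Legal o) (a : Fin I.K)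
    {i : Fin I.d} (hi : i ≠ I.time) :
    I.scaledCon i (o.2 a) = (o.2 a).2 i * (I.minBudget / I.budget i) := by
  rw [KnownData.scaledCon, if_neg hi, unitClip_of_mem (h.2.1 a i)]

/-- The total reward with rewards truncated to the unit interval. -/
theorem totalReward_eq (alg : Algorithm X I.K I.d) {s : alg.Seed} {ω : ℕ → Outcome X I.K I.d}
    (h : ∀ t, I.Legal (ω t)) : alg.totalReward I.T I.budget s ω =
      ∑ t ∈ Finset.range I.T, open Classical in
        if alg.WithinBudget I.budget s ω t then unitClip (alg.reward s ω t) else 0 := by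
  unfold Algorithm.totalReward
  refine Finset.sum_congr rfl fun t _ => ?_
  split_ifs
  · exact ((h t).clip_reward _).symm
  · rfl

theorem expectedReward_nonneg (hD : IsOutcomeDistribution I D) (alg : Algorithm X I.K I.d) :
    0 ≤ alg.expectedReward I.T I.budget D := by
  refine integral_nonneg_of_ae ?_
  filter_upwards [ae_legal hD alg] with p hp
  rw [totalReward_eq alg hp]
  refine Finset.sum_nonneg fun t _ => ?_
  split_ifs
  · exact (unitClip_mem _).1
  · exact le_rfl

theorem integrable_totalReward (hD : IsOutcomeDistribution I D) (alg : Algorithm X I.K I.d) :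
    Integrable (fun p : alg.Seed × (ℕ → Outcome X I.K I.d) =>
      alg.totalReward I.T I.budget p.1 p.2) (alg.pathLaw D) := by
  refine Integrable.of_bound (alg.measurable_totalReward _ _).aestronglyMeasurable I.T ?_
  filter_upwards [ae_legal hD alg] with p hp
  rw [totalReward_eq alg hp]
  refine (norm_sum_le _ _).trans ?_
  have : ∀ t ∈ Finset.range I.T, ‖open Classical in
      if alg.WithinBudget I.budget p.1 p.2 t then unitClip (alg.reward p.1 p.2 t) else 0‖ ≤ 1 := by
    intro t _
    split_ifs
    · rw [Real.norm_eq_abs, abs_of_nonneg (unitClip_mem _).1]; exact (unitClip_mem _).2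
    · simp
  simpa using Finset.sum_le_sum this

theorem benchmark_nonneg (hD : IsOutcomeDistribution I D) : 0 ≤ I.benchmark D := by
  refine Real.sSup_nonneg ?_
  rintro v ⟨alg, -, rfl⟩
  exact expectedReward_nonneg hD alg

/-! ### The linear program bounds the benchmark -/

/-- Round `t` is still reached: no budget has been exceeded before it. -/
def Algorithm.Reaches {K d : ℕ} (alg : Algorithm X K d) (b : Fin d → ℝ) (s : alg.Seed)
    (ω : ℕ → Outcome X K d) (t : ℕ) : Prop :=
  ∀ n < t, alg.WithinBudget b s ω n

theorem measurableSet_reaches {K d : ℕ} (alg : Algorithm X K d) (b : Fin d → ℝ) (t : ℕ) :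
    MeasurableSet {p : alg.Seed × (ℕ → Outcome X K d) | alg.Reaches b p.1 p.2 t} := by
  simp only [Algorithm.Reaches, Set.ofPred_forall]
  exact MeasurableSet.iInter fun n => MeasurableSet.iInter fun _ =>
    alg.measurableSet_withinBudget b n

theorem reaches_congr {K d : ℕ} (alg : Algorithm X K d) (b : Fin d → ℝ) (s : alg.Seed) {t : ℕ}
    {ω ω' : ℕ → Outcome X K d} (h : ∀ m < t, ω m = ω' m) :
    alg.Reaches b s ω t ↔ alg.Reaches b s ω' t := by
  unfold Algorithm.Reaches Algorithm.WithinBudget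
  refine forall₂_congr fun n hn => forall₂_congr fun k hk => forall_congr' fun i => ?_
  rw [Finset.sum_congr rfl fun m hm => ?_]
  have hm := Finset.mem_range.1 hm
  rw [alg.consumption_congr s fun j hj => h j (by omega)]

/-- Up to and including the first round in which a budget is exceeded, an algorithm consumes at most
one unit more than the budget. -/
theorem sum_reaches_con_le (alg : Algorithm X I.K I.d) {s : alg.Seed}
    {ω : ℕ → Outcome X I.K I.d} (h : ∀ t, I.Legal (ω t)) (i : Fin I.d) (n : ℕ) :
    (∑ t ∈ Finset.range n, open Classical in if alg.Reaches I.budget s ω t then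
      I.scaledCon i ((ω t).2 (alg.action s ω t)) else 0) ≤ I.minBudget + 1 := by
  classical
  have hB := I.minBudget_pos
  by_cases hi : i = I.time
  · subst hi
    simp only [I.scaledCon_time, ite_self, Finset.sum_const_zero]
    linarith
  induction n with
  | zero => simp; linarith
  | succ n ih =>
    rw [Finset.sum_range_succ]
    split_ifs with hr
    · refine add_le_add ?_ (I.scaledCon_mem _ _).2
      have h1 : (∑ t ∈ Finset.range n, if alg.Reaches I.budget s ω t then
          I.scaledCon i ((ω t).2 (alg.action s ω t)) else 0) ≤
          (∑ t ∈ Finset.range n, alg.consumption s ω t i) * (I.minBudget / I.budget i) := by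
        rw [Finset.sum_mul]
        refine Finset.sum_le_sum fun t ht => ?_
        have ht' : alg.Reaches I.budget s ω t := fun k hk => hr k (hk.trans (Finset.mem_range.1 ht))
        rw [if_pos ht', (h t).scaledCon_eq _ hi]
        rfl
      refine h1.trans ?_
      rcases Nat.eq_zero_or_pos n with rfl | hn
      · simpa using hB.le
      · have h2 := hr (n - 1) (by omega) (n - 1) le_rfl i
        rw [Nat.sub_add_cancel hn] at h2
        calc _ ≤ I.budget i * (I.minBudget / I.budget i) :=
              mul_le_mul_of_nonneg_right h2 (div_nonneg hB.le (I.budget_pos i).le)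
          _ = I.minBudget := mul_div_cancel₀ _ (I.budget_pos i).ne'
    · simpa using ih

/-- The event that a committing algorithm uses the policy `π` in round `t` is measurable, since
finitely many contexts tell the policies apart. -/
theorem measurableSet_act_eq (alg : Algorithm X I.K I.d) (hc : alg.CommitsTo I.policies)
    (π : I.policies) (t : ℕ) :
    MeasurableSet {p : alg.Seed × (ℕ → Outcome X I.K I.d) |
      alg.act p.1 t (alg.history p.1 p.2 t) = π.1} := by
  classical
  have hsep : ∀ q : I.policies, ∃ S : Set X, S.Finite ∧ (q ≠ π → ∃ x ∈ S, q.1 x ≠ π.1 x) := by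
    intro q
    by_cases hq : q = π
    · exact ⟨∅, Set.finite_empty, fun h => absurd hq h⟩
    · obtain ⟨x, hx⟩ := Function.ne_iff.1 fun h => hq (Subtype.ext h)
      exact ⟨{x}, Set.finite_singleton x, fun _ => ⟨x, rfl, hx⟩⟩
  choose S hS hSx using hsep
  have : {p : alg.Seed × (ℕ → Outcome X I.K I.d) |
      alg.act p.1 t (alg.history p.1 p.2 t) = π.1} =
      ⋂ x ∈ ⋃ q, S q, {p | alg.act p.1 t (alg.history p.1 p.2 t) x = π.1 x} := by
    ext p
    simp only [Set.mem_ofPred_eq, Set.mem_iInter]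
    constructor
    · intro h x _; rw [h]
    · intro h
      by_contra hne
      obtain ⟨x, hx, hx'⟩ := hSx ⟨_, hc p.1 t (alg.history p.1 p.2 t)⟩
        fun h => hne (congrArg Subtype.val h)
      exact hx' (h x (Set.mem_iUnion.2 ⟨_, hx⟩))
  rw [this]
  refine MeasurableSet.biInter (Set.finite_iUnion hS).countable fun x _ => ?_
  have hm : Measurable fun p : alg.Seed × (ℕ → Outcome X I.K I.d) =>
      alg.act p.1 t (alg.history p.1 p.2 t) x :=
    (alg.measurable_act t).comp
      (measurable_fst.prodMk ((alg.measurable_history t).prodMk measurable_const))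
  exact hm (measurableSet_singleton _)

open Classical in
/-- The indicator of the event that round `t` is reached and the policy `π` is used in it. -/
def Algorithm.usage (alg : Algorithm X I.K I.d) (π : I.policies) (t : ℕ)
    (p : alg.Seed × (ℕ → Outcome X I.K I.d)) : ℝ :=
  if alg.Reaches I.budget p.1 p.2 t then
    if alg.act p.1 t (alg.history p.1 p.2 t) = π.1 then 1 else 0 else 0

theorem bddMeas_usage (alg : Algorithm X I.K I.d) (hc : alg.CommitsTo I.policies)
    (π : I.policies) (t : ℕ) : BddMeas (alg.usage π t) := by
  classical
  unfold Algorithm.usage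
  exact .ite (measurableSet_reaches alg _ t)
    (.ite (measurableSet_act_eq alg hc π t) (.const 1) (.const 0)) (.const 0)

theorem usage_nonneg (alg : Algorithm X I.K I.d) (π : I.policies) (t : ℕ)
    (p : alg.Seed × (ℕ → Outcome X I.K I.d)) : 0 ≤ alg.usage π t p := by
  unfold Algorithm.usage; split_ifs <;> norm_num

theorem usage_update (alg : Algorithm X I.K I.d) (π : I.policies) (t : ℕ)
    (p : alg.Seed × (ℕ → Outcome X I.K I.d)) (o : Outcome X I.K I.d) :
    alg.usage π t (p.1, Function.update p.2 t o) = alg.usage π t p := by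
  have h : ∀ m < t, Function.update p.2 t o m = p.2 m := fun m hm =>
    Function.update_of_ne hm.ne _ _
  have h1 := reaches_congr alg I.budget p.1 h
  have h2 := alg.history_congr p.1 h
  unfold Algorithm.usage
  by_cases hr : alg.Reaches I.budget p.1 p.2 t
  · rw [if_pos hr, if_pos (h1.2 hr), h2]
  · rw [if_neg hr, if_neg fun h3 => hr (h1.1 h3)]

theorem sum_usage_mul (alg : Algorithm X I.K I.d) (hc : alg.CommitsTo I.policies) (t : ℕ)
    (p : alg.Seed × (ℕ → Outcome X I.K I.d)) (f : Payoff I.d → ℝ) :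
    ∑ π, alg.usage π t p * f ((p.2 t).2 (π.1 (p.2 t).1)) = open Classical in
      if alg.Reaches I.budget p.1 p.2 t then f ((p.2 t).2 (alg.action p.1 p.2 t)) else 0 := by
  classical
  unfold Algorithm.usage
  split_ifs with h
  · rw [Finset.sum_eq_single ⟨_, hc p.1 t (alg.history p.1 p.2 t)⟩]
    · simp [Algorithm.action]
    · intro q _ hq
      rw [if_neg fun h => hq (Subtype.ext h.symm), zero_mul]
    · simp
  · simp

theorem integral_usage_mul (alg : Algorithm X I.K I.d) (hc : alg.CommitsTo I.policies)
    (π : I.policies) (t : ℕ) {f : Outcome X I.K I.d → ℝ} (hf : BddMeas f) :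
    ∫ p, alg.usage π t p * f (p.2 t) ∂alg.pathLaw D =
      (∫ p, alg.usage π t p ∂alg.pathLaw D) * ∫ o, f o ∂D := by
  have h2 : Measurable fun p : alg.Seed × (ℕ → Outcome X I.K I.d) => p.2 t := by fun_prop
  rw [integral_resample alg.seedLaw D t ((bddMeas_usage alg hc π t).mul (hf.comp h2)),
    ← integral_mul_const]
  refine integral_congr_ae (Filter.Eventually.of_forall fun p => ?_)
  simp only [usage_update, Function.update_self, integral_const_mul]

theorem meanReward_mem (π : I.policies) : I.meanReward D π ∈ Set.Icc (0 : ℝ) 1 := by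
  refine ⟨integral_nonneg fun _ => (unitClip_mem _).1, ?_⟩
  calc I.meanReward D π ≤ ∫ _, (1 : ℝ) ∂D :=
        integral_mono ((I.bddMeas_policy_reward π).integrable D) (integrable_const _)
          fun _ => (unitClip_mem _).2
    _ = 1 := by simp

/-- The expected reward of a committing algorithm is at most the value of the linear program, up to
the factor `1 + 1 / B` due to the overshoot in the last round: the frequencies with which the
policies are used, scaled down by this factor, are feasible. -/
theorem expectedReward_le_lpValue (hD : IsOutcomeDistribution I D) (alg : Algorithm X I.K I.d)
    (hc : alg.CommitsTo I.policies) : alg.expectedReward I.T I.budget D ≤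
      (1 + 1 / I.minBudget) *
        lpValue I.T I.minBudget (I.meanReward D) (I.meanCon D) := by
  classical
  set B := I.minBudget
  have hB : 0 < B := I.minBudget_pos
  have hT : (0 : ℝ) < I.T := by exact_mod_cast I.one_le_T
  set m : ℕ → I.policies → ℝ := fun t π => ∫ p, alg.usage π t p ∂alg.pathLaw D
  have hm0 : ∀ t π, 0 ≤ m t π := fun t π => integral_nonneg fun p => usage_nonneg alg π t p
  have hm1 : ∀ t, ∑ π, m t π ≤ 1 := by
    intro t
    rw [← integral_finsetSum _ fun π _ => (bddMeas_usage alg hc π t).integrable _]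
    calc _ ≤ ∫ _, (1 : ℝ) ∂alg.pathLaw D := by
          refine integral_mono (integrable_finsetSum _ fun π _ =>
            (bddMeas_usage alg hc π t).integrable _) (integrable_const _) fun p => ?_
          have := sum_usage_mul alg hc t p fun _ => 1
          simp only [mul_one] at this
          dsimp only
          rw [this]; split_ifs <;> norm_num
      _ = 1 := by simp
  have hfac : 0 < B / (B + 1) := by positivity
  set P : I.policies → ℝ := fun π => (∑ t ∈ Finset.range I.T, m t π) / I.T * (B / (B + 1))
  have hTP : ∀ f : I.policies → ℝ, (I.T : ℝ) * ∑ π, P π * f π =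
      (∑ t ∈ Finset.range I.T, ∑ π, m t π * f π) * (B / (B + 1)) := by
    intro f
    rw [Finset.sum_comm, Finset.mul_sum, Finset.sum_mul]
    refine Finset.sum_congr rfl fun π _ => ?_
    simp only [P]
    rw [← Finset.sum_mul]
    field_simp
  have hP : LPFeasible I.T B (I.meanCon D) P := by
    refine ⟨fun π => mul_nonneg (div_nonneg (Finset.sum_nonneg fun t _ => hm0 t π) hT.le) hfac.le,
      ?_, fun i => ?_⟩
    · have h1 := hTP fun _ => 1
      simp only [mul_one] at h1
      have h2 : ∑ t ∈ Finset.range I.T, ∑ π, m t π ≤ I.T := by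
        simpa using Finset.sum_le_sum fun t (_ : t ∈ Finset.range I.T) => hm1 t
      have h3 : B / (B + 1) ≤ 1 := (div_le_one (by positivity)).2 (by linarith)
      have h4 : (I.T : ℝ) * ∑ π, P π ≤ I.T * 1 := by
        rw [h1]; exact mul_le_mul h2 h3 hfac.le hT.le
      exact le_of_mul_le_mul_left h4 hT
    · rw [hTP]
      have : ∑ t ∈ Finset.range I.T, ∑ π, m t π * I.meanCon D π i ≤ B + 1 := by
        have h1 : ∀ t π, m t π * I.meanCon D π i =
            ∫ p, alg.usage π t p * I.scaledCon i ((p.2 t).2 (π.1 (p.2 t).1)) ∂alg.pathLaw D :=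
          fun t π => (integral_usage_mul alg hc π t (I.bddMeas_policy_con π i)).symm
        have hb : ∀ t π, BddMeas fun p : alg.Seed × (ℕ → Outcome X I.K I.d) =>
            alg.usage π t p * I.scaledCon i ((p.2 t).2 (π.1 (p.2 t).1)) := fun t π =>
          (bddMeas_usage alg hc π t).mul ((I.bddMeas_policy_con π i).comp (by fun_prop))
        simp only [h1]
        rw [Finset.sum_congr rfl fun t _ => (integral_finsetSum _ fun π _ =>
          (hb t π).integrable _).symm, ← integral_finsetSum _ fun t _ =>
          integrable_finsetSum _ fun π _ => (hb t π).integrable _]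
        calc _ ≤ ∫ _, (B + 1) ∂alg.pathLaw D := by
              refine integral_mono_ae (integrable_finsetSum _ fun t _ =>
                integrable_finsetSum _ fun π _ => (hb t π).integrable _) (integrable_const _) ?_
              filter_upwards [ae_legal hD alg] with p hp
              simp only [sum_usage_mul alg hc _ p (I.scaledCon i)]
              exact sum_reaches_con_le alg hp i I.T
          _ = B + 1 := by simp
      calc _ ≤ (B + 1) * (B / (B + 1)) := mul_le_mul_of_nonneg_right this hfac.le
        _ = B := by field_simp
  have hle := hP.le_lpValue hT.le (fun π => (meanReward_mem (D := D) π).2)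
  rw [hTP] at hle
  have hmain : alg.expectedReward I.T I.budget D ≤
      ∑ t ∈ Finset.range I.T, ∑ π, m t π * I.meanReward D π := by
    have h1 : ∀ t π, m t π * I.meanReward D π =
        ∫ p, alg.usage π t p * unitClip ((p.2 t).2 (π.1 (p.2 t).1)).1 ∂alg.pathLaw D :=
      fun t π => (integral_usage_mul alg hc π t (I.bddMeas_policy_reward π)).symm
    have hb : ∀ t π, BddMeas fun p : alg.Seed × (ℕ → Outcome X I.K I.d) =>
        alg.usage π t p * unitClip ((p.2 t).2 (π.1 (p.2 t).1)).1 := fun t π =>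
      (bddMeas_usage alg hc π t).mul ((I.bddMeas_policy_reward π).comp (by fun_prop))
    simp only [h1]
    rw [Finset.sum_congr rfl fun t _ => (integral_finsetSum _ fun π _ =>
      (hb t π).integrable _).symm, ← integral_finsetSum _ fun t _ =>
      integrable_finsetSum _ fun π _ => (hb t π).integrable _]
    refine integral_mono_ae (integrable_totalReward hD alg) (integrable_finsetSum _ fun t _ =>
      integrable_finsetSum _ fun π _ => (hb t π).integrable _) ?_
    filter_upwards [ae_legal hD alg] with p hp
    rw [totalReward_eq alg hp]
    refine Finset.sum_le_sum fun t _ => ?_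
    rw [sum_usage_mul alg hc t p fun o => unitClip o.1]
    by_cases hw : alg.WithinBudget I.budget p.1 p.2 t
    · have hr : alg.Reaches I.budget p.1 p.2 t := fun n hn k hk => hw k (by omega)
      rw [if_pos hw, if_pos hr]
      rfl
    · rw [if_neg hw]
      split_ifs
      · exact (unitClip_mem _).1
      · exact le_rfl
  refine hmain.trans ?_
  rw [mul_div_assoc', div_le_iff₀ (by positivity)] at hle
  rw [one_add_div hB.ne', div_mul_eq_mul_div, le_div_iff₀ hB]
  linarith

theorem benchmark_le_lpValue (hD : IsOutcomeDistribution I D) : I.benchmark D ≤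
    (1 + 1 / I.minBudget) * lpValue I.T I.minBudget (I.meanReward D) (I.meanCon D) := by
  refine Real.sSup_le ?_ (mul_nonneg ?_ (lpValue_nonneg (Nat.cast_nonneg _)
    fun π => (meanReward_mem (D := D) π).1))
  · rintro v ⟨alg, hc, rfl⟩
    exact expectedReward_le_lpValue hD alg hc
  · have := I.minBudget_pos
    positivity

end

end ResourcefulBandits

end

noncomputable section

open MeasureTheory ResourcefulBandits

/-! ### Algorithms that keep a state -/

theorem BddMeas.integral {α β : Type*} [MeasurableSpace α] [MeasurableSpace β] {f : α × β → ℝ}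
    (hf : BddMeas f) (ν : Measure β) [IsProbabilityMeasure ν] :
    BddMeas fun x => ∫ y, f (x, y) ∂ν := by
  obtain ⟨hm, C, hC⟩ := hf
  refine ⟨(hm.stronglyMeasurable.integral_prod_right' (ν := ν)).measurable, C, fun x => ?_⟩
  have := norm_integral_le_of_norm_le_const (μ := ν) (f := fun y => f (x, y))
    (Filter.Eventually.of_forall fun y => hC (x, y))
  simpa using this

namespace ResourcefulBandits

/-- A randomized algorithm given by a state that is updated after every observation, and by the
probabilities with which the actions are chosen, given the state and the context. -/
structure Strategy (X : Type u) [MeasurableSpace X] (K d : ℕ) where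
  /-- the states -/
  State : Type u
  [stateSpace : MeasurableSpace State]
  /-- the initial state -/
  init : State
  /-- the probabilities of the actions in a round -/
  prob : ℕ → State → X → Fin K → ℝ
  /-- the state after a round -/
  update : ℕ → State → Observation X K d → State
  /-- the action taken if sampling fails, which has probability zero -/
  fallback : X → Fin K
  measurable_prob : ∀ t, Measurable fun q : State × X => prob t q.1 q.2
  measurable_update : ∀ t, Measurable fun q : State × Observation X K d => update t q.1 q.2
  measurable_fallback : Measurable fallback

attribute [instance] Strategy.stateSpace

instance : IsProbabilityMeasure (volume.restrict (Set.Ico (0 : ℝ) 1)) := ⟨by simp⟩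

namespace Strategy

variable {X : Type u} [MeasurableSpace X] {K d : ℕ} (S : Strategy X K d)

/-- The state after the given observations. -/
def stateOf : (t : ℕ) → (Fin t → Observation X K d) → S.State
  | 0, _ => S.init
  | t + 1, h => S.update t (stateOf t (Fin.init h)) (h (Fin.last t))

theorem measurable_stateOf (t : ℕ) : Measurable (S.stateOf t) := by
  induction t with
  | zero => exact measurable_const
  | succ t ih =>
    have h1 : Measurable fun h : Fin (t + 1) → Observation X K d => Fin.init h :=
      measurable_pi_lambda _ fun i => measurable_pi_apply _
    exact (S.measurable_update t).comp ((ih.comp h1).prodMk (measurable_pi_apply _))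

/-- The algorithm that samples its actions by inverse transform, with independent uniform
quantiles as seed. -/
abbrev toAlgorithm : Algorithm X K d where
  Seed := ℕ → ℝ
  seedLaw := Measure.infinitePi fun _ : ℕ => volume.restrict (Set.Ico (0 : ℝ) 1)
  seedLaw_prob := inferInstance
  act s t h x := samplePick (S.fallback x) (S.prob t (S.stateOf t h) x) (s t)
  measurable_act t := by
    refine measurable_samplePick (S.measurable_fallback.comp measurable_snd.snd) ?_
      ((measurable_pi_apply t).comp measurable_fst)
    exact (S.measurable_prob t).comp
      (((S.measurable_stateOf t).comp measurable_snd.fst).prodMk measurable_snd.snd)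

/-- The pairs of a seed and a sequence of outcomes. -/
abbrev Path (_S : Strategy X K d) : Type _ := (ℕ → ℝ) × (ℕ → Outcome X K d)

/-- The state before round `t`. -/
def stateAt (t : ℕ) (p : S.Path) : S.State := S.stateOf t (S.toAlgorithm.history p.1 p.2 t)

/-- What is observed in round `t`. -/
def obsAt (t : ℕ) (p : S.Path) : Observation X K d :=
  ((p.2 t).1, S.toAlgorithm.action p.1 p.2 t, (p.2 t).2 (S.toAlgorithm.action p.1 p.2 t))

theorem stateAt_zero (p : S.Path) : S.stateAt 0 p = S.init := rfl

theorem stateAt_succ (t : ℕ) (p : S.Path) :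
    S.stateAt (t + 1) p = S.update t (S.stateAt t p) (S.obsAt t p) := by
  simp only [stateAt, stateOf, Algorithm.history, Fin.init_snoc, Fin.snoc_last]
  rfl

theorem measurable_stateAt (t : ℕ) : Measurable (S.stateAt t) :=
  (S.measurable_stateOf t).comp (S.toAlgorithm.measurable_history t)

theorem measurable_obsAt (t : ℕ) : Measurable (S.obsAt t) := by
  have h1 : Measurable fun p : S.Path => (p.2 t).1 := by fun_prop
  exact h1.prodMk ((S.toAlgorithm.measurable_action t).prodMk (S.toAlgorithm.measurable_payoff t))

theorem stateAt_congr {t : ℕ} {p q : S.Path} (h1 : ∀ m < t, p.1 m = q.1 m)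
    (h2 : ∀ m < t, p.2 m = q.2 m) : S.stateAt t p = S.stateAt t q := by
  induction t with
  | zero => rfl
  | succ t ih =>
    have hst := ih (fun m hm => h1 m (hm.trans t.lt_succ_self))
      fun m hm => h2 m (hm.trans t.lt_succ_self)
    have ha : S.toAlgorithm.action p.1 p.2 t = S.toAlgorithm.action q.1 q.2 t := by
      change samplePick _ (S.prob t (S.stateAt t p) _) _ =
        samplePick _ (S.prob t (S.stateAt t q) _) _
      rw [hst, h1 t t.lt_succ_self, h2 t t.lt_succ_self]
    rw [stateAt_succ, stateAt_succ, hst, obsAt, obsAt, ha, h2 t t.lt_succ_self]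

/-- The expectation of `g` over the context, the action and the payoff of round `t`, if the state is
`σ` and `D` is the outcome distribution. -/
def stepMean (D : Measure (Outcome X K d)) (t : ℕ) (σ : S.State) (g : Observation X K d → ℝ) : ℝ :=
  ∫ o, ∑ a, S.prob t σ o.1 a * g (o.1, a, o.2 a) ∂D

/-- The expectation of a function of the state and of the observation of a round, computed by
averaging first over this round. -/
theorem integral_step (D : Measure (Outcome X K d)) [IsProbabilityMeasure D] (t : ℕ)
    (hp : ∀ p x a, 0 ≤ S.prob t (S.stateAt t p) x a)
    (hs : ∀ p x, ∑ a, S.prob t (S.stateAt t p) x a = 1) {g : S.State × Observation X K d → ℝ}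
    (hg : Measurable g) (hb : ∃ C, ∀ p o, |g (S.stateAt t p, o)| ≤ C) :
    ∫ p, g (S.stateAt t p, S.obsAt t p) ∂S.toAlgorithm.pathLaw D =
      ∫ p, S.stepMean D t (S.stateAt t p) (fun o => g (S.stateAt t p, o))
        ∂S.toAlgorithm.pathLaw D := by
  obtain ⟨C, hC⟩ := hb
  set U : Measure ℝ := volume.restrict (Set.Ico (0 : ℝ) 1)
  set F : S.Path → ℝ := fun p => g (S.stateAt t p, S.obsAt t p)
  have hF : BddMeas F := ⟨hg.comp ((S.measurable_stateAt t).prodMk (S.measurable_obsAt t)), C,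
    fun p => hC p _⟩
  have hupd : Measurable fun q : (S.Path) × Outcome X K d =>
      ((q.1.1, Function.update q.1.2 t q.2) : S.Path) := by
    refine measurable_fst.fst.prodMk (measurable_pi_lambda _ fun i => ?_)
    by_cases h : i = t
    · subst h; simpa using measurable_snd
    · simp only [Function.update_of_ne h]; fun_prop
  set G : S.Path → ℝ := fun p => ∫ o, F (p.1, Function.update p.2 t o) ∂D
  have hG : BddMeas G := BddMeas.integral (f := fun q : S.Path × Outcome X K d =>
    F (q.1.1, Function.update q.1.2 t q.2)) (hF.comp hupd) D
  have h1 : ∫ p, F p ∂S.toAlgorithm.pathLaw D = ∫ p, G p ∂S.toAlgorithm.pathLaw D :=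
    integral_resample S.toAlgorithm.seedLaw D t hF
  have h2 : ∫ p, G p ∂S.toAlgorithm.pathLaw D =
      ∫ p, ∫ u, G (Function.update p.1 t u, p.2) ∂U ∂S.toAlgorithm.pathLaw D := by
    rw [← integral_prod_swap]
    have := integral_resample (Measure.infinitePi fun _ : ℕ => D) U t
      (F := fun q : (ℕ → Outcome X K d) × (ℕ → ℝ) => G (q.2, q.1)) (hG.comp measurable_swap)
    refine this.trans ?_
    rw [← integral_prod_swap]
    rfl
  refine h1.trans (h2.trans (integral_congr_ae (Filter.Eventually.of_forall fun p => ?_)))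
  change ∫ u, ∫ o, F (Function.update p.1 t u, Function.update p.2 t o) ∂D ∂U = _
  have hmeas : Measurable fun q : ℝ × Outcome X K d =>
      ((Function.update p.1 t q.1, Function.update p.2 t q.2) : S.Path) := by
    refine Measurable.prodMk (measurable_pi_lambda _ fun i => ?_)
      (measurable_pi_lambda _ fun i => ?_)
    · by_cases h : i = t
      · subst h; simpa using measurable_fst
      · simp only [Function.update_of_ne h]; exact measurable_const
    · by_cases h : i = t
      · subst h; simpa using measurable_snd
      · simp only [Function.update_of_ne h]; exact measurable_const
  rw [integral_integral_swap (f := fun u o =>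
    F (Function.update p.1 t u, Function.update p.2 t o)) ((hF.comp hmeas).integrable _)]
  refine integral_congr_ae (Filter.Eventually.of_forall fun o => ?_)
  change _ = ∑ a, S.prob t (S.stateAt t p) o.1 a * g (S.stateAt t p, (o.1, a, o.2 a))
  rw [← integral_samplePick (S.fallback o.1) (hp p o.1) (hs p o.1)
    fun a => g (S.stateAt t p, (o.1, a, o.2 a))]
  refine integral_congr_ae (Filter.Eventually.of_forall fun u => ?_)
  have hst : S.stateAt t ((Function.update p.1 t u, Function.update p.2 t o) : S.Path) =
      S.stateAt t p :=
    S.stateAt_congr (fun m hm => Function.update_of_ne hm.ne _ _)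
      fun m hm => Function.update_of_ne hm.ne _ _
  have ha : S.toAlgorithm.action (Function.update p.1 t u) (Function.update p.2 t o) t =
      samplePick (S.fallback o.1) (S.prob t (S.stateAt t p) o.1) u := by
    change samplePick (S.fallback (Function.update p.2 t o t).1) (S.prob t (S.stateAt t
      ((Function.update p.1 t u, Function.update p.2 t o) : S.Path)) (Function.update p.2 t o t).1)
      (Function.update p.1 t u t) = _
    rw [hst, Function.update_self, Function.update_self]
  change g (S.stateAt t ((Function.update p.1 t u, Function.update p.2 t o) : S.Path),
    S.obsAt t ((Function.update p.1 t u, Function.update p.2 t o) : S.Path)) = _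
  rw [hst]
  simp only [obsAt, ha, Function.update_self]

end Strategy

end ResourcefulBandits

end

noncomputable section

open MeasureTheory ResourcefulBandits

theorem BddMeas.log_sum_exp {α ι : Type*} [MeasurableSpace α] [Fintype ι] [Nonempty ι]
    {l : ι → α → ℝ} (hl : ∀ i, BddMeas (l i)) :
    BddMeas fun x => Real.log (∑ i, Real.exp (l i x)) := by
  have hs : BddMeas fun x => ∑ i, Real.exp (l i x) := .sum fun i _ => (hl i).exp
  obtain ⟨C, hC⟩ := (hl (Classical.arbitrary ι)).2
  obtain ⟨C', hC'⟩ := hs.2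
  refine ⟨hs.1.log, max C C', fun x => abs_le.2 ⟨?_, ?_⟩⟩
  · have h1 := le_log_sum_exp (fun i => l i x) (Classical.arbitrary ι)
    have h2 := (abs_le.1 (hC x)).1
    have h3 := le_max_left C C'
    linarith
  · have h1 : 0 < ∑ i, Real.exp (l i x) :=
      Finset.sum_pos (fun i _ => Real.exp_pos _) Finset.univ_nonempty
    have h2 := Real.log_le_sub_one_of_pos h1
    have h3 := le_max_right C C'
    have h4 := (abs_le.1 (hC' x)).2
    linarith

namespace ResourcefulBandits.KnownData

variable {X : Type u} [MeasurableSpace X] (I : KnownData X)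

instance : Nonempty I.policies := I.policies_nonempty.to_subtype

instance : Nonempty (Fin I.d) := ⟨I.time⟩

/-! ### The algorithm -/

/-- The scale `√(d K T log (d K T |Π|))` of the regret. -/
def regretScale : ℝ :=
  √((I.d : ℝ) * I.K * I.T * Real.log ((I.d : ℝ) * I.K * I.T * I.policies.card))

/-- The rate of exploration, which is also the learning rate for the prices of the resources. -/
def rate : ℝ := I.regretScale / I.T

/-- The number of rounds in which the actions are chosen uniformly. -/
def warmup : ℕ := ⌈I.regretScale⌉₊

/-- The part of the budget that is spent after the warm-up. -/
def innerBudget : ℝ := I.minBudget * (1 - I.rate) - I.warmup - 1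

/-- What is estimated for each policy in the warm-up: the reward (`none`) and the scaled consumption
of every resource. -/
def payoffValue : Option (Fin I.d) → Payoff I.d → ℝ
  | none, o => unitClip o.1
  | some i, o => I.scaledCon i o

/-- The memory of the algorithm: for every policy, the totals of the values that were observed in
the warm-up when the action agreed with the policy; for every policy, the sum of the later
importance-weighted estimates of its Lagrangian payoff; and the later consumption of the resources,
where the clock of time runs at a varying speed. -/
abbrev State : Type _ :=
  (I.policies → Option (Fin I.d) → ℝ) × (I.policies → ℝ) × (Fin I.d → ℝ)

/-- Estimated mean reward, from rounded totals. -/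
def estReward (n : I.policies → Option (Fin I.d) → ℕ) (π : I.policies) : ℝ :=
  min 1 (I.K * n π none / I.warmup)

/-- Estimated mean consumption, from rounded totals. -/
def estCon (n : I.policies → Option (Fin I.d) → ℕ) (π : I.policies) (i : Fin I.d) : ℝ :=
  I.K * n π (some i) / I.warmup

/-- The exchange rate between reward and resources: an overestimate of the optimal reward per unit
of budget. The totals are rounded down to natural numbers, so that it takes only countably many
values. -/
def price (σ : I.State) : ℝ :=
  (6 * lpValue I.T I.minBudget (I.estReward fun π j => ⌊σ.1 π j⌋₊)
    (I.estCon fun π j => ⌊σ.1 π j⌋₊) + 8 * I.regretScale) / I.minBudget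

/-- Learning rate for the policies. -/
def eta (σ : I.State) : ℝ := I.rate / (I.K * (1 + I.price σ))

/-- Exponential weight of a policy, relative to the weight `1` of doing nothing. -/
def weight (σ : I.State) (π : I.policies) : ℝ := Real.exp (I.eta σ * σ.2.1 π)

/-- Normalized weight of a policy; what is missing from `1` is the weight of doing nothing. -/
def share (σ : I.State) (π : I.policies) : ℝ := I.weight σ π / (1 + ∑ q, I.weight σ q)

/-- Probability mass of acting, in one unit of virtual time. -/
def mass (σ : I.State) : ℝ := I.rate + ∑ π, I.share σ π

/-- Mass of an action in one unit of virtual time. -/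
def actionMass (σ : I.State) (x : X) (a : Fin I.K) : ℝ :=
  I.rate / I.K + ∑ π : I.policies, if π.1 x = a then I.share σ π else 0

/-- Consumption after the clock has been advanced. A round takes `1 / mass` units of virtual time,
the mean number of trials up to the first one that acts. -/
def clocked (σ : I.State) (i : Fin I.d) : ℝ :=
  σ.2.2 i + if i = I.time then 1 / I.mass σ * (I.minBudget / I.T) else 0

/-- Relative scarcity of the resources. -/
def scarcity (σ : I.State) (i : Fin I.d) : ℝ :=
  Real.exp (I.rate * I.clocked σ i) / ∑ j, Real.exp (I.rate * I.clocked σ j)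

/-- Reward minus the price of the consumed resources. -/
def lagrangian (σ : I.State) (o : Payoff I.d) : ℝ :=
  unitClip o.1 - I.price σ * ∑ i, I.scarcity σ i * I.scaledCon i o

/-- No resource is used up. -/
def Alive (σ : I.State) : Prop := ∀ i, σ.2.2 i < I.innerBudget

/-- The probabilities of the actions. -/
def actionProb (t : ℕ) (σ : I.State) (x : X) (a : Fin I.K) : ℝ :=
  if t < I.warmup then 1 / I.K else I.actionMass σ x a / I.mass σ

/-- Importance-weighted estimate of the Lagrangian payoff of a policy. -/
def estimate (σ : I.State) (o : Observation X I.K I.d) (π : I.policies) : ℝ :=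
  if π.1 o.1 = o.2.1 then I.lagrangian σ o.2.2 / I.actionMass σ o.1 o.2.1 else 0

open Classical in
/-- The memory after a round. -/
def nextState (t : ℕ) (σ : I.State) (o : Observation X I.K I.d) : I.State :=
  if t < I.warmup then
    (fun π j => σ.1 π j + if π.1 o.1 = o.2.1 then I.payoffValue j o.2.2 else 0, σ.2)
  else if I.Alive σ then
    (σ.1, fun π => σ.2.1 π + I.estimate σ o π, fun i => I.clocked σ i + I.scaledCon i o.2.2)
  else σ

theorem payoffValue_mem (j : Option (Fin I.d)) (o : Payoff I.d) :
    I.payoffValue j o ∈ Set.Icc (0 : ℝ) 1 := by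
  cases j
  · exact unitClip_mem _
  · exact I.scaledCon_mem _ _

theorem measurable_payoffValue (j : Option (Fin I.d)) : Measurable (I.payoffValue j) := by
  cases j
  · exact measurable_unitClip.comp measurable_fst
  · exact I.measurable_scaledCon _

theorem measurable_price : Measurable I.price := by
  have h1 : Measurable fun σ : I.State => fun π j => ⌊σ.1 π j⌋₊ := by
    refine measurable_pi_lambda _ fun π => measurable_pi_lambda _ fun j => ?_
    exact Nat.measurable_floor.comp (by fun_prop)
  exact (measurable_of_countable (fun n : I.policies → Option (Fin I.d) → ℕ =>
    (6 * lpValue I.T I.minBudget (I.estReward n) (I.estCon n) + 8 * I.regretScale) /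
      I.minBudget)).comp h1

theorem measurable_weight (π : I.policies) : Measurable fun σ => I.weight σ π := by
  have := I.measurable_price
  unfold weight eta
  fun_prop

theorem measurable_share (π : I.policies) : Measurable fun σ => I.share σ π := by
  have := I.measurable_weight
  unfold share
  fun_prop

theorem measurable_mass : Measurable I.mass := by
  have := I.measurable_share
  unfold mass
  fun_prop

theorem measurable_clocked (i : Fin I.d) : Measurable fun σ => I.clocked σ i := by
  have := I.measurable_mass
  unfold clocked
  split_ifs <;> fun_prop

theorem measurable_scarcity (i : Fin I.d) : Measurable fun σ => I.scarcity σ i := by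
  have := I.measurable_clocked
  unfold scarcity
  fun_prop

theorem measurable_lagrangian :
    Measurable fun q : I.State × Payoff I.d => I.lagrangian q.1 q.2 := by
  have h1 := I.measurable_scarcity
  have h2 := I.measurable_scaledCon
  have h3 := I.measurable_price
  have h4 := measurable_unitClip
  unfold lagrangian
  fun_prop

theorem measurableSet_policy_eq (π : I.policies) {α : Type*} [MeasurableSpace α] {f : α → X}
    {g : α → Fin I.K} (hf : Measurable f) (hg : Measurable g) :
    MeasurableSet {q | π.1 (f q) = g q} :=
  measurableSet_eq_fun ((I.policies_measurable _ π.2).comp hf) hg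

theorem measurable_actionMass :
    Measurable fun q : I.State × X × Fin I.K => I.actionMass q.1 q.2.1 q.2.2 := by
  unfold actionMass
  refine measurable_const.add (Finset.measurable_sum _ fun π _ => ?_)
  exact Measurable.ite (I.measurableSet_policy_eq π measurable_snd.fst measurable_snd.snd)
    ((I.measurable_share π).comp measurable_fst) measurable_const

theorem measurable_actionProb (t : ℕ) :
    Measurable fun q : I.State × X => I.actionProb t q.1 q.2 := by
  refine measurable_pi_lambda _ fun a => ?_
  unfold actionProb
  split_ifs
  · exact measurable_const
  · exact (I.measurable_actionMass.comp (measurable_fst.prodMk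
      (measurable_snd.prodMk measurable_const))).div (I.measurable_mass.comp measurable_fst)

theorem measurable_estimate (π : I.policies) :
    Measurable fun q : I.State × Observation X I.K I.d => I.estimate q.1 q.2 π := by
  unfold estimate
  refine Measurable.ite (I.measurableSet_policy_eq π measurable_snd.fst measurable_snd.snd.fst)
    (Measurable.div ?_ ?_) measurable_const
  · exact I.measurable_lagrangian.comp (measurable_fst.prodMk measurable_snd.snd.snd)
  · exact I.measurable_actionMass.comp (measurable_fst.prodMk
      (measurable_snd.fst.prodMk measurable_snd.snd.fst))

theorem measurableSet_alive : MeasurableSet {σ : I.State | I.Alive σ} := by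
  simp only [Alive, Set.ofPred_forall]
  exact MeasurableSet.iInter fun i => measurableSet_lt (by fun_prop) measurable_const

theorem measurable_nextState (t : ℕ) :
    Measurable fun q : I.State × Observation X I.K I.d => I.nextState t q.1 q.2 := by
  classical
  unfold nextState
  split_ifs
  · refine Measurable.prodMk (measurable_pi_lambda _ fun π => measurable_pi_lambda _ fun j => ?_)
      measurable_fst.snd
    refine Measurable.add (by fun_prop) (Measurable.ite
      (I.measurableSet_policy_eq π measurable_snd.fst measurable_snd.snd.fst) ?_ measurable_const)
    exact (I.measurable_payoffValue j).comp measurable_snd.snd.snd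
  · refine Measurable.ite (measurable_fst I.measurableSet_alive) ?_ measurable_fst
    refine measurable_fst.fst.prodMk (Measurable.prodMk (measurable_pi_lambda _ fun π => ?_)
      (measurable_pi_lambda _ fun i => ?_))
    · exact Measurable.add (by fun_prop) (I.measurable_estimate π)
    · exact ((I.measurable_clocked i).comp measurable_fst).add
        ((I.measurable_scaledCon i).comp measurable_snd.snd.snd)

/-- The algorithm: a warm-up with uniform actions, and then exponential weights over the policies
against exponential weights over the resources. -/
abbrev strategy : Strategy X I.K I.d where
  State := I.State
  init := 0
  prob := I.actionProb
  update := I.nextState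
  fallback := (Classical.arbitrary I.policies).1
  measurable_prob := I.measurable_actionProb
  measurable_update := I.measurable_nextState
  measurable_fallback := I.policies_measurable _ (Classical.arbitrary I.policies).2

end ResourcefulBandits.KnownData

end

noncomputable section

open MeasureTheory ResourcefulBandits

namespace ResourcefulBandits.KnownData

variable {X : Type u} [MeasurableSpace X] {I : KnownData X}

/-! ### The regime in which the bound is not trivial -/

theorem one_le_T' : (1 : ℝ) ≤ I.T := by exact_mod_cast I.one_le_T

theorem T_pos : (0 : ℝ) < I.T := zero_lt_one.trans_le I.one_le_T'

theorem one_le_d : (1 : ℝ) ≤ I.d := by exact_mod_cast I.time.pos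

theorem one_le_card : (1 : ℝ) ≤ I.policies.card := by
  exact_mod_cast Finset.card_pos.2 I.policies_nonempty

variable (I) in
/-- There is a choice between actions, and the budget is large compared with the regret scale. -/
structure Regime : Prop where
  two_le_K : 2 ≤ I.K
  large : 400 * I.regretScale ≤ I.minBudget

variable (I) in
/-- The argument of the logarithm in the regret bound. -/
def logArg : ℝ := (I.d : ℝ) * I.K * I.T * I.policies.card

theorem regretScale_sq (hK : 1 ≤ I.K) :
    I.regretScale ^ 2 = (I.d : ℝ) * I.K * I.T * Real.log I.logArg := by
  have h1 : (1 : ℝ) ≤ I.K := by exact_mod_cast hK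
  refine Real.sq_sqrt (mul_nonneg (by positivity) (Real.log_nonneg ?_))
  exact one_le_mul_of_one_le_of_one_le (one_le_mul_of_one_le_of_one_le
    (one_le_mul_of_one_le_of_one_le I.one_le_d h1) I.one_le_T') I.one_le_card

namespace Regime

theorem two_le_K' (h : I.Regime) : (2 : ℝ) ≤ I.K := by exact_mod_cast h.two_le_K

theorem K_pos (h : I.Regime) : (0 : ℝ) < I.K := by linarith [h.two_le_K']

theorem one_le_dT (_h : I.Regime) : (1 : ℝ) ≤ I.d * I.T :=
  one_le_mul_of_one_le_of_one_le I.one_le_d I.one_le_T'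

theorem two_mul_card_le (h : I.Regime) : 2 * (I.policies.card : ℝ) ≤ I.logArg := by
  have h1 := mul_le_mul h.one_le_dT h.two_le_K' (by norm_num) (by linarith [h.one_le_dT])
  have h2 := mul_le_mul_of_nonneg_right h1 (zero_le_one.trans I.one_le_card)
  unfold logArg
  linarith

theorem two_le_logArg (h : I.Regime) : 2 ≤ I.logArg := by
  linarith [h.two_mul_card_le, I.one_le_card]

theorem half_lt_log (h : I.Regime) : 1 / 2 < Real.log I.logArg := by
  have := Real.log_le_log (by norm_num) h.two_le_logArg
  linarith [Real.log_two_gt_d9]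

theorem sq_eq (h : I.Regime) :
    I.regretScale ^ 2 = (I.d : ℝ) * I.K * I.T * Real.log I.logArg :=
  I.regretScale_sq (by linarith [h.two_le_K])

theorem mul_log_le (h : I.Regime) {c l : ℝ} (hc0 : 0 ≤ c) (hc : c ≤ I.d * I.K * I.T) {m : ℝ}
    (hm : 0 ≤ m) (hl : l ≤ m * Real.log I.logArg) : c * l ≤ m * I.regretScale ^ 2 := by
  rw [h.sq_eq]
  have h1 := mul_le_mul_of_nonneg_left hl hc0
  have h2 : 0 ≤ m * Real.log I.logArg := mul_nonneg hm (by linarith [h.half_lt_log])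
  have h3 := mul_le_mul_of_nonneg_right hc h2
  linarith

theorem T_le (h : I.Regime) : (I.T : ℝ) ≤ I.d * I.K * I.T := by
  have h1 := mul_le_mul I.one_le_d (by linarith [h.two_le_K'] : (1 : ℝ) ≤ I.K) zero_le_one
    (by linarith [I.one_le_d])
  nlinarith [I.T_pos]

theorem TK_le (h : I.Regime) : (I.T : ℝ) * I.K ≤ I.d * I.K * I.T := by
  have := mul_le_mul_of_nonneg_right I.one_le_d (mul_nonneg I.T_pos.le h.K_pos.le)
  linarith

theorem T_le_sq (h : I.Regime) : (I.T : ℝ) ≤ I.regretScale ^ 2 := by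
  have h1 : (2 : ℝ) * I.T ≤ I.d * I.K * I.T := by
    have := mul_le_mul I.one_le_d h.two_le_K' (by norm_num) (by linarith [I.one_le_d])
    nlinarith [I.T_pos]
  have := h.mul_log_le (c := 2 * I.T) (l := 1 / 2) (m := 1) (by linarith [I.T_pos]) h1 zero_le_one
    (by linarith [h.half_lt_log])
  linarith

theorem one_le_scale (h : I.Regime) : 1 ≤ I.regretScale := by
  have h1 := h.T_le_sq
  have h2 := I.one_le_T'
  have h3 : 0 ≤ I.regretScale := Real.sqrt_nonneg _
  nlinarith

theorem scale_pos (h : I.Regime) : 0 < I.regretScale := zero_lt_one.trans_le h.one_le_scale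

theorem log_card_le (h : I.Regime) :
    (I.T : ℝ) * I.K * Real.log (1 + I.policies.card) ≤ I.regretScale ^ 2 := by
  have := h.mul_log_le (l := Real.log (1 + I.policies.card)) (m := 1)
    (mul_nonneg I.T_pos.le h.K_pos.le) h.TK_le zero_le_one (by
      rw [one_mul]
      exact Real.log_le_log (by linarith [I.one_le_card])
        (by linarith [I.one_le_card, h.two_mul_card_le]))
  linarith

theorem log_d_le (h : I.Regime) : (I.T : ℝ) * Real.log I.d ≤ I.regretScale ^ 2 := by
  have := h.mul_log_le (l := Real.log I.d) (m := 1) I.T_pos.le h.T_le zero_le_one (by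
      rw [one_mul]
      refine Real.log_le_log (by linarith [I.one_le_d]) ?_
      have h1 : (1 : ℝ) ≤ I.K * I.T * I.policies.card :=
        one_le_mul_of_one_le_of_one_le (one_le_mul_of_one_le_of_one_le
          (by linarith [h.two_le_K']) I.one_le_T') I.one_le_card
      unfold logArg
      nlinarith [I.one_le_d])
  linarith

/-- The logarithmic term of the deviation bound in the warm-up. -/
theorem log_union_le (h : I.Regime) :
    (I.T : ℝ) * I.K * Real.log (2 * I.policies.card * (I.d + 1) * I.T) ≤
      2 * I.regretScale ^ 2 := by
  refine h.mul_log_le (mul_nonneg I.T_pos.le h.K_pos.le) h.TK_le zero_le_two ?_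
  have h0 : (0 : ℝ) < 2 * I.policies.card * (I.d + 1) * I.T := by
    have := I.one_le_card
    have := I.T_pos
    positivity
  rw [show (2 : ℝ) * Real.log I.logArg = Real.log (I.logArg ^ 2) by rw [Real.log_pow]; norm_num]
  refine Real.log_le_log h0 ?_
  have h1 : (2 : ℝ) * I.policies.card * (I.d + 1) * I.T ≤ 2 * I.logArg := by
    have ha : (0 : ℝ) ≤ I.policies.card * I.T :=
      mul_nonneg (by linarith [I.one_le_card]) I.T_pos.le
    have hb : (I.d : ℝ) + 1 ≤ I.d * I.K := by nlinarith [I.one_le_d, h.two_le_K']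
    unfold logArg
    nlinarith [mul_le_mul_of_nonneg_left hb ha]
  nlinarith [h.two_le_logArg]

theorem TK_le_sq (h : I.Regime) : (I.T : ℝ) * I.K ≤ 2 * I.regretScale ^ 2 := by
  have := h.mul_log_le (l := 1) (m := 2)
    (mul_nonneg I.T_pos.le h.K_pos.le) h.TK_le zero_le_two (by linarith [h.half_lt_log])
  linarith

theorem scale_le_T (h : I.Regime) : 400 * I.regretScale ≤ I.T := h.large.trans I.minBudget_le_T

theorem rate_pos (h : I.Regime) : 0 < I.rate := div_pos h.scale_pos I.T_pos

theorem rate_le_one (h : I.Regime) : I.rate ≤ 1 :=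
  (div_le_one I.T_pos).2 (by linarith [h.scale_le_T, h.one_le_scale])

theorem rate_mul_T (_h : I.Regime) : I.rate * I.T = I.regretScale :=
  div_mul_cancel₀ _ I.T_pos.ne'

theorem warmup_le (h : I.Regime) : (I.warmup : ℝ) ≤ I.regretScale + 1 :=
  (Nat.ceil_lt_add_one h.scale_pos.le).le

end Regime

theorem scale_le_warmup : I.regretScale ≤ I.warmup := Nat.le_ceil _

/-! ### Bounds for the quantities in the algorithm -/

theorem estReward_mem (n : I.policies → Option (Fin I.d) → ℕ) (π : I.policies) :
    I.estReward n π ∈ Set.Icc (0 : ℝ) 1 :=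
  ⟨le_min zero_le_one (by positivity), min_le_left _ _⟩

variable (I) in
/-- A bound for the price that holds whatever has been observed. -/
def priceBound : ℝ := (6 * I.T + 8 * I.regretScale) / I.minBudget

theorem price_nonneg (σ : I.State) : 0 ≤ I.price σ := by
  refine div_nonneg (add_nonneg (mul_nonneg (by norm_num) (lpValue_nonneg I.T_pos.le
    fun π => (estReward_mem _ π).1)) ?_) I.minBudget_pos.le
  exact mul_nonneg (by norm_num) (Real.sqrt_nonneg _)

theorem price_le (σ : I.State) : I.price σ ≤ I.priceBound := by
  refine div_le_div_of_nonneg_right ?_ I.minBudget_pos.le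
  have := lpValue_le (T := I.T) (B := I.minBudget)
    (c := I.estCon fun π j => ⌊σ.1 π j⌋₊) I.T_pos.le
    fun π => (estReward_mem (fun π j => ⌊σ.1 π j⌋₊) π).2
  linarith

theorem weight_pos (σ : I.State) (π : I.policies) : 0 < I.weight σ π := Real.exp_pos _

theorem one_add_sum_weight_pos (σ : I.State) : 0 < 1 + ∑ π, I.weight σ π :=
  add_pos_of_pos_of_nonneg one_pos (Finset.sum_nonneg fun π _ => (weight_pos σ π).le)

theorem share_nonneg (σ : I.State) (π : I.policies) : 0 ≤ I.share σ π :=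
  div_nonneg (weight_pos σ π).le (one_add_sum_weight_pos σ).le

theorem sum_share_le_one (σ : I.State) : ∑ π, I.share σ π ≤ 1 := by
  unfold share
  rw [← Finset.sum_div, div_le_one (one_add_sum_weight_pos σ)]
  linarith

theorem rate_le_mass (σ : I.State) : I.rate ≤ I.mass σ :=
  le_add_of_nonneg_right (Finset.sum_nonneg fun π _ => share_nonneg σ π)

theorem mass_le (σ : I.State) : I.mass σ ≤ 1 + I.rate := by
  unfold mass; linarith [sum_share_le_one σ]

theorem Regime.mass_pos (h : I.Regime) (σ : I.State) : 0 < I.mass σ :=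
  h.rate_pos.trans_le (rate_le_mass σ)

theorem sum_ite_share (σ : I.State) (x : X) (a : Fin I.K) :
    (∑ π : I.policies, if π.1 x = a then I.share σ π else 0) =
      I.actionMass σ x a - I.rate / I.K := by
  unfold actionMass; ring

theorem rate_div_le_actionMass (σ : I.State) (x : X) (a : Fin I.K) :
    I.rate / I.K ≤ I.actionMass σ x a := by
  refine le_add_of_nonneg_right (Finset.sum_nonneg fun π _ => ?_)
  split_ifs
  · exact share_nonneg σ π
  · exact le_rfl

theorem Regime.rate_div_pos (h : I.Regime) : 0 < I.rate / I.K := div_pos h.rate_pos h.K_pos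

theorem Regime.actionMass_pos (h : I.Regime) (σ : I.State) (x : X) (a : Fin I.K) :
    0 < I.actionMass σ x a :=
  h.rate_div_pos.trans_le (rate_div_le_actionMass σ x a)

theorem Regime.sum_actionMass (h : I.Regime) (σ : I.State) (x : X) :
    ∑ a, I.actionMass σ x a = I.mass σ := by
  unfold actionMass mass
  rw [Finset.sum_add_distrib, Finset.sum_comm]
  congr 1
  · simp only [Finset.sum_const, Finset.card_univ, Fintype.card_fin, nsmul_eq_mul]
    exact mul_div_cancel₀ _ h.K_pos.ne'
  · simp

theorem Regime.actionProb_nonneg (h : I.Regime) (t : ℕ) (σ : I.State) (x : X) (a : Fin I.K) :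
    0 ≤ I.actionProb t σ x a := by
  unfold actionProb
  split_ifs
  · positivity
  · exact div_nonneg (h.actionMass_pos σ x a).le (h.mass_pos σ).le

theorem Regime.sum_actionProb (h : I.Regime) (t : ℕ) (σ : I.State) (x : X) :
    ∑ a, I.actionProb t σ x a = 1 := by
  unfold actionProb
  split_ifs
  · simp only [Finset.sum_const, Finset.card_univ, Fintype.card_fin, nsmul_eq_mul]
    exact mul_one_div_cancel h.K_pos.ne'
  · rw [← Finset.sum_div, h.sum_actionMass, div_self (h.mass_pos σ).ne']

theorem scarcity_nonneg (σ : I.State) (i : Fin I.d) : 0 ≤ I.scarcity σ i :=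
  div_nonneg (Real.exp_pos _).le (Finset.sum_nonneg fun _ _ => (Real.exp_pos _).le)

theorem sum_scarcity (σ : I.State) : ∑ i, I.scarcity σ i = 1 := by
  unfold scarcity
  rw [← Finset.sum_div, div_self]
  exact (Finset.sum_pos (fun i _ => Real.exp_pos _) Finset.univ_nonempty).ne'

theorem scarcity_con_mem (σ : I.State) (o : Payoff I.d) :
    ∑ i, I.scarcity σ i * I.scaledCon i o ∈ Set.Icc (0 : ℝ) 1 := by
  refine ⟨Finset.sum_nonneg fun i _ => mul_nonneg (scarcity_nonneg σ i) (I.scaledCon_mem i o).1, ?_⟩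
  rw [← sum_scarcity σ]
  exact Finset.sum_le_sum fun i _ => mul_le_of_le_one_right (scarcity_nonneg σ i)
    (I.scaledCon_mem i o).2

theorem lagrangian_mem (σ : I.State) (o : Payoff I.d) :
    I.lagrangian σ o ∈ Set.Icc (-I.price σ) 1 := by
  have h1 := unitClip_mem o.1
  have h2 := scarcity_con_mem σ o
  have h3 := price_nonneg σ
  unfold lagrangian
  constructor
  · nlinarith [h1.1, mul_le_mul_of_nonneg_left h2.2 h3]
  · nlinarith [h1.2, mul_nonneg h3 h2.1]

theorem abs_lagrangian_le (σ : I.State) (o : Payoff I.d) :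
    |I.lagrangian σ o| ≤ 1 + I.price σ := by
  have h := lagrangian_mem σ o
  have h3 := price_nonneg σ
  exact abs_le.2 ⟨by linarith [h.1], by linarith [h.2]⟩

theorem Regime.abs_estimate_le (h : I.Regime) (σ : I.State) (o : Observation X I.K I.d)
    (π : I.policies) : |I.estimate σ o π| ≤ (1 + I.priceBound) / (I.rate / I.K) := by
  have hp := price_nonneg σ
  have hp' := price_le σ
  unfold estimate
  split_ifs
  · rw [abs_div, abs_of_pos (h.actionMass_pos σ _ _)]
    exact div_le_div₀ (by linarith) ((abs_lagrangian_le σ _).trans (by linarith))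
      h.rate_div_pos (rate_div_le_actionMass σ _ _)
  · rw [abs_zero]
    exact div_nonneg (by linarith) h.rate_div_pos.le

/-! ### One round -/

theorem Regime.eta_pos (h : I.Regime) (σ : I.State) : 0 < I.eta σ :=
  div_pos h.rate_pos (mul_pos h.K_pos (by linarith [price_nonneg σ]))

theorem Regime.eta_mul (h : I.Regime) (σ : I.State) :
    I.eta σ * (1 + I.price σ) = I.rate / I.K := by
  have h1 : 1 + I.price σ ≠ 0 := by linarith [price_nonneg σ]
  have h2 := h.K_pos.ne'
  unfold eta
  field_simp

theorem Regime.sum_share_estimate (h : I.Regime) (σ : I.State) (o : Observation X I.K I.d) :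
    ∑ π, I.share σ π * (I.eta σ * I.estimate σ o π + (I.eta σ * I.estimate σ o π) ^ 2) ≤
      I.eta σ * (I.lagrangian σ o.2.2 +
        2 * I.rate * (1 + I.price σ) / I.K / I.actionMass σ o.1 o.2.1) := by
  set ρ := I.actionMass σ o.1 o.2.1
  set L := I.lagrangian σ o.2.2
  set Z := I.price σ
  have hZ : 0 ≤ Z := price_nonneg σ
  have hρ : 0 < ρ := h.actionMass_pos σ _ _
  have hη := h.eta_pos σ
  have hL := lagrangian_mem σ o.2.2
  have h1 : ∑ π, I.share σ π * (I.eta σ * I.estimate σ o π + (I.eta σ * I.estimate σ o π) ^ 2) =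
      (ρ - I.rate / I.K) * (I.eta σ * (L / ρ) + (I.eta σ * (L / ρ)) ^ 2) := by
    rw [← sum_ite_share, Finset.sum_mul]
    refine Finset.sum_congr rfl fun π _ => ?_
    unfold estimate
    split_ifs
    · rfl
    · simp
  rw [h1]
  have h2 : (ρ - I.rate / I.K) * (I.eta σ * (L / ρ) + (I.eta σ * (L / ρ)) ^ 2) =
      I.eta σ * (L + (I.rate / I.K * (-L) + (1 - I.rate / I.K / ρ) * (I.eta σ * L ^ 2)) / ρ) := by
    have := hρ.ne'
    field_simp
    ring
  rw [h2]
  refine mul_le_mul_of_nonneg_left (add_le_add_right ?_ _) hη.le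
  refine div_le_div_of_nonneg_right ?_ hρ.le
  have hr := h.rate_div_pos
  have hq : I.rate / I.K / ρ ≤ 1 := (div_le_one hρ).2 (rate_div_le_actionMass σ _ _)
  have hq0 : 0 ≤ I.rate / I.K / ρ := div_nonneg hr.le hρ.le
  have hL2 : L ^ 2 ≤ (1 + Z) ^ 2 := sq_le_sq.2 (by
    rw [abs_of_pos (by linarith : 0 < 1 + Z)]; exact abs_lagrangian_le σ _)
  have h3 : I.eta σ * L ^ 2 ≤ I.rate / I.K * (1 + Z) := by
    calc I.eta σ * L ^ 2 ≤ I.eta σ * (1 + Z) ^ 2 := mul_le_mul_of_nonneg_left hL2 hη.le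
      _ = I.eta σ * (1 + Z) * (1 + Z) := by ring
      _ = _ := by rw [h.eta_mul σ]
  have h4 : (1 - I.rate / I.K / ρ) * (I.eta σ * L ^ 2) ≤ I.rate / I.K * (1 + Z) :=
    (mul_le_of_le_one_left (mul_nonneg hη.le (sq_nonneg L)) (by linarith)).trans h3
  have h5 : I.rate / I.K * (-L) ≤ I.rate / I.K * (1 + Z) :=
    mul_le_mul_of_nonneg_left (by linarith [hL.1]) hr.le
  calc _ ≤ I.rate / I.K * (1 + Z) + I.rate / I.K * (1 + Z) := add_le_add h5 h4
    _ = _ := by ring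

/-- The exponential weights over the policies: the growth of the logarithm of the total weight in
one round is at most the Lagrangian payoff of the action, up to terms of second order. -/
theorem Regime.log_weight_step (h : I.Regime) (σ : I.State) (o : Observation X I.K I.d) :
    Real.log (1 + ∑ π, Real.exp (I.eta σ * (σ.2.1 π + I.estimate σ o π))) -
        Real.log (1 + ∑ π, I.weight σ π) ≤
      I.eta σ * (I.lagrangian σ o.2.2 +
        2 * I.rate * (1 + I.price σ) / I.K / I.actionMass σ o.1 o.2.1) := by
  refine le_trans ?_ (h.sum_share_estimate σ o)
  have hx : ∀ π, I.eta σ * I.estimate σ o π ≤ 1 := by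
    intro π
    have hZ := price_nonneg σ
    unfold estimate
    split_ifs
    · rw [mul_div_assoc', div_le_one (h.actionMass_pos σ _ _)]
      calc I.eta σ * I.lagrangian σ o.2.2 ≤ I.eta σ * (1 + I.price σ) :=
            mul_le_mul_of_nonneg_left (by linarith [(lagrangian_mem σ o.2.2).2]) (h.eta_pos σ).le
        _ = I.rate / I.K := h.eta_mul σ
        _ ≤ _ := rate_div_le_actionMass σ _ _
    · simp
  have := log_sum_exp_step zero_le_one (fun π => (weight_pos σ π).le) hx (one_add_sum_weight_pos σ)
  simpa only [weight, share, mul_add, Real.exp_add] using this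

/-- The exponential weights over the resources: as the advance of the clock is known before the
round, it causes no second-order term. -/
theorem Regime.log_scarcity_step (h : I.Regime) (σ : I.State) (o : Payoff I.d) :
    Real.log (∑ i, Real.exp (I.rate * (I.clocked σ i + I.scaledCon i o))) -
        Real.log (∑ i, Real.exp (I.rate * σ.2.2 i)) ≤
      I.rate * (I.scarcity σ I.time * (1 / I.mass σ * (I.minBudget / I.T)) +
        ∑ i, I.scarcity σ i * I.scaledCon i o + I.rate) := by
  have h1 := log_sum_exp_sub_le (fun i => I.rate * σ.2.2 i)
    (fun i => I.rate * if i = I.time then 1 / I.mass σ * (I.minBudget / I.T) else 0)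
  simp only [← mul_add] at h1
  change Real.log (∑ i, Real.exp (I.rate * I.clocked σ i)) - _ ≤ ∑ i, I.scarcity σ i * _ at h1
  have hr := h.rate_pos.le
  have h2 := log_sum_exp_step (c := 0) (w := fun i => Real.exp (I.rate * I.clocked σ i))
    (x := fun i => I.rate * I.scaledCon i o) le_rfl (fun i => (Real.exp_pos _).le)
    (fun i => mul_le_one₀ h.rate_le_one (I.scaledCon_mem i o).1 (I.scaledCon_mem i o).2)
    (by rw [zero_add]; exact Finset.sum_pos (fun i _ => Real.exp_pos _) Finset.univ_nonempty)
  simp only [zero_add, ← Real.exp_add, ← mul_add] at h2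
  change _ ≤ ∑ i, I.scarcity σ i * _ at h2
  have h3 : ∑ i, I.scarcity σ i * (I.rate * if i = I.time then
      1 / I.mass σ * (I.minBudget / I.T) else 0) =
      I.rate * (I.scarcity σ I.time * (1 / I.mass σ * (I.minBudget / I.T))) := by
    rw [Finset.sum_eq_single I.time]
    · rw [if_pos rfl]; ring
    · intro i _ hi; rw [if_neg hi]; ring
    · simp
  have h4 : ∑ i, I.scarcity σ i * (I.rate * I.scaledCon i o + (I.rate * I.scaledCon i o) ^ 2) ≤
      I.rate * ∑ i, I.scarcity σ i * I.scaledCon i o + I.rate * I.rate := by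
    calc _ ≤ ∑ i, (I.rate * (I.scarcity σ i * I.scaledCon i o) +
          I.scarcity σ i * (I.rate * I.rate)) := by
          refine Finset.sum_le_sum fun i _ => ?_
          have hc := I.scaledCon_mem i o
          have hc2 : I.scaledCon i o ^ 2 ≤ 1 := pow_le_one₀ hc.1 hc.2
          have := mul_le_mul_of_nonneg_left (mul_le_of_le_one_right (mul_nonneg hr hr) hc2)
            (scarcity_nonneg σ i)
          linarith [this]
      _ = _ := by
          rw [Finset.sum_add_distrib, ← Finset.mul_sum, ← Finset.sum_mul, sum_scarcity, one_mul]
  rw [h3] at h1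
  linarith

end ResourcefulBandits.KnownData

end

noncomputable section

open MeasureTheory ResourcefulBandits

namespace ResourcefulBandits.KnownData

variable {X : Type u} [MeasurableSpace X] {I : KnownData X}

/-! ### The potential -/

variable (I) in
/-- The potential that measures the progress of the algorithm against a vector `P` of policies with
reward `V` over the horizon: the logarithms of the total weights of both players, and a term for the
elapsed virtual time, in which the benefit of `P` accrues. -/
def potential (V : ℝ) (P : I.policies → ℝ) (σ : I.State) : ℝ :=
  I.K * (1 + I.price σ) / I.rate * Real.log (1 + ∑ π, I.weight σ π) - ∑ π, P π * σ.2.1 π +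
    I.price σ / I.rate * Real.log (∑ i, Real.exp (I.rate * σ.2.2 i)) +
    σ.2.2 I.time * ((V - I.price σ * I.minBudget - 2 * I.rate * (1 + I.price σ) * I.T) /
      I.minBudget)

variable (I) in
open Classical in
/-- The reward of a round, minus the growth of the potential, plus the second-order loss. -/
def surplus (V : ℝ) (P : I.policies → ℝ) (t : ℕ) (σ : I.State) (o : Observation X I.K I.d) : ℝ :=
  (if I.Alive σ then unitClip o.2.2.1 else 0) -
    (I.potential V P (I.nextState t σ o) - I.potential V P σ) + I.price σ * I.rate

theorem nextState_alive {t : ℕ} (ht : ¬ t < I.warmup) {σ : I.State} (hσ : I.Alive σ)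
    (o : Observation X I.K I.d) : I.nextState t σ o = (σ.1, fun π => σ.2.1 π + I.estimate σ o π,
      fun i => I.clocked σ i + I.scaledCon i o.2.2) := by
  unfold nextState
  rw [if_neg ht, if_pos hσ]

theorem nextState_dead {t : ℕ} (ht : ¬ t < I.warmup) {σ : I.State} (hσ : ¬ I.Alive σ)
    (o : Observation X I.K I.d) : I.nextState t σ o = σ := by
  unfold nextState
  rw [if_neg ht, if_neg hσ]

theorem price_congr {σ τ : I.State} (h : σ.1 = τ.1) : I.price σ = I.price τ := by
  unfold price; rw [h]

theorem Regime.le_surplus (h : I.Regime) (V : ℝ) (P : I.policies → ℝ) {t : ℕ}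
    (ht : ¬ t < I.warmup) {σ : I.State} (hσ : I.Alive σ) (o : Observation X I.K I.d) :
    ∑ π, P π * I.estimate σ o π -
        2 * I.rate * (1 + I.price σ) / I.K / I.actionMass σ o.1 o.2.1 -
        I.price σ * (I.scarcity σ I.time * (1 / I.mass σ * (I.minBudget / I.T))) -
        1 / I.mass σ * ((V - I.price σ * I.minBudget) / I.T - 2 * I.rate * (1 + I.price σ)) ≤
      I.surplus V P t σ o := by
  have hZ := price_nonneg σ
  have hr := h.rate_pos
  have hK := h.K_pos
  have h1 := h.log_weight_step σ o
  have h2 := h.log_scarcity_step σ o.2.2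
  have hc : 0 ≤ I.K * (1 + I.price σ) / I.rate := by positivity
  have h3 := mul_le_mul_of_nonneg_left h1 hc
  have h4 := mul_le_mul_of_nonneg_left h2 (div_nonneg hZ hr.le)
  have hce : I.K * (1 + I.price σ) / I.rate * I.eta σ = 1 := by
    have h5 := h.eta_mul σ
    have : I.K * (1 + I.price σ) / I.rate * I.eta σ =
        I.K / I.rate * (I.eta σ * (1 + I.price σ)) := by
      ring
    rw [this, h5]
    field_simp
  rw [← mul_assoc, hce, one_mul] at h3
  rw [← mul_assoc, div_mul_cancel₀ _ hr.ne'] at h4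
  have hclock : I.clocked σ I.time = σ.2.2 I.time + 1 / I.mass σ * (I.minBudget / I.T) := by
    unfold clocked; rw [if_pos rfl]
  have hp : I.price (I.nextState t σ o) = I.price σ :=
    price_congr (by rw [nextState_alive ht hσ])
  unfold surplus potential
  rw [if_pos hσ, hp]
  have hw : ∀ π, I.weight (I.nextState t σ o) π =
      Real.exp (I.eta σ * (σ.2.1 π + I.estimate σ o π)) := by
    intro π
    unfold weight eta
    rw [hp, nextState_alive ht hσ]
  simp only [hw]
  rw [nextState_alive ht hσ]
  simp only [I.scaledCon_time, add_zero, hclock, mul_add, Finset.sum_add_distrib]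
  simp only [mul_add] at h3 h4
  have hB := I.minBudget_pos.ne'
  have hT := (I.T_pos).ne'
  have hlag : I.lagrangian σ o.2.2 =
    unitClip o.2.2.1 - I.price σ * ∑ i, I.scarcity σ i * I.scaledCon i o.2.2 := rfl
  have htime : 1 / I.mass σ * (I.minBudget / I.T) *
      ((V - I.price σ * I.minBudget - 2 * I.rate * (1 + I.price σ) * I.T) / I.minBudget) =
      1 / I.mass σ * ((V - I.price σ * I.minBudget) / I.T - 2 * I.rate * (1 + I.price σ)) := by
    field_simp
  simp only [mul_add] at htime
  nlinarith [h3, h4, htime, hlag]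

/-- Averaged over the action of a round, the importance-weighted estimates become the Lagrangian
payoffs of the policies. -/
theorem Regime.sum_actionProb_mul_estimate (h : I.Regime) {t : ℕ} (ht : ¬ t < I.warmup)
    (σ : I.State) (o : Outcome X I.K I.d) (π : I.policies) :
    ∑ a, I.actionProb t σ o.1 a * I.estimate σ (o.1, a, o.2 a) π =
      1 / I.mass σ * I.lagrangian σ (o.2 (π.1 o.1)) := by
  rw [Finset.sum_eq_single (π.1 o.1)]
  · unfold actionProb estimate
    rw [if_neg ht, if_pos rfl]
    have := (h.actionMass_pos σ o.1 (π.1 o.1)).ne'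
    have := (h.mass_pos σ).ne'
    field_simp
  · intro a _ ha
    unfold estimate
    rw [if_neg ha.symm, mul_zero]
  · simp

theorem Regime.le_sum_surplus (h : I.Regime) (V : ℝ) (P : I.policies → ℝ) {t : ℕ}
    (ht : ¬ t < I.warmup) {σ : I.State} (hσ : I.Alive σ) (o : Outcome X I.K I.d) :
    1 / I.mass σ * (∑ π, P π * I.lagrangian σ (o.2 (π.1 o.1)) -
        I.price σ * I.scarcity σ I.time * I.minBudget / I.T -
        (V - I.price σ * I.minBudget) / I.T) ≤
      ∑ a, I.actionProb t σ o.1 a * I.surplus V P t σ (o.1, a, o.2 a) := by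
  refine le_trans (le_of_eq ?_) (Finset.sum_le_sum fun a _ => mul_le_mul_of_nonneg_left
    (h.le_surplus V P ht hσ (o.1, a, o.2 a)) (h.actionProb_nonneg t σ o.1 a))
  have h0 : ∀ (p e f : Fin I.K → ℝ) (b c : ℝ), ∑ a, p a = 1 →
      ∑ a, p a * (e a - f a - b - c) = ∑ a, p a * e a - ∑ a, p a * f a - b - c := by
    intro p e f b c hp
    have : ∀ a, p a * (e a - f a - b - c) = p a * e a - p a * f a - p a * (b + c) :=
      fun a => by ring
    simp only [this, Finset.sum_sub_distrib, ← Finset.sum_mul, hp]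
    ring
  rw [h0 _ _ _ _ _ (h.sum_actionProb t σ o.1)]
  have h1 : ∑ a, I.actionProb t σ o.1 a * ∑ π, P π * I.estimate σ (o.1, a, o.2 a) π =
      1 / I.mass σ * ∑ π, P π * I.lagrangian σ (o.2 (π.1 o.1)) := by
    simp only [Finset.mul_sum]
    rw [Finset.sum_comm]
    refine Finset.sum_congr rfl fun π _ => ?_
    rw [mul_left_comm, ← h.sum_actionProb_mul_estimate ht σ o π, Finset.mul_sum]
    exact Finset.sum_congr rfl fun a _ => by ring
  have h2 : ∑ a, I.actionProb t σ o.1 a *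
      (2 * I.rate * (1 + I.price σ) / I.K / I.actionMass σ o.1 a) =
      1 / I.mass σ * (2 * I.rate * (1 + I.price σ)) := by
    have : ∀ a, I.actionProb t σ o.1 a *
        (2 * I.rate * (1 + I.price σ) / I.K / I.actionMass σ o.1 a) =
        1 / I.mass σ * (2 * I.rate * (1 + I.price σ)) / I.K := by
      intro a
      unfold actionProb
      rw [if_neg ht]
      have := (h.actionMass_pos σ o.1 a).ne'
      have := (h.mass_pos σ).ne'
      have := h.K_pos.ne'
      field_simp
    simp only [this, Finset.sum_const, Finset.card_univ, Fintype.card_fin, nsmul_eq_mul]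
    exact mul_div_cancel₀ _ h.K_pos.ne'
  rw [h1, h2]
  ring

theorem bddMeas_policy_lagrangian (σ : I.State) (π : I.policies) :
    BddMeas fun o : Outcome X I.K I.d => I.lagrangian σ (o.2 (π.1 o.1)) :=
  .of_mem_Icc (I.measurable_lagrangian.comp
    (measurable_const.prodMk (I.measurable_policy_payoff π))) fun _ => lagrangian_mem σ _

theorem meanCon_time (D : Measure (Outcome X I.K I.d)) (π : I.policies) :
    I.meanCon D π I.time = 0 := by
  unfold meanCon
  simp [I.scaledCon_time]

variable {D : Measure (Outcome X I.K I.d)} [IsProbabilityMeasure D]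

theorem integral_lagrangian (σ : I.State) (π : I.policies) :
    ∫ o, I.lagrangian σ (o.2 (π.1 o.1)) ∂D =
      I.meanReward D π - I.price σ * ∑ i, I.scarcity σ i * I.meanCon D π i := by
  unfold lagrangian meanReward meanCon
  have h1 : ∀ i, Integrable (fun o : Outcome X I.K I.d =>
      I.scarcity σ i * I.scaledCon i (o.2 (π.1 o.1))) D := fun i =>
    ((I.bddMeas_policy_con π i).integrable D).const_mul _
  rw [integral_sub ((I.bddMeas_policy_reward π).integrable D)
    ((integrable_finsetSum _ fun i _ => h1 i).const_mul _), integral_const_mul,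
    integral_finsetSum _ fun i _ => h1 i]
  simp only [integral_const_mul]

variable (I) in
/-- The quantities that the algorithm keeps after the warm-up are bounded by `C`. -/
def BoundedState (C : ℝ) (σ : I.State) : Prop := (∀ π, |σ.2.1 π| ≤ C) ∧ ∀ i, |σ.2.2 i| ≤ C

theorem measurable_eta : Measurable I.eta := by
  have := I.measurable_price
  unfold eta
  fun_prop

theorem measurable_potential (V : ℝ) (P : I.policies → ℝ) : Measurable (I.potential V P) := by
  have h1 := I.measurable_price
  have h2 := I.measurable_weight
  unfold potential
  fun_prop

theorem Regime.exists_abs_potential_le (h : I.Regime) (V : ℝ) (P : I.policies → ℝ) (C : ℝ) :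
    ∃ C', ∀ σ, I.BoundedState C σ → |I.potential V P σ| ≤ C' := by
  have hv : Measurable fun σ : {σ // I.BoundedState C σ} => σ.1 := measurable_subtype_coe
  have hp : BddMeas fun σ : {σ // I.BoundedState C σ} => I.price σ.1 :=
    .of_mem_Icc (I.measurable_price.comp hv) fun σ => ⟨price_nonneg σ.1, price_le σ.1⟩
  have hl : ∀ π, BddMeas fun σ : {σ // I.BoundedState C σ} => σ.1.2.1 π := fun π =>
    ⟨by fun_prop, C, fun σ => σ.2.1 π⟩
  have hM : ∀ i, BddMeas fun σ : {σ // I.BoundedState C σ} => σ.1.2.2 i := fun i =>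
    ⟨by fun_prop, C, fun σ => σ.2.2 i⟩
  have he : BddMeas fun σ : {σ // I.BoundedState C σ} => I.eta σ.1 := by
    refine .of_mem_Icc (measurable_eta.comp hv) (a := 0) (b := I.rate / I.K) fun σ =>
      ⟨(h.eta_pos σ.1).le, ?_⟩
    rw [← h.eta_mul σ.1]
    exact le_mul_of_one_le_right (h.eta_pos σ.1).le (by linarith [price_nonneg σ.1])
  have hw : BddMeas fun σ : {σ // I.BoundedState C σ} =>
      Real.log (1 + ∑ π, I.weight σ.1 π) := by
    refine .log_of_one_le ((BddMeas.const 1).add (.sum fun π _ => ?_)) fun σ => ?_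
    · unfold weight; exact (he.mul (hl π)).exp
    · exact le_add_of_nonneg_right (Finset.sum_nonneg fun π _ => (weight_pos σ.1 π).le)
  have hs : BddMeas fun σ : {σ // I.BoundedState C σ} =>
      Real.log (∑ i, Real.exp (I.rate * σ.1.2.2 i)) :=
    .log_sum_exp fun i => (BddMeas.const _).mul (hM i)
  have hpot : BddMeas fun σ : {σ // I.BoundedState C σ} => I.potential V P σ.1 := by
    unfold potential
    simp only [div_eq_mul_inv]
    refine .add (.add (.sub (.mul ?_ hw) (.sum fun π _ => (BddMeas.const _).mul (hl π)))
      (.mul (.mul hp (.const _)) hs)) (.mul (hM _) (.mul ?_ (.const _)))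
    · exact .mul (.mul (.const _) ((BddMeas.const 1).add hp)) (.const _)
    · exact .sub (.sub (.const _) (.mul hp (.const _)))
        (.mul (.mul (.const _) ((BddMeas.const 1).add hp)) (.const _))
  obtain ⟨C', hC'⟩ := hpot.2
  exact ⟨C', fun σ hσ => hC' ⟨σ, hσ⟩⟩

variable (I) in
/-- A bound for the change of the memory in one round. -/
def stepBound : ℝ :=
  (1 + I.priceBound) / (I.rate / I.K) + 1 / I.rate * (I.minBudget / I.T) + 1

theorem Regime.boundedState_nextState (h : I.Regime) {C : ℝ} {σ : I.State}
    (hσ : I.BoundedState C σ) (t : ℕ) (o : Observation X I.K I.d) :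
    I.BoundedState (C + I.stepBound) (I.nextState t σ o) := by
  have h1 : 0 ≤ 1 / I.rate * (I.minBudget / I.T) := mul_nonneg (one_div_pos.2 h.rate_pos).le
    (div_nonneg I.minBudget_pos.le I.T_pos.le)
  have h2 : 0 ≤ (1 + I.priceBound) / (I.rate / I.K) :=
    (abs_nonneg _).trans (h.abs_estimate_le σ o (Classical.arbitrary _))
  have h3 : 0 ≤ I.stepBound := by unfold stepBound; linarith
  have hmono : I.BoundedState (C + I.stepBound) σ :=
    ⟨fun π => (hσ.1 π).trans (by linarith), fun i => (hσ.2 i).trans (by linarith)⟩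
  by_cases ht : t < I.warmup
  · unfold nextState
    rw [if_pos ht]
    exact hmono
  by_cases ha : I.Alive σ
  · rw [nextState_alive ht ha]
    refine ⟨fun π => (abs_add_le _ _).trans (add_le_add (hσ.1 π) ?_),
      fun i => ?_⟩
    · refine (h.abs_estimate_le σ o π).trans ?_
      unfold stepBound; linarith
    · have hc := I.scaledCon_mem i o.2.2
      have hm : 1 / I.mass σ * (I.minBudget / I.T) ≤ 1 / I.rate * (I.minBudget / I.T) :=
        mul_le_mul_of_nonneg_right (one_div_le_one_div_of_le h.rate_pos (rate_le_mass σ))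
          (div_nonneg I.minBudget_pos.le I.T_pos.le)
      have hm0 : 0 ≤ 1 / I.mass σ * (I.minBudget / I.T) :=
        mul_nonneg (one_div_pos.2 (h.mass_pos σ)).le (div_nonneg I.minBudget_pos.le I.T_pos.le)
      unfold clocked
      dsimp only
      rw [add_assoc]
      refine (abs_add_le _ _).trans (add_le_add (hσ.2 i) ?_)
      unfold stepBound
      rw [abs_of_nonneg]
      · split_ifs <;> linarith [hc.2]
      · split_ifs <;> linarith [hc.1]
  · rw [nextState_dead ht ha]
    exact hmono

theorem Regime.boundedState_stateAt (h : I.Regime) (t : ℕ) (p : I.strategy.Path) :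
    I.BoundedState (t * I.stepBound) (I.strategy.stateAt t p) := by
  induction t with
  | zero =>
    rw [Strategy.stateAt_zero]
    constructor <;> intro _ <;> simp
  | succ t ih =>
    rw [Strategy.stateAt_succ]
    have := h.boundedState_nextState ih t (I.strategy.obsAt t p)
    have he : ((t + 1 : ℕ) : ℝ) * I.stepBound = t * I.stepBound + I.stepBound := by
      push_cast; ring
    rw [he]
    exact this

theorem measurable_surplus (V : ℝ) (P : I.policies → ℝ) (t : ℕ) :
    Measurable fun q : I.State × Observation X I.K I.d => I.surplus V P t q.1 q.2 := by
  classical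
  unfold surplus
  refine ((Measurable.ite (measurable_fst I.measurableSet_alive)
    (measurable_unitClip.comp measurable_snd.snd.snd.fst) measurable_const).sub
    (((measurable_potential V P).comp (I.measurable_nextState t)).sub
      ((measurable_potential V P).comp measurable_fst))).add ?_
  exact (I.measurable_price.comp measurable_fst).mul measurable_const

theorem Regime.exists_abs_surplus_le (h : I.Regime) (V : ℝ) (P : I.policies → ℝ) (t : ℕ) (C : ℝ) :
    ∃ C', ∀ σ, I.BoundedState C σ → ∀ o, |I.surplus V P t σ o| ≤ C' := by
  classical
  obtain ⟨C1, h1⟩ := h.exists_abs_potential_le V P C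
  obtain ⟨C2, h2⟩ := h.exists_abs_potential_le V P (C + I.stepBound)
  refine ⟨1 + (C2 + C1) + I.priceBound * I.rate, fun σ hσ o => ?_⟩
  unfold surplus
  refine (abs_add_le _ _).trans (add_le_add ((abs_sub _ _).trans (add_le_add ?_
    ((abs_sub _ _).trans (add_le_add (h2 _ (h.boundedState_nextState hσ t o)) (h1 σ hσ))))) ?_)
  · split_ifs
    · rw [abs_of_nonneg (unitClip_mem _).1]; exact (unitClip_mem _).2
    · simp
  · rw [abs_of_nonneg (mul_nonneg (price_nonneg σ) h.rate_pos.le)]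
    exact mul_le_mul_of_nonneg_right (price_le σ) h.rate_pos.le

/-- In every round after the warm-up, the expected reward pays for the expected growth of the
potential, up to a second-order loss. -/
theorem Regime.stepMean_surplus_nonneg (h : I.Regime) {P : I.policies → ℝ}
    (hP : LPFeasible I.T I.minBudget (I.meanCon D) P) {t : ℕ} (ht : ¬ t < I.warmup) (σ : I.State) :
    0 ≤ I.strategy.stepMean D t σ
      (I.surplus (I.T * ∑ π, P π * I.meanReward D π) P t σ) := by
  classical
  set V := (I.T : ℝ) * ∑ π, P π * I.meanReward D π with hV
  change 0 ≤ ∫ o, ∑ a, I.actionProb t σ o.1 a * I.surplus V P t σ (o.1, a, o.2 a) ∂D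
  by_cases hσ : I.Alive σ
  · obtain ⟨C, hC⟩ : ∃ C, I.BoundedState C σ := by
      refine ⟨∑ π, |σ.2.1 π| + ∑ i, |σ.2.2 i|, fun π => ?_, fun i => ?_⟩
      · have h1 := Finset.single_le_sum (f := fun π => |σ.2.1 π|) (fun _ _ => abs_nonneg _)
          (Finset.mem_univ π)
        have h2 : 0 ≤ ∑ i, |σ.2.2 i| := Finset.sum_nonneg fun _ _ => abs_nonneg _
        linarith
      · have h1 := Finset.single_le_sum (f := fun i => |σ.2.2 i|) (fun _ _ => abs_nonneg _)
          (Finset.mem_univ i)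
        have h2 : 0 ≤ ∑ π, |σ.2.1 π| := Finset.sum_nonneg fun _ _ => abs_nonneg _
        linarith
    obtain ⟨C', hC'⟩ := h.exists_abs_surplus_le V P t C
    have hint : BddMeas fun o : Outcome X I.K I.d =>
        ∑ a, I.actionProb t σ o.1 a * I.surplus V P t σ (o.1, a, o.2 a) := by
      refine .sum fun a _ => .mul (.of_mem_Icc (a := 0) (b := 1) ?_ fun o => ?_) ⟨?_, C', fun o =>
        hC' σ hC _⟩
      · exact (measurable_pi_apply a).comp ((I.measurable_actionProb t).comp
          (measurable_const.prodMk measurable_fst))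
      · refine ⟨h.actionProb_nonneg t σ o.1 a, ?_⟩
        rw [← h.sum_actionProb t σ o.1]
        exact Finset.single_le_sum (fun b _ => h.actionProb_nonneg t σ o.1 b) (Finset.mem_univ a)
      · have : Measurable fun o : Outcome X I.K I.d => o.2 a := by fun_prop
        exact (measurable_surplus V P t).comp
          (measurable_const.prodMk (measurable_fst.prodMk (measurable_const.prodMk this)))
    have hlag : ∀ π, Integrable (fun o : Outcome X I.K I.d =>
        P π * I.lagrangian σ (o.2 (π.1 o.1))) D := fun π =>
      ((bddMeas_policy_lagrangian σ π).integrable D).const_mul _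
    have hsum := integrable_finsetSum Finset.univ fun π (_ : π ∈ Finset.univ) => hlag π
    refine le_trans ?_ (integral_mono ?_ (hint.integrable D) fun o => h.le_sum_surplus V P ht hσ o)
    · simp only [sub_sub]
      rw [integral_const_mul, integral_sub hsum (integrable_const _),
        integral_finsetSum _ fun π _ => hlag π]
      simp only [integral_const_mul, integral_lagrangian, integral_const, probReal_univ, one_smul]
      refine mul_nonneg (one_div_pos.2 (h.mass_pos σ)).le ?_
      have hZ := price_nonneg σ
      have hT := I.T_pos
      -- The consumption of `P`, averaged over the resources other than time.
      have hcon : ∑ i, I.scarcity σ i * (I.T * ∑ π, P π * I.meanCon D π i) ≤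
          (1 - I.scarcity σ I.time) * I.minBudget := by
        have h1 : ∀ i, I.scarcity σ i * (I.T * ∑ π, P π * I.meanCon D π i) ≤
            I.scarcity σ i * I.minBudget - if i = I.time then
              I.scarcity σ I.time * I.minBudget else 0 := by
          intro i
          split_ifs with hi
          · subst hi
            simp [meanCon_time]
          · rw [sub_zero]
            exact mul_le_mul_of_nonneg_left (hP.2.2 i) (scarcity_nonneg σ i)
        refine (Finset.sum_le_sum fun i _ => h1 i).trans (le_of_eq ?_)
        rw [Finset.sum_sub_distrib, ← Finset.sum_mul, sum_scarcity]
        simp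
        ring
      have hexp : ∑ π, P π * (I.meanReward D π - I.price σ *
          ∑ i, I.scarcity σ i * I.meanCon D π i) =
          (V - I.price σ * ∑ i, I.scarcity σ i * (I.T * ∑ π, P π * I.meanCon D π i)) / I.T := by
        have h2 : ∑ i, I.scarcity σ i * (I.T * ∑ π, P π * I.meanCon D π i) =
            I.T * ∑ π, P π * ∑ i, I.scarcity σ i * I.meanCon D π i := by
          simp only [Finset.mul_sum]
          rw [Finset.sum_comm]
          exact Finset.sum_congr rfl fun π _ => Finset.sum_congr rfl fun i _ => by ring
        rw [h2, hV, eq_div_iff hT.ne']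
        simp only [mul_sub, Finset.sum_sub_distrib]
        have h3 : ∑ π, P π * (I.price σ * ∑ i, I.scarcity σ i * I.meanCon D π i) =
            I.price σ * ∑ π, P π * ∑ i, I.scarcity σ i * I.meanCon D π i := by
          rw [Finset.mul_sum]
          exact Finset.sum_congr rfl fun π _ => by ring
        rw [h3]
        ring
      rw [hexp, ← sub_sub, ← sub_div, ← sub_div]
      refine div_nonneg ?_ hT.le
      nlinarith [mul_le_mul_of_nonneg_left hcon hZ]
    · exact ((hsum.sub (integrable_const _)).sub (integrable_const _)).const_mul _
  · refine integral_nonneg fun o => Finset.sum_nonneg fun a _ =>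
      mul_nonneg (h.actionProb_nonneg t σ o.1 a) ?_
    unfold surplus
    rw [if_neg hσ, nextState_dead ht hσ, sub_self, sub_zero, zero_add]
    exact mul_nonneg (price_nonneg σ) h.rate_pos.le

end ResourcefulBandits.KnownData

end

noncomputable section

open MeasureTheory ResourcefulBandits

namespace ResourcefulBandits.KnownData

variable {X : Type u} [MeasurableSpace X] {I : KnownData X}

/-! ### The warm-up -/

variable (I) in
/-- The mean of the reward (`none`) or of a consumption under a policy. -/
def meanValue (D : Measure (Outcome X I.K I.d)) (π : I.policies) (j : Option (Fin I.d)) : ℝ :=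
  ∫ o, I.payoffValue j (o.2 (π.1 o.1)) ∂D

variable (I) in
/-- What a round of the warm-up contributes to a total. -/
def contribution (π : I.policies) (j : Option (Fin I.d)) (o : Observation X I.K I.d) : ℝ :=
  if π.1 o.1 = o.2.1 then I.payoffValue j o.2.2 else 0

theorem contribution_mem (π : I.policies) (j : Option (Fin I.d)) (o : Observation X I.K I.d) :
    I.contribution π j o ∈ Set.Icc (0 : ℝ) 1 := by
  unfold contribution
  split_ifs
  · exact I.payoffValue_mem j _
  · simp

theorem measurable_contribution (π : I.policies) (j : Option (Fin I.d)) :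
    Measurable (I.contribution π j) :=
  Measurable.ite (I.measurableSet_policy_eq π measurable_fst measurable_snd.fst)
    ((I.measurable_payoffValue j).comp measurable_snd.snd) measurable_const

theorem nextState_warmup {t : ℕ} (ht : t < I.warmup) (σ : I.State) (o : Observation X I.K I.d) :
    I.nextState t σ o = (fun π j => σ.1 π j + I.contribution π j o, σ.2) := by
  unfold nextState
  rw [if_pos ht]
  rfl

theorem total_mem {t : ℕ} (ht : t ≤ I.warmup) (p : I.strategy.Path) (π : I.policies)
    (j : Option (Fin I.d)) :
    (I.strategy.stateAt t p : I.State).1 π j ∈ Set.Icc (0 : ℝ) t := by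
  induction t with
  | zero => rw [Strategy.stateAt_zero]; simp
  | succ t ih =>
    rw [Strategy.stateAt_succ]
    change (I.nextState t _ _).1 π j ∈ _
    rw [nextState_warmup (by omega)]
    have h1 := ih (by omega)
    have h2 := contribution_mem π j (I.strategy.obsAt t p)
    push_cast
    exact ⟨add_nonneg h1.1 h2.1, add_le_add h1.2 h2.2⟩

variable (I) in
/-- The price is at least the optimal reward per unit of budget, and not much larger. -/
def GoodPrice (D : Measure (Outcome X I.K I.d)) (σ : I.State) : Prop :=
  lpValue I.T I.minBudget (I.meanReward D) (I.meanCon D) ≤ I.price σ * I.minBudget ∧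
    I.price σ * I.minBudget ≤
      36 * lpValue I.T I.minBudget (I.meanReward D) (I.meanCon D) + 56 * I.regretScale

theorem measurableSet_goodPrice (D : Measure (Outcome X I.K I.d)) :
    MeasurableSet {σ | I.GoodPrice D σ} := by
  have h := I.measurable_price.mul_const I.minBudget
  exact (measurableSet_le measurable_const h).inter (measurableSet_le h measurable_const)

variable {D : Measure (Outcome X I.K I.d)} [IsProbabilityMeasure D]

/-- Exponential moments of the totals of the warm-up. -/
theorem Regime.integral_exp_total_le (h : I.Regime) {s κ : ℝ}
    (hsκ : ∀ x : ℝ, 0 ≤ x → x ≤ 1 → Real.exp (s * x) ≤ 1 + κ * x) {t : ℕ} (ht : t ≤ I.warmup)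
    (π : I.policies) (j : Option (Fin I.d)) :
    ∫ p, Real.exp (s * (I.strategy.stateAt t p : I.State).1 π j)
        ∂I.strategy.toAlgorithm.pathLaw D ≤
      Real.exp (t * (κ * (I.meanValue D π j / I.K))) := by
  induction t with
  | zero =>
    simp only [Strategy.stateAt_zero]
    simp [strategy]
  | succ t ih =>
    have ht' : t < I.warmup := by omega
    have hb : BddMeas fun p : I.strategy.Path =>
        Real.exp (s * (I.strategy.stateAt t p : I.State).1 π j) := by
      refine BddMeas.exp (.mul (.const _) (.of_mem_Icc ?_ fun p => total_mem ht'.le p π j))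
      have : Measurable fun σ : I.State => σ.1 π j := by fun_prop
      exact this.comp (I.strategy.measurable_stateAt t)
    have h1 : ∀ p : I.strategy.Path, Real.exp (s * (I.strategy.stateAt (t + 1) p : I.State).1 π j) =
        (fun q : I.State × Observation X I.K I.d => Real.exp (s * q.1.1 π j) *
          Real.exp (s * I.contribution π j q.2))
          (I.strategy.stateAt t p, I.strategy.obsAt t p) := by
      intro p
      rw [Strategy.stateAt_succ]
      change Real.exp (s * (I.nextState t _ _).1 π j) = _
      rw [nextState_warmup ht']
      simp only [mul_add, Real.exp_add]
    have hc : BddMeas fun o => Real.exp (s * I.contribution π j o) :=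
      BddMeas.exp (.mul (.const _) (.of_mem_Icc (measurable_contribution π j) fun o =>
        contribution_mem π j o))
    simp only [h1]
    rw [Strategy.integral_step (g := fun q : I.State × Observation X I.K I.d =>
      Real.exp (s * q.1.1 π j) * Real.exp (s * I.contribution π j q.2)) I.strategy D t
      (fun p x a => h.actionProb_nonneg t _ x a) (fun p x => h.sum_actionProb t _ x)
      (Measurable.mul (by fun_prop) (hc.1.comp measurable_snd)) ?_]
    · have hstep : ∀ σ : I.State, I.strategy.stepMean D t σ (fun o => Real.exp (s * σ.1 π j) *
          Real.exp (s * I.contribution π j o)) ≤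
          Real.exp (s * σ.1 π j) * Real.exp (κ * (I.meanValue D π j / I.K)) := by
        intro σ
        change ∫ o, ∑ a, I.actionProb t σ o.1 a * _ ∂D ≤ _
        have hp : ∀ x a, I.actionProb t σ x a = 1 / I.K := fun x a => by
          unfold actionProb; rw [if_pos ht']
        have hpv : BddMeas fun o : Outcome X I.K I.d => I.payoffValue j (o.2 (π.1 o.1)) :=
          .of_mem_Icc ((I.measurable_payoffValue j).comp (I.measurable_policy_payoff π))
            fun _ => I.payoffValue_mem j _
        have hle : ∀ o : Outcome X I.K I.d, ∑ a, I.actionProb t σ o.1 a *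
            (Real.exp (s * σ.1 π j) * Real.exp (s * I.contribution π j (o.1, a, o.2 a))) ≤
            Real.exp (s * σ.1 π j) * (1 + κ / I.K * I.payoffValue j (o.2 (π.1 o.1))) := by
          intro o
          have hsum : ∑ a, I.contribution π j (o.1, a, o.2 a) =
              I.payoffValue j (o.2 (π.1 o.1)) := by
            unfold contribution
            simp
          have hK := h.K_pos.ne'
          calc _ ≤ ∑ a : Fin I.K, 1 / I.K * (Real.exp (s * σ.1 π j) *
                (1 + κ * I.contribution π j (o.1, a, o.2 a))) := by
                refine Finset.sum_le_sum fun a _ => ?_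
                rw [hp]
                have hm := contribution_mem π j ((o.1, a, o.2 a) : Observation X I.K I.d)
                exact mul_le_mul_of_nonneg_left (mul_le_mul_of_nonneg_left (hsκ _ hm.1 hm.2)
                  (Real.exp_pos _).le) (by positivity)
            _ = _ := by
                rw [← Finset.mul_sum, ← Finset.mul_sum, Finset.sum_add_distrib, ← Finset.mul_sum,
                  hsum]
                simp only [Finset.sum_const, Finset.card_univ, Fintype.card_fin, nsmul_eq_mul]
                field_simp
        have hint : Integrable (fun o : Outcome X I.K I.d => ∑ a, I.actionProb t σ o.1 a *
            (Real.exp (s * σ.1 π j) * Real.exp (s * I.contribution π j (o.1, a, o.2 a)))) D := by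
          refine integrable_finsetSum _ fun a _ => ?_
          simp only [hp]
          refine (BddMeas.mul (.const _) (.mul (.const _) (hc.comp ?_))).integrable D
          have : Measurable fun o : Outcome X I.K I.d => o.2 a := by fun_prop
          exact measurable_fst.prodMk (measurable_const.prodMk this)
        have hint' : Integrable (fun o : Outcome X I.K I.d =>
            1 + κ / I.K * I.payoffValue j (o.2 (π.1 o.1))) D :=
          (integrable_const _).add ((hpv.integrable D).const_mul _)
        refine (integral_mono hint (hint'.const_mul _) hle).trans ?_
        rw [integral_const_mul]
        refine mul_le_mul_of_nonneg_left ?_ (Real.exp_pos _).le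
        rw [integral_add (integrable_const _) ((hpv.integrable D).const_mul _), integral_const_mul]
        simp only [integral_const, probReal_univ, one_smul]
        have := Real.add_one_le_exp (κ * (I.meanValue D π j / I.K))
        refine le_trans (le_of_eq ?_) this
        unfold meanValue
        ring
      have hmeas : Measurable fun p : I.strategy.Path => I.strategy.stepMean D t
          (I.strategy.stateAt t p) (fun o =>
            Real.exp (s * (I.strategy.stateAt t p : I.State).1 π j) *
          Real.exp (s * I.contribution π j o)) := by
        have h2 : ∀ p : I.strategy.Path, I.strategy.stepMean D t
          (I.strategy.stateAt t p) (fun o =>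
            Real.exp (s * (I.strategy.stateAt t p : I.State).1 π j) *
          Real.exp (s * I.contribution π j o)) =
          Real.exp (s * (I.strategy.stateAt t p : I.State).1 π j) *
            ∫ o : Outcome X I.K I.d,
              ∑ a, 1 / I.K * Real.exp (s * I.contribution π j (o.1, a, o.2 a)) ∂D := by
          intro p
          rw [← integral_const_mul]
          change ∫ o, ∑ a, I.actionProb t (I.strategy.stateAt t p) o.1 a * _ ∂D = _
          refine integral_congr_ae (Filter.Eventually.of_forall fun o => ?_)
          simp only [Finset.mul_sum]
          refine Finset.sum_congr rfl fun a _ => ?_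
          unfold actionProb
          rw [if_pos ht']
          ring
        simp only [h2]
        exact hb.1.mul measurable_const
      have hnn : ∀ σ : I.State, 0 ≤ I.strategy.stepMean D t σ (fun o => Real.exp (s * σ.1 π j) *
          Real.exp (s * I.contribution π j o)) := fun σ => integral_nonneg fun o =>
        Finset.sum_nonneg fun a _ => mul_nonneg (h.actionProb_nonneg t σ o.1 a) (by positivity)
      calc _ ≤ ∫ p, Real.exp (s * (I.strategy.stateAt t p : I.State).1 π j) *
            Real.exp (κ * (I.meanValue D π j / I.K)) ∂I.strategy.toAlgorithm.pathLaw D := by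
            refine integral_mono_of_nonneg (Filter.Eventually.of_forall fun p => hnn _)
              ((hb.integrable _).mul_const _) (Filter.Eventually.of_forall fun p => hstep _)
        _ ≤ _ := by
            rw [integral_mul_const]
            refine (mul_le_mul_of_nonneg_right (ih ht'.le) (Real.exp_pos _).le).trans ?_
            rw [← Real.exp_add]
            refine le_of_eq (congrArg _ ?_)
            push_cast; ring
    · obtain ⟨C, hC⟩ := hb.2
      obtain ⟨C', hC'⟩ := hc.2
      refine ⟨C * C', fun p o => ?_⟩
      rw [abs_mul]
      exact mul_le_mul (hC p) (hC' o) (abs_nonneg _) ((abs_nonneg _).trans (hC p))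

variable (I) in
/-- The logarithm of the number of deviation events, divided by the admitted probability `1 / T`. -/
def deviation : ℝ := Real.log (2 * I.policies.card * (I.d + 1) * I.T)

/-- If no total of the warm-up deviates much from its mean, the price is good. -/
theorem Regime.goodPrice_of_close (h : I.Regime) {σ : I.State} (h0 : ∀ π j, 0 ≤ σ.1 π j)
    (hu : ∀ π j, σ.1 π j ≤ I.warmup * (2 * (I.meanValue D π j / I.K)) + I.deviation)
    (hl : ∀ π j, I.warmup * (1 / 2 * (I.meanValue D π j / I.K)) ≤ σ.1 π j + I.deviation) :
    I.GoodPrice D σ := by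
  set S := I.regretScale with hS
  have hSpos : 0 < S := h.scale_pos
  have hT := I.T_pos
  have hK := h.K_pos
  have hW : S ≤ I.warmup := scale_le_warmup
  have hWpos : (0 : ℝ) < I.warmup := hSpos.trans_le hW
  have hdev : I.K * I.deviation / I.warmup ≤ 2 * S / I.T := by
    have hd : 0 ≤ I.deviation := by
      refine Real.log_nonneg ?_
      have h1 := I.one_le_card
      have h2 := I.one_le_d
      have h3 := I.one_le_T'
      have h4 : (1 : ℝ) ≤ 2 * I.policies.card := by linarith
      exact one_le_mul_of_one_le_of_one_le (one_le_mul_of_one_le_of_one_le h4 (by linarith)) h3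
    calc _ ≤ I.K * I.deviation / S := div_le_div_of_nonneg_left (mul_nonneg hK.le hd) hSpos hW
      _ ≤ _ := by
        rw [div_le_div_iff₀ hSpos hT]
        have := h.log_union_le
        unfold deviation
        nlinarith
  have hone : I.K / I.warmup ≤ 2 * S / I.T := by
    calc (I.K : ℝ) / I.warmup ≤ I.K / S := div_le_div_of_nonneg_left hK.le hSpos hW
      _ ≤ _ := by
        rw [div_le_div_iff₀ hSpos hT]
        have := h.TK_le_sq
        nlinarith
  set x : I.policies → Option (Fin I.d) → ℝ := fun π j => I.K * (⌊σ.1 π j⌋₊ : ℝ) / I.warmup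
  set s := 8 * S / I.T with hs
  have hspos : 0 < s := by positivity
  have hsS : (2 * S / I.T) = s / 4 := by rw [hs]; ring
  rw [hsS] at hdev hone
  have hx1 : ∀ π j, x π j ≤ 2 * I.meanValue D π j + s := by
    intro π j
    have h1 : (⌊σ.1 π j⌋₊ : ℝ) ≤ I.warmup * (2 * (I.meanValue D π j / I.K)) + I.deviation :=
      (Nat.floor_le (h0 π j)).trans (hu π j)
    have h2 := div_le_div_of_nonneg_right (mul_le_mul_of_nonneg_left h1 hK.le) hWpos.le
    have h3 : I.K * (I.warmup * (2 * (I.meanValue D π j / I.K)) + I.deviation) / I.warmup =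
        2 * I.meanValue D π j + I.K * I.deviation / I.warmup := by field_simp
    rw [h3] at h2
    exact h2.trans (by linarith)
  have hx2 : ∀ π j, I.meanValue D π j ≤ 2 * x π j + s := by
    intro π j
    have h1 : I.warmup * (1 / 2 * (I.meanValue D π j / I.K)) ≤ ⌊σ.1 π j⌋₊ + 1 + I.deviation :=
      (hl π j).trans (by linarith [(Nat.lt_floor_add_one (σ.1 π j)).le])
    have h2 := mul_le_mul_of_nonneg_left h1 (div_nonneg hK.le hWpos.le)
    have h3 : I.K / I.warmup * (I.warmup * (1 / 2 * (I.meanValue D π j / I.K))) =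
        I.meanValue D π j / 2 := by field_simp
    have h4 : I.K / I.warmup * ((⌊σ.1 π j⌋₊ : ℝ) + 1 + I.deviation) =
        x π j + I.K / I.warmup + I.K * I.deviation / I.warmup := by
      simp only [x]; ring
    rw [h3, h4] at h2
    linarith
  have hTs : I.T * s = 8 * S := by rw [hs]; field_simp
  have hsB : I.T * s ≤ I.minBudget := by rw [hTs]; linarith [h.large]
  set n : I.policies → Option (Fin I.d) → ℕ := fun π j => ⌊σ.1 π j⌋₊
  have hr0 : ∀ π, 0 ≤ I.meanReward D π := fun π => (meanReward_mem π).1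
  have hr1 : ∀ π, I.meanReward D π ≤ 1 := fun π => (meanReward_mem π).2
  have hA := lpValue_le_of_close (r := I.meanReward D) (c := I.meanCon D) (r' := I.estReward n)
    (c' := I.estCon n) hT.le hspos.le hsB (fun π => (estReward_mem n π).1)
    (fun π => (estReward_mem n π).2) (fun π => ?_) (fun π i => hx1 π (some i))
  · have hB := lpValue_le_of_close (r := I.estReward n) (c := I.estCon n) (r' := I.meanReward D)
      (c' := I.meanCon D) hT.le hspos.le hsB hr0 hr1
      (fun π => (min_le_right _ _).trans (hx1 π none)) (fun π i => hx2 π (some i))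
    have hp : I.price σ * I.minBudget =
        6 * lpValue I.T I.minBudget (I.estReward n) (I.estCon n) + 8 * S :=
      div_mul_cancel₀ _ I.minBudget_pos.ne'
    rw [hTs] at hA hB
    constructor
    · rw [hp]; exact hA
    · rw [hp]; linarith
  · have h1 : I.meanReward D π ≤ 2 * x π none + s := hx2 π none
    rcases min_cases (1 : ℝ) (I.K * (n π none : ℝ) / I.warmup) with ⟨he, _⟩ | ⟨he, _⟩
    · unfold estReward; rw [he]; linarith [hr1 π]
    · unfold estReward; rw [he]; exact h1

/-- The price is good with high probability. -/
theorem Regime.integral_goodPrice (h : I.Regime) :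
    1 - 1 / (I.T : ℝ) ≤ ∫ p, (open Classical in
      if I.GoodPrice D (I.strategy.stateAt I.warmup p) then (1 : ℝ) else 0)
        ∂I.strategy.toAlgorithm.pathLaw D := by
  classical
  set W := I.warmup
  set μ := I.strategy.toAlgorithm.pathLaw D
  set st : I.policies → Option (Fin I.d) → I.strategy.Path → ℝ := fun π j p =>
    (I.strategy.stateAt W p : I.State).1 π j
  set m : I.policies → Option (Fin I.d) → ℝ := fun π j => I.meanValue D π j / I.K
  have hst : ∀ π j, BddMeas (st π j) := by
    intro π j
    refine .of_mem_Icc ?_ fun p => total_mem le_rfl p π j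
    have : Measurable fun σ : I.State => σ.1 π j := by fun_prop
    exact this.comp (I.strategy.measurable_stateAt W)
  set Θ : I.strategy.Path → ℝ := fun p => ∑ π, ∑ j,
    (Real.exp (1 * st π j p) * Real.exp (-(W * (2 * m π j))) +
      Real.exp (-1 * st π j p) * Real.exp (W * (1 / 2 * m π j)))
  have hb1 : ∀ π j, BddMeas fun p => Real.exp (1 * st π j p) * Real.exp (-(W * (2 * m π j))) :=
    fun π j => .mul (BddMeas.exp (.mul (.const _) (hst π j))) (.const _)
  have hb2 : ∀ π j, BddMeas fun p => Real.exp (-1 * st π j p) * Real.exp (W * (1 / 2 * m π j)) :=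
    fun π j => .mul (BddMeas.exp (.mul (.const _) (hst π j))) (.const _)
  have hΘ : BddMeas Θ := .sum fun π _ => .sum fun j _ => (hb1 π j).add (hb2 π j)
  have hnum : (0 : ℝ) < 2 * I.policies.card * (I.d + 1) := by
    have := I.one_le_card
    positivity
  have hEΘ : ∫ p, Θ p ∂μ ≤ 2 * I.policies.card * (I.d + 1) := by
    have hone : ∀ π j, ∫ p, (Real.exp (1 * st π j p) * Real.exp (-(W * (2 * m π j))) +
        Real.exp (-1 * st π j p) * Real.exp (W * (1 / 2 * m π j))) ∂μ ≤ 2 := by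
      intro π j
      rw [integral_add ((hb1 π j).integrable _) ((hb2 π j).integrable _), integral_mul_const,
        integral_mul_const]
      have h1 := h.integral_exp_total_le (D := D) (s := 1) (κ := 2) (fun x hx0 hx1 => by
        rw [one_mul]; exact exp_le_one_add_two_mul hx0 hx1) le_rfl π j
      have h2 := h.integral_exp_total_le (D := D) (s := -1) (κ := -(1 / 2)) (fun x hx0 hx1 => by
        have := exp_neg_le_one_sub_half hx0 hx1
        rw [neg_one_mul]; linarith) le_rfl π j
      have h3 := mul_le_mul_of_nonneg_right h1 (Real.exp_pos (-(W * (2 * m π j)))).le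
      have h4 := mul_le_mul_of_nonneg_right h2 (Real.exp_pos (W * (1 / 2 * m π j))).le
      rw [← Real.exp_add] at h3 h4
      have e3 : (W : ℝ) * (2 * m π j) + -(W * (2 * m π j)) = 0 := by ring
      have e4 : (W : ℝ) * (-(1 / 2) * m π j) + W * (1 / 2 * m π j) = 0 := by ring
      rw [e3, Real.exp_zero] at h3
      rw [e4, Real.exp_zero] at h4
      change (∫ p, Real.exp (1 * st π j p) ∂μ) * _ ≤ 1 at h3
      change (∫ p, Real.exp (-1 * st π j p) ∂μ) * _ ≤ 1 at h4
      linarith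
    rw [integral_finsetSum _ fun π _ => integrable_finsetSum _ fun j _ =>
      ((hb1 π j).add (hb2 π j)).integrable _]
    calc _ ≤ ∑ _π : I.policies, ∑ _j : Option (Fin I.d), (2 : ℝ) := by
          refine Finset.sum_le_sum fun π _ => ?_
          rw [integral_finsetSum _ fun j _ => ((hb1 π j).add (hb2 π j)).integrable _]
          exact Finset.sum_le_sum fun j _ => hone π j
      _ = _ := by
          simp only [Finset.sum_const, Finset.card_univ, Fintype.card_option, Fintype.card_fin,
            Fintype.card_coe, nsmul_eq_mul]
          push_cast; ring
  have hpt : ∀ p, 1 - Θ p / (2 * I.policies.card * (I.d + 1) * I.T) ≤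
      if I.GoodPrice D (I.strategy.stateAt W p) then (1 : ℝ) else 0 := by
    intro p
    have hden : 0 < 2 * I.policies.card * (I.d + 1) * (I.T : ℝ) := mul_pos hnum I.T_pos
    have hterm : ∀ π j, 0 ≤ Real.exp (1 * st π j p) * Real.exp (-(W * (2 * m π j))) +
        Real.exp (-1 * st π j p) * Real.exp (W * (1 / 2 * m π j)) := fun π j => by positivity
    have hrow : ∀ π, ∑ j, (Real.exp (1 * st π j p) * Real.exp (-(W * (2 * m π j))) +
        Real.exp (-1 * st π j p) * Real.exp (W * (1 / 2 * m π j))) ≤ Θ p := fun π =>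
      Finset.single_le_sum (f := fun π => ∑ j, (Real.exp (1 * st π j p) *
        Real.exp (-(W * (2 * m π j))) + Real.exp (-1 * st π j p) *
        Real.exp (W * (1 / 2 * m π j)))) (fun π _ => Finset.sum_nonneg fun j _ => hterm π j)
        (Finset.mem_univ π)
    have hΘ0 : 0 ≤ Θ p := Finset.sum_nonneg fun π _ => Finset.sum_nonneg fun j _ => hterm π j
    split_ifs with hg
    · linarith [div_nonneg hΘ0 hden.le]
    · rw [sub_nonpos, one_le_div hden]
      by_contra hlt
      push Not at hlt
      refine hg (h.goodPrice_of_close (fun π j => (total_mem le_rfl p π j).1) (fun π j => ?_)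
        fun π j => ?_)
      · by_contra hcon
        push Not at hcon
        have h1 : I.deviation < 1 * st π j p + -(W * (2 * m π j)) := by
          simp only [st, m]; linarith
        have h2 := Real.exp_lt_exp.2 h1
        rw [Real.exp_add, deviation, Real.exp_log hden] at h2
        have h3 := Finset.single_le_sum (fun j _ => hterm π j) (Finset.mem_univ j)
        have h4 := hrow π
        have h5 : 0 < Real.exp (-1 * st π j p) * Real.exp (W * (1 / 2 * m π j)) := by positivity
        linarith
      · by_contra hcon
        push Not at hcon
        have h1 : I.deviation < -1 * st π j p + W * (1 / 2 * m π j) := by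
          simp only [st, m]; linarith
        have h2 := Real.exp_lt_exp.2 h1
        rw [Real.exp_add, deviation, Real.exp_log hden] at h2
        have h3 := Finset.single_le_sum (fun j _ => hterm π j) (Finset.mem_univ j)
        have h4 := hrow π
        have h5 : 0 < Real.exp (1 * st π j p) * Real.exp (-(W * (2 * m π j))) := by positivity
        linarith
  have hgood : BddMeas fun p => if I.GoodPrice D (I.strategy.stateAt W p) then (1 : ℝ) else 0 :=
    .ite ((I.strategy.measurable_stateAt W) (measurableSet_goodPrice D)) (.const 1) (.const 0)
  have hmono := integral_mono (μ := μ) ((integrable_const 1).sub ((hΘ.integrable μ).div_const _))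
    (hgood.integrable μ) hpt
  refine le_trans ?_ hmono
  have hsplit : ∫ p, (1 - Θ p / (2 * I.policies.card * (I.d + 1) * I.T)) ∂μ =
      1 - (∫ p, Θ p ∂μ) / (2 * I.policies.card * (I.d + 1) * I.T) := by
    rw [integral_sub (integrable_const _) ((hΘ.integrable μ).div_const _), integral_div]
    simp
  refine le_trans ?_ hsplit.ge
  have h5 : (∫ p, Θ p ∂μ) / (2 * I.policies.card * (I.d + 1) * I.T) ≤ 1 / I.T := by
    rw [← div_div]
    exact div_le_div_of_nonneg_right ((div_le_one hnum).2 hEΘ) I.T_pos.le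
  linarith

end ResourcefulBandits.KnownData

end

noncomputable section

open MeasureTheory ResourcefulBandits

namespace ResourcefulBandits.KnownData

variable {X : Type u} [MeasurableSpace X] {I : KnownData X}

/-! ### The rounds after the warm-up -/

theorem stateAt_succ (t : ℕ) (p : I.strategy.Path) : I.strategy.stateAt (t + 1) p =
    I.nextState t (I.strategy.stateAt t p) (I.strategy.obsAt t p) :=
  I.strategy.stateAt_succ t p

theorem stateAt_snd {t : ℕ} (ht : t ≤ I.warmup) (p : I.strategy.Path) :
    (I.strategy.stateAt t p).2 = 0 := by
  induction t with
  | zero => rfl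
  | succ t ih => rw [stateAt_succ, nextState_warmup (by omega)]; exact ih (by omega)

theorem stateAt_fst {t : ℕ} (ht : I.warmup ≤ t) (p : I.strategy.Path) :
    (I.strategy.stateAt t p).1 = (I.strategy.stateAt I.warmup p).1 := by
  induction t, ht using Nat.le_induction with
  | base => rfl
  | succ t ht ih =>
    rw [stateAt_succ, ← ih]
    by_cases ha : I.Alive (I.strategy.stateAt t p)
    · rw [nextState_alive (not_lt.2 ht) ha]
    · rw [nextState_dead (not_lt.2 ht) ha]

theorem price_stateAt {t : ℕ} (ht : I.warmup ≤ t) (p : I.strategy.Path) :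
    I.price (I.strategy.stateAt t p) = I.price (I.strategy.stateAt I.warmup p) :=
  price_congr (stateAt_fst ht p)

theorem alive_of_succ {t : ℕ} (ht : I.warmup ≤ t) {p : I.strategy.Path}
    (ha : I.Alive (I.strategy.stateAt (t + 1) p)) : I.Alive (I.strategy.stateAt t p) := by
  by_contra hd
  rw [stateAt_succ, nextState_dead (not_lt.2 ht) hd] at ha
  exact hd ha

theorem clocked_time (σ : I.State) :
    I.clocked σ I.time = σ.2.2 I.time + 1 / I.mass σ * (I.minBudget / I.T) := by
  unfold clocked; rw [if_pos rfl]

theorem clocked_of_ne (σ : I.State) {i : Fin I.d} (hi : i ≠ I.time) :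
    I.clocked σ i = σ.2.2 i := by
  unfold clocked; rw [if_neg hi, add_zero]

/-- Virtual time runs at least almost as fast as the rounds. -/
theorem Regime.le_clock (h : I.Regime) {t : ℕ} (ht : I.warmup ≤ t) {p : I.strategy.Path}
    (ha : I.Alive (I.strategy.stateAt t p)) :
    ((t : ℝ) - I.warmup) * (1 / (1 + I.rate) * (I.minBudget / I.T)) ≤
      (I.strategy.stateAt t p).2.2 I.time := by
  induction t, ht using Nat.le_induction with
  | base => rw [stateAt_snd le_rfl]; simp
  | succ t ht ih =>
    have ha' := alive_of_succ ht ha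
    rw [stateAt_succ, nextState_alive (not_lt.2 ht) ha']
    simp only [clocked_time, I.scaledCon_time, add_zero]
    have h1 : 1 / (1 + I.rate) * (I.minBudget / I.T) ≤
        1 / I.mass (I.strategy.stateAt t p) * (I.minBudget / I.T) :=
      mul_le_mul_of_nonneg_right (one_div_le_one_div_of_le (h.mass_pos _) (mass_le _))
        (div_nonneg I.minBudget_pos.le I.T_pos.le)
    have h2 := ih ha'
    push_cast
    linarith

/-- The horizon ends after the virtual time is used up. -/
theorem Regime.not_alive_horizon (h : I.Regime) (hW : I.warmup ≤ I.T) (p : I.strategy.Path) :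
    ¬ I.Alive (I.strategy.stateAt I.T p) := by
  intro ha
  have h1 := h.le_clock hW ha
  have h2 := ha I.time
  have h3 := h1.trans_lt h2
  have hT := I.T_pos
  have hr := h.rate_pos
  have hB := I.minBudget_pos
  have hBT : I.minBudget / I.T ≤ 1 := (div_le_one hT).2 I.minBudget_le_T
  have e : ((I.T : ℝ) - I.warmup) * (1 / (1 + I.rate) * (I.minBudget / I.T)) =
      (I.minBudget - I.warmup * (I.minBudget / I.T)) / (1 + I.rate) := by
    field_simp
  rw [e, div_lt_iff₀ (by linarith)] at h3
  unfold innerBudget at h3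
  have hw : (0 : ℝ) ≤ I.warmup := Nat.cast_nonneg _
  have h4 := mul_le_of_le_one_right hw hBT
  nlinarith [mul_nonneg hr.le hw, mul_nonneg (mul_nonneg hr.le hr.le) hB.le]

theorem Regime.innerBudget_nonneg (h : I.Regime) : 0 ≤ I.innerBudget := by
  have h1 := h.large
  have h2 := h.warmup_le
  have h3 := h.one_le_scale
  have h4 : I.rate ≤ 1 / 400 := by
    rw [rate, div_le_iff₀ I.T_pos]; linarith [h.scale_le_T]
  have h5 := I.minBudget_pos
  unfold innerBudget
  nlinarith

/-- Virtual time overshoots by at most one step. -/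
theorem Regime.clock_le (h : I.Regime) {t : ℕ} (ht : I.warmup ≤ t) (p : I.strategy.Path) :
    (I.strategy.stateAt t p).2.2 I.time ≤ I.innerBudget + I.minBudget / I.regretScale := by
  have hstep : 0 ≤ I.minBudget / I.regretScale := div_nonneg I.minBudget_pos.le h.scale_pos.le
  induction t, ht using Nat.le_induction with
  | base =>
    rw [stateAt_snd le_rfl]
    exact add_nonneg h.innerBudget_nonneg hstep
  | succ t ht ih =>
    rw [stateAt_succ]
    by_cases ha : I.Alive (I.strategy.stateAt t p)
    · rw [nextState_alive (not_lt.2 ht) ha]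
      simp only [clocked_time, I.scaledCon_time, add_zero]
      refine add_le_add (ha I.time).le ?_
      have e : 1 / I.rate * (I.minBudget / I.T) = I.minBudget / I.regretScale := by
        rw [div_mul_div_comm, one_mul, h.rate_mul_T]
      rw [← e]
      exact mul_le_mul_of_nonneg_right (one_div_le_one_div_of_le h.rate_pos (rate_le_mass _))
        (div_nonneg I.minBudget_pos.le I.T_pos.le)
    · rw [nextState_dead (not_lt.2 ht) ha]
      exact ih

theorem sum_con_le {t : ℕ} (ht : I.warmup ≤ t) {p : I.strategy.Path}
    (ha : I.Alive (I.strategy.stateAt t p)) {i : Fin I.d} (hi : i ≠ I.time) :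
    ∑ m ∈ Finset.range t, I.scaledCon i (I.strategy.obsAt m p).2.2 ≤
      I.warmup + (I.strategy.stateAt t p).2.2 i := by
  induction t, ht using Nat.le_induction with
  | base =>
    rw [stateAt_snd le_rfl]
    have := Finset.sum_le_sum fun m (_ : m ∈ Finset.range I.warmup) =>
      (I.scaledCon_mem i (I.strategy.obsAt m p).2.2).2
    simpa using this
  | succ t ht ih =>
    have ha' := alive_of_succ ht ha
    rw [stateAt_succ, nextState_alive (not_lt.2 ht) ha', Finset.sum_range_succ]
    simp only [clocked_of_ne _ hi]
    linarith [ih ha']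

/-- As long as the algorithm considers itself alive, no budget is exceeded. -/
theorem Regime.withinBudget_of_alive (h : I.Regime) {t : ℕ} (ht : I.warmup ≤ t) (htT : t < I.T)
    {p : I.strategy.Path} (hp : ∀ t, I.Legal (p.2 t)) (ha : I.Alive (I.strategy.stateAt t p)) :
    I.strategy.toAlgorithm.WithinBudget I.budget p.1 p.2 t := by
  intro n hn i
  by_cases hi : i = I.time
  · subst hi
    have : ∀ m, I.strategy.toAlgorithm.consumption p.1 p.2 m I.time = 1 := fun m =>
      (hp m).2.2 _
    simp only [this, Finset.sum_const, Finset.card_range, nsmul_eq_mul, mul_one, I.budget_time]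
    exact_mod_cast (by omega : n + 1 ≤ I.T)
  · have hB := I.minBudget_pos
    have hb := I.budget_pos i
    have hc : ∀ m, I.strategy.toAlgorithm.consumption p.1 p.2 m i =
        I.scaledCon i (I.strategy.obsAt m p).2.2 * (I.budget i / I.minBudget) := by
      intro m
      have h1 := (hp m).scaledCon_eq (I.strategy.toAlgorithm.action p.1 p.2 m) hi
      change ((p.2 m).2 (I.strategy.toAlgorithm.action p.1 p.2 m)).2 i =
        I.scaledCon i ((p.2 m).2 (I.strategy.toAlgorithm.action p.1 p.2 m)) * _
      rw [h1]
      field_simp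
    simp only [hc, ← Finset.sum_mul]
    have h2 : ∑ m ∈ Finset.range (n + 1), I.scaledCon i (I.strategy.obsAt m p).2.2 ≤
        I.minBudget := by
      calc _ ≤ ∑ m ∈ Finset.range (t + 1), I.scaledCon i (I.strategy.obsAt m p).2.2 :=
            Finset.sum_le_sum_of_subset_of_nonneg (Finset.range_mono (by omega))
              fun m _ _ => (I.scaledCon_mem i _).1
        _ ≤ _ := by
            rw [Finset.sum_range_succ]
            have h3 := sum_con_le ht ha hi
            have h4 := ha i
            have h5 := (I.scaledCon_mem i (I.strategy.obsAt t p).2.2).2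
            unfold innerBudget at h4
            nlinarith [h.rate_pos]
    calc _ ≤ I.minBudget * (I.budget i / I.minBudget) :=
          mul_le_mul_of_nonneg_right h2 (div_nonneg hb.le hB.le)
      _ = I.budget i := mul_div_cancel₀ _ hB.ne'

/-! ### The potential at the start and at the end -/

theorem Regime.potential_start_le (h : I.Regime) (V : ℝ) (P : I.policies → ℝ) {σ : I.State}
    (hσ : σ.2 = 0) :
    I.potential V P σ ≤ (1 + 2 * I.price σ) * I.regretScale := by
  have hZ := price_nonneg σ
  have hS := h.scale_pos
  have hw : ∀ π, I.weight σ π = 1 := fun π => by unfold weight; rw [hσ]; simp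
  unfold potential
  simp only [hw, hσ, Prod.fst_zero, Prod.snd_zero, Pi.zero_apply, mul_zero,
    Real.exp_zero, Finset.sum_const, Finset.card_univ, Fintype.card_fin, Fintype.card_coe,
    nsmul_eq_mul, mul_one, zero_mul, sub_zero, add_zero]
  have h1 : I.K * (1 + I.price σ) / I.rate * Real.log (1 + I.policies.card) ≤
      (1 + I.price σ) * I.regretScale := by
    have e : I.K * (1 + I.price σ) / I.rate * Real.log (1 + I.policies.card) =
        (1 + I.price σ) * (I.T * I.K * Real.log (1 + I.policies.card) / I.regretScale) := by
      unfold rate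
      have := I.T_pos.ne'
      field_simp
    rw [e]
    refine mul_le_mul_of_nonneg_left ?_ (by linarith)
    rw [div_le_iff₀ hS, ← sq]
    exact h.log_card_le
  have h2 : I.price σ / I.rate * Real.log I.d ≤ I.price σ * I.regretScale := by
    have e : I.price σ / I.rate * Real.log I.d =
        I.price σ * (I.T * Real.log I.d / I.regretScale) := by
      unfold rate
      have := I.T_pos.ne'
      field_simp
    rw [e]
    refine mul_le_mul_of_nonneg_left ?_ hZ
    rw [div_le_iff₀ hS, ← sq]
    exact h.log_d_le
  linarith

theorem Regime.le_potential_end (h : I.Regime) {V : ℝ} {P : I.policies → ℝ} {σ : I.State}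
    (hP0 : ∀ π, 0 ≤ P π) (hP1 : ∑ π, P π ≤ 1) (hV0 : 0 ≤ V) (hV : V ≤ I.price σ * I.minBudget)
    (hdead : ¬ I.Alive σ)
    (hclock : σ.2.2 I.time ≤ I.innerBudget + I.minBudget / I.regretScale) :
    V * (I.innerBudget / I.minBudget) - (4 + 5 * I.price σ) * I.regretScale ≤
      I.potential V P σ := by
  have hZ := price_nonneg σ
  have hr := h.rate_pos
  have hS := h.scale_pos
  have hB := I.minBudget_pos
  have hη := h.eta_pos σ
  have hT := I.T_pos
  set Z := I.price σ
  set S := I.regretScale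
  have h1 : ∑ π, P π * σ.2.1 π ≤ I.K * (1 + Z) / I.rate * Real.log (1 + ∑ π, I.weight σ π) := by
    have h2 := sum_mul_le_log_one_add_sum_exp (l := fun π => I.eta σ * σ.2.1 π) hP0 hP1
    have e : ∑ π, P π * (I.eta σ * σ.2.1 π) = I.eta σ * ∑ π, P π * σ.2.1 π := by
      rw [Finset.mul_sum]; exact Finset.sum_congr rfl fun π _ => by ring
    rw [e] at h2
    have e2 : I.K * (1 + Z) / I.rate = 1 / I.eta σ := by unfold eta; rw [one_div_div]
    rw [e2, one_div_mul_eq_div, le_div_iff₀ hη, mul_comm]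
    exact h2
  have h2 : Z * I.innerBudget ≤ Z / I.rate * Real.log (∑ i, Real.exp (I.rate * σ.2.2 i)) := by
    unfold Alive at hdead
    push Not at hdead
    obtain ⟨i, hi⟩ := hdead
    have h3 := le_log_sum_exp (fun i => I.rate * σ.2.2 i) i
    have h4 : I.rate * I.innerBudget ≤ Real.log (∑ i, Real.exp (I.rate * σ.2.2 i)) :=
      (mul_le_mul_of_nonneg_left hi hr.le).trans h3
    calc Z * I.innerBudget = Z / I.rate * (I.rate * I.innerBudget) := by field_simp
      _ ≤ _ := mul_le_mul_of_nonneg_left h4 (div_nonneg hZ hr.le)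
  have hrT : I.rate * I.T = S := h.rate_mul_T
  have e3 : 2 * I.rate * (1 + Z) * I.T = 2 * S * (1 + Z) := by rw [← hrT]; ring
  have h5 : (I.innerBudget + I.minBudget / S) *
      ((V - Z * I.minBudget - 2 * S * (1 + Z)) / I.minBudget) ≤
      σ.2.2 I.time * ((V - Z * I.minBudget - 2 * I.rate * (1 + Z) * I.T) / I.minBudget) := by
    rw [e3]
    refine mul_le_mul_of_nonpos_right hclock (div_nonpos_of_nonpos_of_nonneg ?_ hB.le)
    have : 0 ≤ 2 * S * (1 + Z) := by positivity
    linarith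
  have e4 : (I.innerBudget + I.minBudget / S) *
      ((V - Z * I.minBudget - 2 * S * (1 + Z)) / I.minBudget) =
      V * (I.innerBudget / I.minBudget) - Z * I.innerBudget -
        2 * S * (1 + Z) * (I.innerBudget / I.minBudget) + V / S - Z * (I.minBudget / S) -
        2 * (1 + Z) := by
    field_simp
    ring
  have h6 : I.innerBudget / I.minBudget ≤ 1 := by
    rw [div_le_one hB]
    unfold innerBudget
    nlinarith [(Nat.cast_nonneg I.warmup : (0 : ℝ) ≤ I.warmup)]
  have h7 : 2 * S * (1 + Z) * (I.innerBudget / I.minBudget) ≤ 2 * S * (1 + Z) :=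
    mul_le_of_le_one_right (by positivity) h6
  have h8 : I.minBudget / S ≤ S := by
    rw [div_le_iff₀ hS, ← sq]
    exact I.minBudget_le_T.trans h.T_le_sq
  have h9 := mul_le_mul_of_nonneg_left h8 hZ
  have h10 : 0 ≤ V / S := div_nonneg hV0 hS.le
  have h11 : 2 * (1 + Z) ≤ 2 * (1 + Z) * S := le_mul_of_one_le_right (by linarith) h.one_le_scale
  unfold potential
  change _ ≤ I.K * (1 + Z) / I.rate * Real.log (1 + ∑ π, I.weight σ π) - ∑ π, P π * σ.2.1 π +
    Z / I.rate * _ +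
    σ.2.2 I.time * ((V - Z * I.minBudget - 2 * I.rate * (1 + Z) * I.T) / I.minBudget)
  linarith

/-! ### The regret -/

variable (I) in
open Classical in
/-- The indicator of the event that the price is good. -/
def goodIndicator (D : Measure (Outcome X I.K I.d)) (σ : I.State) : ℝ :=
  if I.GoodPrice D σ then 1 else 0

variable (I) in
/-- The surplus of a round, counted only if the price is good. -/
def gatedSurplus (D : Measure (Outcome X I.K I.d)) (V : ℝ) (P : I.policies → ℝ) (t : ℕ)
    (z : I.State × Observation X I.K I.d) : ℝ :=
  I.goodIndicator D z.1 * I.surplus V P t z.1 z.2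

theorem goodIndicator_mem (D : Measure (Outcome X I.K I.d)) (σ : I.State) :
    I.goodIndicator D σ ∈ Set.Icc (0 : ℝ) 1 := by
  unfold goodIndicator
  split_ifs <;> simp

theorem bddMeas_goodIndicator (D : Measure (Outcome X I.K I.d)) : BddMeas (I.goodIndicator D) := by
  classical
  exact .of_mem_Icc (Measurable.ite (measurableSet_goodPrice D) measurable_const measurable_const)
    (goodIndicator_mem D)

theorem goodIndicator_stateAt (D : Measure (Outcome X I.K I.d)) {t : ℕ} (ht : I.warmup ≤ t)
    (p : I.strategy.Path) : I.goodIndicator D (I.strategy.stateAt t p) =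
      I.goodIndicator D (I.strategy.stateAt I.warmup p) := by
  have hiff : I.GoodPrice D (I.strategy.stateAt t p) ↔
      I.GoodPrice D (I.strategy.stateAt I.warmup p) := by
    unfold GoodPrice
    rw [price_stateAt ht p]
  unfold goodIndicator
  by_cases h : I.GoodPrice D (I.strategy.stateAt I.warmup p)
  · rw [if_pos h, if_pos (hiff.2 h)]
  · rw [if_neg h, if_neg fun h' => h (hiff.1 h')]

theorem measurable_gatedSurplus (D : Measure (Outcome X I.K I.d)) (V : ℝ) (P : I.policies → ℝ)
    (t : ℕ) : Measurable (I.gatedSurplus D V P t) :=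
  ((bddMeas_goodIndicator D).1.comp measurable_fst).mul (measurable_surplus V P t)

theorem Regime.exists_abs_gatedSurplus_le (h : I.Regime) (D : Measure (Outcome X I.K I.d)) (V : ℝ)
    (P : I.policies → ℝ) (t : ℕ) : ∃ C, ∀ (p : I.strategy.Path) (o : Observation X I.K I.d),
      |I.gatedSurplus D V P t (I.strategy.stateAt t p, o)| ≤ C := by
  obtain ⟨C, hC⟩ := h.exists_abs_surplus_le V P t (t * I.stepBound)
  refine ⟨C, fun p o => ?_⟩
  have h1 := hC _ (h.boundedState_stateAt t p) o
  have h2 := goodIndicator_mem D (I.strategy.stateAt t p)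
  unfold gatedSurplus
  rw [abs_mul, abs_of_nonneg h2.1]
  exact (mul_le_of_le_one_left (abs_nonneg _) h2.2).trans h1

/-- If the price is good, the potential grows by the benchmark `V`, up to the regret. -/
theorem Regime.le_potential_sub (h : I.Regime) {D : Measure (Outcome X I.K I.d)} {V : ℝ}
    {P : I.policies → ℝ} {σ τ : I.State}
    (hP0 : ∀ π, 0 ≤ P π) (hP1 : ∑ π, P π ≤ 1) (hV0 : 0 ≤ V)
    (hV : V ≤ lpValue I.T I.minBudget (I.meanReward D) (I.meanCon D)) (hσ : σ.2 = 0)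
    (hστ : τ.1 = σ.1) (hg : I.GoodPrice D σ) (hdead : ¬ I.Alive τ)
    (hclock : τ.2.2 I.time ≤ I.innerBudget + I.minBudget / I.regretScale) :
    V - 292 * (1 + lpValue I.T I.minBudget (I.meanReward D) (I.meanCon D) / I.minBudget) *
        I.regretScale ≤
      I.potential V P τ - I.potential V P σ - I.price σ * I.regretScale := by
  set L := lpValue I.T I.minBudget (I.meanReward D) (I.meanCon D)
  set S := I.regretScale
  have hS := h.scale_pos
  have hB := I.minBudget_pos
  have hp : I.price τ = I.price σ := price_congr hστ
  have h1 := h.potential_start_le V P hσ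
  have h2 := h.le_potential_end hP0 hP1 hV0 (by rw [hp]; exact hV.trans hg.1) hdead hclock
  rw [hp] at h2
  have h3 : I.price σ ≤ 36 * (L / I.minBudget) + 7 := by
    have h4 : I.price σ ≤ (36 * L + 56 * S) / I.minBudget := (le_div_iff₀ hB).2 hg.2
    refine h4.trans ?_
    rw [add_div, mul_div_assoc]
    have : 56 * S / I.minBudget ≤ 7 := by
      rw [div_le_iff₀ hB]; linarith [h.large]
    linarith
  have h5 : V - 4 * (L / I.minBudget) * S ≤ V * (I.innerBudget / I.minBudget) := by
    have e : V * (I.innerBudget / I.minBudget) =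
        V - V * (I.rate + (I.warmup + 1) / I.minBudget) := by
      unfold innerBudget
      field_simp
      ring
    have h6 : I.rate ≤ S / I.minBudget :=
      div_le_div_of_nonneg_left hS.le hB I.minBudget_le_T
    have h7 : ((I.warmup : ℝ) + 1) / I.minBudget ≤ 3 * S / I.minBudget :=
      div_le_div_of_nonneg_right (by linarith [h.warmup_le, h.one_le_scale]) hB.le
    have h8 : V * (I.rate + (I.warmup + 1) / I.minBudget) ≤ L * (4 * S / I.minBudget) := by
      refine mul_le_mul hV ?_ ?_ (hV0.trans hV)
      · have : 4 * S / I.minBudget = S / I.minBudget + 3 * S / I.minBudget := by ring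
        linarith
      · have := h.rate_pos
        positivity
    have e2 : L * (4 * S / I.minBudget) = 4 * (L / I.minBudget) * S := by ring
    linarith
  have hZS := mul_le_mul_of_nonneg_right h3 hS.le
  have hx : 0 ≤ L / I.minBudget * S := by
    have := hV0.trans hV
    positivity
  linarith

variable {D : Measure (Outcome X I.K I.d)} [IsProbabilityMeasure D]

theorem Regime.bddMeas_gatedSurplus (h : I.Regime) (D : Measure (Outcome X I.K I.d)) (V : ℝ)
    (P : I.policies → ℝ) (t : ℕ) : BddMeas fun p : I.strategy.Path =>
      I.gatedSurplus D V P t (I.strategy.stateAt t p, I.strategy.obsAt t p) := by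
  obtain ⟨C, hC⟩ := h.exists_abs_gatedSurplus_le D V P t
  have hm : Measurable fun p : I.strategy.Path => (I.strategy.stateAt t p, I.strategy.obsAt t p) :=
    (I.strategy.measurable_stateAt t).prodMk (I.strategy.measurable_obsAt t)
  exact ⟨(measurable_gatedSurplus D V P t).comp hm, C, fun p => hC p (I.strategy.obsAt t p)⟩

theorem Regime.integral_gatedSurplus_nonneg (h : I.Regime) {P : I.policies → ℝ}
    (hP : LPFeasible I.T I.minBudget (I.meanCon D) P) {t : ℕ} (ht : ¬ t < I.warmup) :
    0 ≤ ∫ p, I.gatedSurplus D (I.T * ∑ π, P π * I.meanReward D π) P t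
      (I.strategy.stateAt t p, I.strategy.obsAt t p) ∂I.strategy.toAlgorithm.pathLaw D := by
  set V := (I.T : ℝ) * ∑ π, P π * I.meanReward D π
  have h1 := I.strategy.integral_step D t (fun p x a => h.actionProb_nonneg t _ x a)
    (fun p x => h.sum_actionProb t _ x) (measurable_gatedSurplus D V P t)
    (h.exists_abs_gatedSurplus_le D V P t)
  refine le_trans ?_ h1.ge
  refine integral_nonneg fun p => ?_
  have h2 := h.stepMean_surplus_nonneg hP ht (I.strategy.stateAt t p)
  have h3 : I.strategy.stepMean D t (I.strategy.stateAt t p) (fun o =>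
      I.gatedSurplus D V P t (I.strategy.stateAt t p, o)) =
      I.goodIndicator D (I.strategy.stateAt t p) * I.strategy.stepMean D t
        (I.strategy.stateAt t p) (I.surplus V P t (I.strategy.stateAt t p)) := by
    unfold Strategy.stepMean gatedSurplus
    rw [← integral_const_mul]
    refine integral_congr_ae (Filter.Eventually.of_forall fun o => ?_)
    dsimp only
    rw [Finset.mul_sum]
    exact Finset.sum_congr rfl fun a _ => by ring
  exact (mul_nonneg (goodIndicator_mem D _).1 h2).trans h3.ge

/-- The expected reward of the algorithm reaches every feasible point of the linear program. -/
theorem Regime.le_expectedReward (h : I.Regime) (hD : IsOutcomeDistribution I D)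
    {P : I.policies → ℝ} (hP : LPFeasible I.T I.minBudget (I.meanCon D) P) :
    I.T * ∑ π, P π * I.meanReward D π - 293 *
        (1 + lpValue I.T I.minBudget (I.meanReward D) (I.meanCon D) / I.minBudget) *
        I.regretScale ≤
      I.strategy.toAlgorithm.expectedReward I.T I.budget D := by
  classical
  set V := (I.T : ℝ) * ∑ π, P π * I.meanReward D π with hVdef
  set L := lpValue I.T I.minBudget (I.meanReward D) (I.meanCon D)
  set R := (1 + L / I.minBudget) * I.regretScale with hR
  set μ := I.strategy.toAlgorithm.pathLaw D
  have hT := I.T_pos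
  have hV0 : 0 ≤ V := mul_nonneg hT.le
    (Finset.sum_nonneg fun π _ => mul_nonneg (hP.1 π) (meanReward_mem π).1)
  have hVL : V ≤ L := hP.le_lpValue hT.le fun π => (meanReward_mem π).2
  have hVT : V ≤ I.T := hP.reward_le hT.le fun π => (meanReward_mem π).2
  have hR1 : 1 ≤ R := by
    have h1 : 0 ≤ L / I.minBudget := div_nonneg (hV0.trans hVL) I.minBudget_pos.le
    nlinarith [h.one_le_scale]
  have hW : I.warmup ≤ I.T := by
    have h1 := h.warmup_le
    have h2 := h.scale_le_T
    have h3 := h.one_le_scale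
    exact_mod_cast (by linarith : (I.warmup : ℝ) ≤ I.T)
  set G := I.goodIndicator D
  set q : ℕ → I.strategy.Path → ℝ := fun t p =>
    I.gatedSurplus D V P t (I.strategy.stateAt t p, I.strategy.obsAt t p)
  have hqb : ∀ t, BddMeas (q t) := fun t => h.bddMeas_gatedSurplus D V P t
  have hq : ∀ t ∈ Finset.Ico I.warmup I.T, 0 ≤ ∫ p, q t p ∂μ := fun t ht =>
    h.integral_gatedSurplus_nonneg hP (not_lt.2 (Finset.mem_Ico.1 ht).1)
  -- On every path the reward dominates the sum of the surpluses and the growth of the potential.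
  have hpath : ∀ p : I.strategy.Path, (∀ t, I.Legal (p.2 t)) →
      ∑ t ∈ Finset.Ico I.warmup I.T, q t p +
        G (I.strategy.stateAt I.warmup p) * (V - 292 * R) ≤
      I.strategy.toAlgorithm.totalReward I.T I.budget p.1 p.2 := by
    intro p hp
    have hrew : ∑ t ∈ Finset.Ico I.warmup I.T, (if I.Alive (I.strategy.stateAt t p) then
        unitClip (I.strategy.obsAt t p).2.2.1 else 0) ≤
        I.strategy.toAlgorithm.totalReward I.T I.budget p.1 p.2 := by
      rw [totalReward_eq _ hp]
      calc _ ≤ ∑ t ∈ Finset.Ico I.warmup I.T,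
            (if I.strategy.toAlgorithm.WithinBudget I.budget p.1 p.2 t then
              unitClip (I.strategy.toAlgorithm.reward p.1 p.2 t) else 0) := by
            refine Finset.sum_le_sum fun t ht => ?_
            obtain ⟨h1, h2⟩ := Finset.mem_Ico.1 ht
            by_cases ha : I.Alive (I.strategy.stateAt t p)
            · rw [if_pos ha, if_pos (h.withinBudget_of_alive h1 h2 hp ha)]
              exact le_rfl
            · rw [if_neg ha]
              split_ifs
              · exact (unitClip_mem _).1
              · exact le_rfl
        _ ≤ _ := by
            refine Finset.sum_le_sum_of_subset_of_nonneg (fun t ht =>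
              Finset.mem_range.2 (Finset.mem_Ico.1 ht).2) fun t _ _ => ?_
            split_ifs
            · exact (unitClip_mem _).1
            · exact le_rfl
    refine le_trans ?_ hrew
    have hrew0 : 0 ≤ ∑ t ∈ Finset.Ico I.warmup I.T, (if I.Alive (I.strategy.stateAt t p) then
        unitClip (I.strategy.obsAt t p).2.2.1 else 0) := Finset.sum_nonneg fun t _ => by
      split_ifs
      · exact (unitClip_mem _).1
      · exact le_rfl
    have hqsum : ∑ t ∈ Finset.Ico I.warmup I.T, q t p = G (I.strategy.stateAt I.warmup p) *
        ∑ t ∈ Finset.Ico I.warmup I.T,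
          I.surplus V P t (I.strategy.stateAt t p) (I.strategy.obsAt t p) := by
      rw [Finset.mul_sum]
      refine Finset.sum_congr rfl fun t ht => ?_
      simp only [q, gatedSurplus, G, goodIndicator_stateAt D (Finset.mem_Ico.1 ht).1 p]
    rw [hqsum]
    by_cases hg : I.GoodPrice D (I.strategy.stateAt I.warmup p)
    · have hG1 : G (I.strategy.stateAt I.warmup p) = 1 := if_pos hg
      rw [hG1, one_mul, one_mul]
      have htel : ∑ t ∈ Finset.Ico I.warmup I.T,
          I.surplus V P t (I.strategy.stateAt t p) (I.strategy.obsAt t p) =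
          ∑ t ∈ Finset.Ico I.warmup I.T, (if I.Alive (I.strategy.stateAt t p) then
            unitClip (I.strategy.obsAt t p).2.2.1 else 0) -
          (I.potential V P (I.strategy.stateAt I.T p) -
            I.potential V P (I.strategy.stateAt I.warmup p)) +
          ((I.T : ℝ) - I.warmup) * (I.price (I.strategy.stateAt I.warmup p) * I.rate) := by
        unfold surplus
        rw [Finset.sum_add_distrib, Finset.sum_sub_distrib]
        congr 1
        · congr 1
          simp only [← stateAt_succ]
          exact Finset.sum_Ico_sub (fun t => I.potential V P (I.strategy.stateAt t p)) hW
        · rw [Finset.sum_congr rfl fun t ht => by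
            rw [price_stateAt (Finset.mem_Ico.1 ht).1 p]]
          rw [Finset.sum_const, Nat.card_Ico, nsmul_eq_mul, Nat.cast_sub hW]
      have hend := h.le_potential_sub (P := P) hP.1 hP.2.1 hV0 hVL (stateAt_snd le_rfl p)
        (stateAt_fst hW p) hg (h.not_alive_horizon hW p) (h.clock_le hW p)
      have hloss : ((I.T : ℝ) - I.warmup) * (I.price (I.strategy.stateAt I.warmup p) * I.rate) ≤
          I.price (I.strategy.stateAt I.warmup p) * I.regretScale := by
        rw [← h.rate_mul_T]
        have h1 := mul_nonneg (price_nonneg (I.strategy.stateAt I.warmup p)) h.rate_pos.le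
        nlinarith [(Nat.cast_nonneg I.warmup : (0 : ℝ) ≤ I.warmup)]
      rw [htel]
      have e : 292 * (1 + L / I.minBudget) * I.regretScale = 292 * R := by rw [hR]; ring
      rw [e] at hend
      linarith
    · have hG0 : G (I.strategy.stateAt I.warmup p) = 0 := if_neg hg
      rw [hG0, zero_mul, zero_mul, add_zero]
      exact hrew0
  have hGW : BddMeas fun p : I.strategy.Path => G (I.strategy.stateAt I.warmup p) :=
    (bddMeas_goodIndicator D).comp (I.strategy.measurable_stateAt _)
  have hsumint : Integrable (fun p => ∑ t ∈ Finset.Ico I.warmup I.T, q t p) μ :=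
    integrable_finsetSum _ fun t _ => (hqb t).integrable μ
  have hGint : Integrable (fun p : I.strategy.Path =>
      G (I.strategy.stateAt I.warmup p) * (V - 292 * R)) μ := (hGW.integrable μ).mul_const _
  have hmain : (∫ p, G (I.strategy.stateAt I.warmup p) ∂μ) * (V - 292 * R) ≤
      I.strategy.toAlgorithm.expectedReward I.T I.budget D := by
    have h1 : ∫ p, (∑ t ∈ Finset.Ico I.warmup I.T, q t p +
        G (I.strategy.stateAt I.warmup p) * (V - 292 * R)) ∂μ ≤
        I.strategy.toAlgorithm.expectedReward I.T I.budget D := by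
      refine integral_mono_ae (hsumint.add hGint) (integrable_totalReward hD _) ?_
      filter_upwards [ae_legal hD I.strategy.toAlgorithm] with p hp
      exact hpath p hp
    rw [integral_add hsumint hGint, integral_mul_const, integral_finsetSum _ fun t _ =>
      (hqb t).integrable μ] at h1
    linarith [Finset.sum_nonneg hq]
  have hgood : 1 - 1 / (I.T : ℝ) ≤ ∫ p, G (I.strategy.stateAt I.warmup p) ∂μ :=
    h.integral_goodPrice
  have e : 293 * (1 + L / I.minBudget) * I.regretScale = 293 * R := by rw [hR]; ring
  rw [e]
  rcases le_total 0 (V - 292 * R) with h1 | h1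
  · have h2 := mul_le_mul_of_nonneg_right hgood h1
    have h3 : 1 / (I.T : ℝ) * (V - 292 * R) ≤ 1 := by
      rw [one_div_mul_eq_div, div_le_one hT]; linarith
    linarith
  · linarith [expectedReward_nonneg hD I.strategy.toAlgorithm]

/-- The regret bound against the benchmark, with `lpValue` eliminated. -/
theorem Regime.le_expectedReward_benchmark (h : I.Regime) (hD : IsOutcomeDistribution I D) :
    I.benchmark D - 400 * (1 + I.benchmark D / I.minBudget) * I.regretScale ≤
      I.strategy.toAlgorithm.expectedReward I.T I.budget D := by
  set E := I.strategy.toAlgorithm.expectedReward I.T I.budget D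
  set L := lpValue I.T I.minBudget (I.meanReward D) (I.meanCon D)
  set B := I.minBudget
  set S := I.regretScale
  have hB : 0 < B := I.minBudget_pos
  have hS : 1 ≤ S := h.one_le_scale
  have hBS : 400 * S ≤ B := h.large
  have hE : 0 ≤ E := expectedReward_nonneg hD _
  have hL : 0 ≤ L := lpValue_nonneg I.T_pos.le fun π => (meanReward_mem π).1
  have hO : 0 ≤ I.benchmark D := benchmark_nonneg hD
  have h1 : L ≤ E + 293 * (1 + L / B) * S := by
    refine Real.sSup_le ?_ (by positivity)
    rintro v ⟨P, hP, rfl⟩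
    linarith [h.le_expectedReward hD hP]
  have h2 : I.benchmark D ≤ (1 + 1 / B) * L := benchmark_le_lpValue hD
  set O := I.benchmark D
  have h3 : O / B - O / B / B ≤ L / B := by
    have : O * B ≤ (B + 1) * L := by
      have := mul_le_mul_of_nonneg_right h2 hB.le
      have e : (1 + 1 / B) * L * B = (B + 1) * L := by field_simp
      linarith
    have h4 : O * (B - 1) ≤ L * B := by
      refine le_of_mul_le_mul_right ?_ hB
      nlinarith [mul_le_mul_of_nonneg_right this (by linarith : 0 ≤ B - 1)]
    have e : O / B - O / B / B = O * (B - 1) / B / B := by field_simp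
    rw [e]
    exact div_le_div_of_nonneg_right ((div_le_iff₀ hB).2 h4) hB.le
  -- With `x = L / B` the bound `L - 293 (1 + x) S` is increasing in `L`.
  have eL : L = L / B * B := by field_simp
  have eO : O = O / B * B := by field_simp
  have eO2 : O / B = O / B / B * B := by field_simp
  set x := L / B
  set y := O / B
  set z := y / B
  have hz : 0 ≤ z := by positivity
  have hy : 0 ≤ y := by positivity
  have h4 : (y - z) * (B - 293 * S) ≤ x * (B - 293 * S) :=
    mul_le_mul_of_nonneg_right h3 (by linarith)
  have h5 : y * 1 ≤ y * S := mul_le_mul_of_nonneg_left hS hy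
  have h6 : 0 ≤ z * S := by positivity
  nlinarith

theorem totalReward_congr (alg alg' : Algorithm X I.K I.d) {s : alg.Seed} {s' : alg'.Seed}
    {ω : ℕ → Outcome X I.K I.d} (h : ∀ t, alg.action s ω t = alg'.action s' ω t) :
    alg.totalReward I.T I.budget s ω = alg'.totalReward I.T I.budget s' ω := by
  classical
  have h1 : ∀ t, alg.WithinBudget I.budget s ω t ↔ alg'.WithinBudget I.budget s' ω t := fun t => by
    simp only [Algorithm.WithinBudget, Algorithm.consumption, h]
  have h2 : ∀ t, alg.reward s ω t = alg'.reward s' ω t := fun t => by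
    simp only [Algorithm.reward, h]
  unfold Algorithm.totalReward
  exact Finset.sum_congr rfl fun t _ => if_congr (h1 t) (h2 t) rfl

/-- If there is only one action, all algorithms obtain the same reward. -/
theorem benchmark_le_of_subsingleton (hK : I.K ≤ 1) (alg : Algorithm X I.K I.d)
    (hE : 0 ≤ alg.expectedReward I.T I.budget D) :
    I.benchmark D ≤ alg.expectedReward I.T I.budget D := by
  have : Subsingleton (Fin I.K) := Fin.subsingleton_iff_le_one.2 hK
  refine Real.sSup_le ?_ hE
  rintro v ⟨alg', -, rfl⟩
  refine le_of_eq ?_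
  have hs : Nonempty alg.Seed := alg.seedLaw.nonempty_of_neZero
  obtain ⟨s⟩ := hs
  have key : ∀ (A : Algorithm X I.K I.d) (s' : A.Seed) ω, A.totalReward I.T I.budget s' ω =
      alg.totalReward I.T I.budget s ω := fun A s' ω =>
    totalReward_congr A alg fun t => Subsingleton.elim _ _
  unfold Algorithm.expectedReward
  simp only [key alg', key alg]
  rw [integral_fun_snd, integral_fun_snd]
  simp

end ResourcefulBandits.KnownData

end

open MeasureTheory ResourcefulBandits in
theorem theorem1 :
    ∃ (C : ℝ) (alg :
        ∀ (X : Type u) [MeasurableSpace X] (I : KnownData X), Algorithm X I.K I.d),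
      0 < C ∧
      ∀ (X : Type u) [MeasurableSpace X] (I : KnownData X)
        (D : Measure (Outcome X I.K I.d)) [IsProbabilityMeasure D],
        IsOutcomeDistribution I D →
          (alg X I).expectedReward I.T I.budget D ≥
            I.benchmark D - C * (1 + I.benchmark D / I.minBudget) *
              √((I.d : ℝ) * I.K * I.T *
                Real.log ((I.d : ℝ) * I.K * I.T * I.policies.card)) := by
  refine ⟨400, fun X _ I => I.strategy.toAlgorithm, by norm_num, fun X _ I D _ hD => ?_⟩
  change I.benchmark D - 400 * (1 + I.benchmark D / I.minBudget) * I.regretScale ≤ _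
  have hE := expectedReward_nonneg hD I.strategy.toAlgorithm
  have hO := benchmark_nonneg hD
  have hB := I.minBudget_pos
  have hS : 0 ≤ I.regretScale := Real.sqrt_nonneg _
  by_cases hK : I.K ≤ 1
  · have h1 := KnownData.benchmark_le_of_subsingleton hK I.strategy.toAlgorithm hE
    have h2 : 0 ≤ 400 * (1 + I.benchmark D / I.minBudget) * I.regretScale := by positivity
    linarith
  by_cases hL : 400 * I.regretScale ≤ I.minBudget
  · exact KnownData.Regime.le_expectedReward_benchmark ⟨by omega, hL⟩ hD
  · -- The right-hand side is not positive.
    refine le_trans ?_ hE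
    have h1 : I.benchmark D ≤ I.benchmark D / I.minBudget * (400 * I.regretScale) := by
      calc I.benchmark D = I.benchmark D / I.minBudget * I.minBudget := by field_simp
        _ ≤ _ := mul_le_mul_of_nonneg_left (not_le.1 hL).le (div_nonneg hO hB.le)
    nlinarith
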